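/- Let $\mathcal H$ be the upper half plane, $q=e^{2\pi i z}$, and let $\Gamma_1(12)$ be the group of matrices $\begin{pmatrix}a&b\\c&d\end{pmatrix}\in\mathrm{SL}_2(\mathbb Z)$ with $c\equiv 0$ and $a\equiv d\equiv 1 \pmod{12}$. For $\gamma=\begin{pmatrix}a&b\\c&d\end{pmatrix}\in\Gamma_1(12)$ put $J(\gamma,z)=\left(\frac cd\right)(cz+d)^{1/2}$, with the Kronecker symbol and the principal square root. For $\kappa\in\frac12\mathbb Z_{\ge 0}$ let $M_\kappa(12,1)$ be the complex vector space of holomorphic functions $f:\mathcal H\to\mathbb C$ with $J(\gamma,z)^{-2\kappa}f(\gamma z)=f(z)$ for all $\gamma\in\Gamma_1(12)$, $z\in\mathcal H$, that are holomorphic at all cusps, i.e. for every $\begin{pmatrix}a&b\\c&d\end{pmatrix}\in\mathrm{SL}_2(\mathbb Z)$ the function $(cz+d)^{-\kappa}f\!\left(\frac{az+b}{cz+d}\right)$ is bounded as $\operatorname{Im} z\to\infty$ (for integral $\kappa$ this is the usual space of modular forms of weight $\kappa$ for $\Gamma_1(12)$). For a function $f$ on $\mathcal H$ and $h\in\mathbb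 Z_{\ge1}$ write $f^{\langle h\rangle}(z)=f(hz)$. Put $$\vartheta=\sum_{n\in\mathbb Z}q^{n^2},\qquad \vartheta_{\langle3\rangle}=\tfrac12\big(\vartheta-\vartheta^{\langle3\rangle}\big),\qquad \mathrm f=1+6\sum_{n\ge1}\Big(\sum_{d\mid n}\rho_3(d)\Big)q^n,$$ where $\rho_3$ is the nontrivial Dirichlet character modulo $3$, and $$\alpha_6=\tfrac16\big(\mathrm f-\mathrm f^{\langle2\rangle}\big),\quad \alpha_{12}=\alpha_6+\alpha_6^{\langle2\rangle},\quad u_{12}=\mathrm f^{\langle4\rangle}+6\alpha_{12}+12\alpha_6^{\langle2\rangle},\quad v_{12}=\mathrm f^{\langle4\rangle}-2\alpha_{12}+4\alpha_6^{\langle2\rangle}.$$ Then the following hold. 1. The sum of the subspaces $M_\kappa(12,1)$, $\kappa\in\frac12\mathbb Z_{\ge0}$, of the space of functions on $\mathcal H$ is direct, so that $M_{\frac12\mathbb N}(12,1)=\bigoplus_{\kappa\in\frac12\mathbb Z_{\ge0}}M_\kappa(12,1)$ is a graded ring of functions. 2. For every integer $k\ge0$, $$M_{k+\frac12}(12,1)=\mathbb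 C\,\vartheta^{2k+1}\oplus M_k(12,1)\,\vartheta_{\langle3\rangle}.$$ 3. We have $\vartheta,\vartheta^{\langle3\rangle}\in M_{1/2}(12,1)$ and $u_{12},v_{12}\in M_1(12,1)$. Let $\mathbb C[X_0,X_1,X_2,X_3]$ be graded by giving $X_0,X_1,X_2,X_3$ the degrees $\frac12,\frac12,1,1$. Then there is an isomorphism of graded $\mathbb C$-algebras $$\mathbb C[X_0,X_1,X_2,X_3]\big/\big(X_0^3-X_1X_2,\;X_1^3-X_0X_3,\;X_0^2X_1^2-X_2X_3\big)\;\simeq\;M_{\frac12\mathbb N}(12,1)$$ that sends $X_0,X_1,X_2,X_3$ to $\vartheta,\vartheta^{\langle3\rangle},u_{12},v_{12}$ respectively. -/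

import Mathlib

open UpperHalfPlane CongruenceSubgroup MvPolynomial
open scoped MatrixGroups Manifold DirectSum ModularForm

noncomputable section

namespace HalfIntegral

/-- The Kronecker symbol `(c / d)`, for odd `d`. -/
def kronecker (c d : ℤ) : ℤ :=
  (if c < 0 ∧ d < 0 then -1 else 1) * jacobiSym c d.natAbs

/-- `(cz + d)^(1/2)` with the principal square root, where `(c, d)` is the lower row of `γ`. -/
def sqrtDenom (γ : SL(2, ℤ)) (z : ℍ) : ℂ :=
  (((γ 1 0 : ℤ) : ℂ) * (z : ℂ) + ((γ 1 1 : ℤ) : ℂ)) ^ (1 / 2 : ℂ)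

/-- The automorphic factor `J(γ, z) = (c / d) (cz + d)^(1/2)`, used for `γ ∈ Γ₁(4)`. -/
def J (γ : SL(2, ℤ)) (z : ℍ) : ℂ :=
  (kronecker (γ 1 0) (γ 1 1) : ℂ) * sqrtDenom γ z

/-- The space `M_{m/2}(Γ)` of modular forms of weight `m/2` for a congruence subgroup `Γ ≤ Γ₁(4)`:
holomorphic functions `f` on the upper half plane with `J(γ, z)^{-m} f(γ z) = f z` for `γ ∈ Γ`
that are holomorphic at every cusp, i.e. for each `α ∈ SL₂(ℤ)` with lower row `(c, d)` the function
`(cz + d)^{-m/2} f(α z)` is bounded as `Im z → ∞`. -/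
def M (Γ : Subgroup SL(2, ℤ)) (m : ℕ) : Submodule ℂ (ℍ → ℂ) where
  carrier := {f | MDiff f ∧
    (∀ γ ∈ Γ, ∀ z : ℍ, (J γ z ^ m)⁻¹ * f (γ • z) = f z) ∧
    ∀ α : SL(2, ℤ), IsBoundedAtImInfty fun z : ℍ => (sqrtDenom α z ^ m)⁻¹ * f (α • z)}
  zero_mem' := by
    refine ⟨mdifferentiable_const, by simp, fun α => ?_⟩
    simpa using! zero_form_isBoundedAtImInfty
  add_mem' := by
    rintro f g ⟨hf, hf', hf''⟩ ⟨hg, hg', hg''⟩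
    refine ⟨hf.add hg, fun γ hγ z => ?_, fun α => ?_⟩
    · rw [Pi.add_apply, Pi.add_apply, mul_add, hf' γ hγ, hg' γ hγ]
    · simpa only [Pi.add_apply, mul_add] using! (hf'' α).add (hg'' α)
  smul_mem' := by
    rintro a f ⟨hf, hf', hf''⟩
    refine ⟨hf.const_smul a, fun γ hγ z => ?_, fun α => ?_⟩
    · rw [Pi.smul_apply, Pi.smul_apply, mul_smul_comm, hf' γ hγ]
    · simpa only [Pi.smul_apply, mul_smul_comm] using! (hf'' α).smul a

instance (Γ : Subgroup SL(2, ℤ)) : SetLike.GradedMonoid (M Γ) where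
  one_mem := by
    refine ⟨mdifferentiable_const, by simp, fun α => ?_⟩
    simpa using! Filter.const_boundedAtFilter atImInfty (1 : ℂ)
  mul_mem := by
    rintro m n f g ⟨hf, hf', hf''⟩ ⟨hg, hg', hg''⟩
    refine ⟨hf.mul hg, fun γ hγ z => ?_, fun α => ?_⟩
    · rw [Pi.mul_apply, Pi.mul_apply, pow_add, mul_inv, mul_mul_mul_comm, hf' γ hγ, hg' γ hγ]
    · have h := (hf'' α).mul (hg'' α)
      refine h.congr_left fun z => ?_
      simp only [Pi.mul_apply]
      rw [pow_add, mul_inv, mul_mul_mul_comm]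

lemma sqrtDenom_sq (γ : SL(2, ℤ)) (z : ℍ) :
    sqrtDenom γ z ^ 2 = ((γ 1 0 : ℤ) : ℂ) * (z : ℂ) + ((γ 1 1 : ℤ) : ℂ) := by
  rw [sqrtDenom, ← Complex.cpow_nat_mul]
  norm_num

lemma J_sq (γ : SL(2, ℤ)) (z : ℍ) :
    J γ z ^ 2 = ((γ 1 0 : ℤ) : ℂ) * (z : ℂ) + ((γ 1 1 : ℤ) : ℂ) := by
  have h : kronecker (γ 1 0) (γ 1 1) ^ 2 = 1 := by
    have hc : Int.gcd (γ 1 0) ((γ 1 1).natAbs : ℤ) = 1 := by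
      have hd := γ.det_coe
      rw [Matrix.det_fin_two] at hd
      have hg : Int.gcd (γ 1 0) (γ 1 1) = 1 :=
        Int.isCoprime_iff_gcd_eq_one.mp ⟨-γ 0 1, γ 0 0, by linarith⟩
      simpa only [Int.gcd, Int.natAbs_natCast] using hg
    rw [kronecker, mul_pow, jacobiSym.sq_one hc]
    split_ifs <;> simp
  rw [J, mul_pow, sqrtDenom_sq, ← Int.cast_pow, h]
  simp

/-- In even degree `2k`, the space `M (Γ₁(N)) (2k)` is the usual space of modular forms of weight `k`. -/
theorem mem_M_even (N : ℕ) [NeZero N] (k : ℕ) (f : ℍ → ℂ) :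
    f ∈ M (Gamma1 N) (2 * k) ↔
      ∃ g : ModularForm ((Gamma1 N).map (Matrix.SpecialLinearGroup.mapGL ℝ)) k, ⇑g = f := by
  have key : ∀ (f : ℍ → ℂ) (α : SL(2, ℤ)) (z : ℍ),
      (f ∣[(k : ℤ)] α) z =
        ((((α 1 0 : ℤ) : ℂ) * (z : ℂ) + ((α 1 1 : ℤ) : ℂ)) ^ k)⁻¹ * f (α • z) := by
    intro f α z
    rw [ModularForm.SL_slash_apply, mul_comm, zpow_neg, zpow_natCast]
    simp [denom]
  constructor
  · rintro ⟨h1, h2, h3⟩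
    refine ⟨⟨⟨f, ?_⟩, h1, ?_⟩, rfl⟩
    · rintro _ ⟨γ, hγ, rfl⟩
      funext z
      have := key f γ z
      rw [← J_sq, ← pow_mul, h2 γ hγ z] at this
      exact this
    · intro c hc
      rw [Subgroup.IsArithmetic.isCusp_iff_isCusp_SL2Z] at hc
      rw [OnePoint.isBoundedAt_iff_forall_SL2Z hc]
      intro γ _
      refine (h3 γ).congr_left fun z => ?_
      rw [pow_mul, sqrtDenom_sq]
      exact (key f γ z).symm
  · rintro ⟨g, rfl⟩
    refine ⟨g.holo', fun γ hγ z => ?_, fun α => ?_⟩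
    · rw [pow_mul, J_sq, ← key]
      exact congrFun (g.slash_action_eq' _ ⟨γ, hγ, rfl⟩) z
    · have := ModularFormClass.bdd_at_infty_slash g α
      refine this.congr_left fun z => ?_
      rw [pow_mul, sqrtDenom_sq]
      exact key g α z

/-- `f^⟨h⟩(z) = f(hz)`. -/
def dilate (h : ℕ+) (f : ℍ → ℂ) : ℍ → ℂ :=
  fun z => f ⟨((h : ℕ) : ℂ) * (z : ℂ), by
    have h0 : (0 : ℝ) < ((h : ℕ) : ℝ) := by exact_mod_cast h.pos
    simpa using mul_pos h0 z.im_pos⟩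

/-- `ϑ = ∑_{n ∈ ℤ} q^{n²}`, `q = e^{2πiz}`. -/
def theta : ℍ → ℂ :=
  fun z => ∑' n : ℤ, Complex.exp (2 * Real.pi * Complex.I * (n : ℂ) ^ 2 * (z : ℂ))

/-- `ϑ_⟨3⟩ = (ϑ - ϑ^⟨3⟩) / 2`. -/
def thetaSub : ℍ → ℂ :=
  (1 / 2 : ℂ) • (theta - dilate 3 theta)

/-- The weight one Eisenstein series `f_{ρ₃} = 1 + 6 ∑_{n ≥ 1} (∑_{d ∣ n} ρ₃(d)) q^n`, where
`ρ₃` is the nontrivial character modulo `3`. -/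
def fRho : ℍ → ℂ :=
  fun z => 1 + 6 * ∑' n : ℕ+,
    (∑ d ∈ (n : ℕ).divisors, (legendreSym 3 (d : ℤ) : ℂ)) *
      Complex.exp (2 * Real.pi * Complex.I * ((n : ℕ) : ℂ) * (z : ℂ))

/-- `α₆ = (f_{ρ₃} - f_{ρ₃}^⟨2⟩) / 6`. -/
def alpha6 : ℍ → ℂ :=
  (1 / 6 : ℂ) • (fRho - dilate 2 fRho)

/-- `α₁₂ = α₆ + α₆^⟨2⟩`. -/
def alpha12 : ℍ → ℂ :=
  alpha6 + dilate 2 alpha6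

/-- `u₁₂ = f_{ρ₃}^⟨4⟩ + 6 α₁₂ + 12 α₆^⟨2⟩`. -/
def u12 : ℍ → ℂ :=
  dilate 4 fRho + (6 : ℂ) • alpha12 + (12 : ℂ) • dilate 2 alpha6

/-- `v₁₂ = f_{ρ₃}^⟨4⟩ - 2 α₁₂ + 4 α₆^⟨2⟩`. -/
def v12 : ℍ → ℂ :=
  dilate 4 fRho - (2 : ℂ) • alpha12 + (4 : ℂ) • dilate 2 alpha6

/-- The four generators `ϑ, ϑ^⟨3⟩, u₁₂, v₁₂`. -/
def gen : Fin 4 → ℍ → ℂ :=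
  ![theta, dilate 3 theta, u12, v12]

/-- Twice the weights `1/2, 1/2, 1, 1` of the generators. -/
def wt : Fin 4 → ℕ :=
  ![1, 1, 2, 2]

/-- The ideal of relations `(O_{12a}, O_{12b}, O_{12c})` in `ℂ[X₀, X₁, X₂, X₃]`. -/
def relIdeal : Ideal (MvPolynomial (Fin 4) ℂ) :=
  Ideal.span {X 0 ^ 3 - X 1 * X 2, X 1 ^ 3 - X 0 * X 3, X 0 ^ 2 * X 1 ^ 2 - X 2 * X 3}

/-- The graded ring `⨁_{κ ∈ ½ℕ} M_κ(Γ)`; the component of index `m` has weight `κ = m/2`. -/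
abbrev FormRing (Γ : Subgroup SL(2, ℤ)) : Type :=
  ⨁ m : ℕ, M Γ m

end HalfIntegral

end

/-! Write s, t, u, v for `theta`, `dilate 3 theta`, `u12`, `v12` and x = t/s for `hauptmodul`; index
m means weight m/2. Everything follows from one description: for r ≤ 1 the forms of weight k + r/2
are, near i∞, exactly the s^r u^k p(x) with p a polynomial of degree at most 4k + r, and p is unique
(`exists_formOfPoly`, `eq_zero_of_formOfPoly_eq_zero`).

The upper bound is a valence argument: taking norms to level one, and squaring when the weight is
half-integral, a form of index m that vanishes at i∞ to order more than 2m is zero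
(`eq_zero_of_isBigO`). Identities between forms thus reduce to finitely many q-coefficients. This
proves ut = s^3 and vs = t^3, and uv = s^2 t^2 follows by cancellation. Hence u = s^2/x and v = s^2
x^3, so every monomial of index 2k + r in the generators is some s^r u^k x^n with 0 ≤ n ≤ 4k + r,
and each such n occurs (`normalForm`). Since 1 - x has a simple zero at i∞, the forms u^k (1 - x)^j
realise the orders 0, ..., 4k, and elimination exhausts the even index 2k. In odd index, fs =
u^(k+1) p(x) and f^2 = u^(2k+1) r(x) with s^2 = ux give p^2 = x r; so x divides p, and s can be
divided out.

The decomposition in half-integral weight is p = p(1) x^k + (1 - x) p2, because s^(2k+1) = s u^k x^k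
and `thetaSub` = s(1 - x)/2. For the presentation, the relations bring a weighted homogeneous
polynomial to a combination of normal forms whose coefficients are those of some p, and its value is
zero only if p = 0. The weights are independent because J(γ, z) takes infinitely many values at
fixed z.

It remains to see that the generators are forms. For s and t this rests on Jacobi's inversion
formula and generators of Γ₁(4). For u and v it rests on the behaviour of `fRho` under z ↦ -1/(3z),
obtained by summing a double series in two orders against the quasi-modular G2. -/

noncomputable section

namespace HalfIntegral

open Filter Asymptotics Topology

/-! ### q-expansions and orders of vanishing at i∞. -/

/-- The parameter `q = e^{2πiz}` at the cusp `i∞`. -/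
def qp (z : ℍ) : ℂ := Function.Periodic.qParam 1 (z : ℂ)

lemma qp_eq (z : ℍ) : qp z = Complex.exp (2 * Real.pi * Complex.I * (z : ℂ)) := by
  simp [qp, Function.Periodic.qParam]

lemma qp_pow (z : ℍ) (n : ℕ) :
    qp z ^ n = Complex.exp (2 * Real.pi * Complex.I * (n : ℂ) * (z : ℂ)) := by
  rw [qp_eq, ← Complex.exp_nat_mul]
  ring_nf

lemma qp_ne_zero (z : ℍ) : qp z ≠ 0 := Function.Periodic.qParam_ne_zero _

lemma norm_qp_lt_one (z : ℍ) : ‖qp z‖ < 1 :=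
  Function.Periodic.norm_qParam_lt_one one_pos z.im_pos

lemma tendsto_qp : Tendsto qp atImInfty (𝓝 0) := qParam_tendsto_atImInfty one_pos

lemma isBigO_qp_pow {m n : ℕ} (h : m ≤ n) :
    (fun z => qp z ^ n) =O[atImInfty] fun z => qp z ^ m := by
  refine IsBigO.of_bound 1 (Eventually.of_forall fun z => ?_)
  rw [one_mul, norm_pow, norm_pow]
  exact pow_le_pow_of_le_one (norm_nonneg _) (norm_qp_lt_one z).le h

lemma _root_.UpperHalfPlane.IsBoundedAtImInfty.isBigO_one {g : ℍ → ℂ} (hg : IsBoundedAtImInfty g) :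
    g =O[atImInfty] fun _ => (1 : ℂ) :=
  IsBigO.trans hg (isBigO_const_const (1 : ℝ) one_ne_zero _)

/-- Truncation of a `q`-expansion. -/
lemma isBigO_sub_sum_of_hasSum {f : ℍ → ℂ} {c : ℕ → ℂ}
    (hf : ∀ z, HasSum (fun m => c m * qp z ^ m) (f z)) (n : ℕ) :
    (fun z => f z - ∑ m ∈ Finset.range n, c m * qp z ^ m) =O[atImInfty] fun z => qp z ^ n := by
  set g : ℍ → ℂ := fun z => (f z - ∑ m ∈ Finset.range n, c m * qp z ^ m) / qp z ^ n with hg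
  have hgs : ∀ z, HasSum (fun m => c (m + n) • qp z ^ m) (g z) := by
    intro z
    have h := ((hasSum_nat_add_iff' n).mpr (hf z)).div_const (qp z ^ n)
    refine h.congr_fun fun m => ?_
    rw [smul_eq_mul, pow_add]
    field_simp [qp_ne_zero z]
  have hb : IsBoundedAtImInfty g := isBoundedAtImInfty_of_hasSum_qExpansion one_pos hgs
  have := hb.isBigO_one.mul (isBigO_refl (fun z => qp z ^ n) atImInfty)
  refine (this.congr_left fun z => ?_).congr_right fun z => ?_
  · simp only [hg]
    field_simp [qp_ne_zero z]
  · simp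

lemma eq_zero_of_isBigO_qp {c : ℂ} {n : ℕ}
    (h : (fun z => c * qp z ^ n) =O[atImInfty] fun z => qp z ^ (n + 1)) : c = 0 := by
  have h1 : (fun _ : ℍ => c) =O[atImInfty] qp := by
    have := h.mul (isBigO_refl (fun z => (qp z ^ n)⁻¹) atImInfty)
    refine (this.congr_left fun z => ?_).congr_right fun z => ?_
    · field_simp [qp_ne_zero z]
    · rw [pow_succ]
      field_simp [qp_ne_zero z]
  have h2 := h1.trans_tendsto tendsto_qp
  exact tendsto_nhds_unique tendsto_const_nhds h2

lemma coeff_eq_zero_of_isBigO {f : ℍ → ℂ} {c : ℕ → ℂ}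
    (hf : ∀ z, HasSum (fun m => c m * qp z ^ m) (f z)) {n : ℕ}
    (h : f =O[atImInfty] fun z => qp z ^ n) : ∀ i < n, c i = 0 := by
  intro i
  induction i using Nat.strong_induction_on with
  | _ i ih =>
    intro hi
    have h1 := isBigO_sub_sum_of_hasSum hf (i + 1)
    have h2 := (h.trans (isBigO_qp_pow (Nat.succ_le_of_lt hi))).sub h1
    refine eq_zero_of_isBigO_qp (n := i) (h2.congr_left fun z => ?_)
    rw [sub_sub_cancel, Finset.sum_range_succ, Finset.sum_eq_zero, zero_add]
    intro m hm
    rw [ih m (Finset.mem_range.mp hm) ((Finset.mem_range.mp hm).trans hi), zero_mul]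

lemma le_order_qExpansion_of_isBigO {k : ℤ} (F : ModularForm 𝒮ℒ k) {n : ℕ}
    (h : (F : ℍ → ℂ) =O[atImInfty] fun z => qp z ^ n) : (n : ℕ∞) ≤ (qExpansion 1 F).order := by
  refine PowerSeries.nat_le_order _ _ fun i hi => ?_
  refine coeff_eq_zero_of_isBigO (f := F) (c := fun m => (qExpansion 1 F).coeff m) (fun z => ?_) h i hi
  simpa [qp] using ModularForm.hasSum_qExpansion (h := 1) F one_pos (by simp) z

/-! ### The index of Γ₁(12) and the valence bound. -/

/-- The columns modulo `12` that occur as first columns of matrices of determinant one. -/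
def colMod : Type := {p : ZMod 12 × ZMod 12 //
  ¬ (6 * p.1 = 0 ∧ 6 * p.2 = 0) ∧ ¬ (4 * p.1 = 0 ∧ 4 * p.2 = 0)}

/-- The two conditions exclude columns divisible by 2 and by 3 respectively, which leaves 12²(1 -
1/4)(1 - 1/9). -/
lemma card_colMod : Nat.card colMod = 96 := by
  rw [colMod, Nat.card_eq_fintype_card]
  decide +kernel

lemma det_mod (N : ℕ) (γ : SL(2, ℤ)) :
    (γ 0 0 : ZMod N) * (γ 1 1 : ZMod N) - (γ 0 1 : ZMod N) * (γ 1 0 : ZMod N) = 1 := by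
  have h := γ.det_coe
  rw [Matrix.det_fin_two] at h
  exact_mod_cast congrArg (Int.cast : ℤ → ZMod N) h

/-- The first column of a matrix, modulo `12`. -/
def firstCol (γ : SL(2, ℤ)) : colMod := by
  refine ⟨((γ 0 0 : ZMod 12), (γ 1 0 : ZMod 12)), ?_, ?_⟩
  · rintro ⟨h1, h2⟩
    have h := det_mod 12 γ
    have : (6 : ZMod 12) = 0 := by
      linear_combination (γ 1 1 : ZMod 12) * h1 - (γ 0 1 : ZMod 12) * h2 - 6 * h
    exact absurd this (by decide)
  · rintro ⟨h1, h2⟩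
    have h := det_mod 12 γ
    have : (4 : ZMod 12) = 0 := by
      linear_combination (γ 1 1 : ZMod 12) * h1 - (γ 0 1 : ZMod 12) * h2 - 4 * h
    exact absurd this (by decide)

lemma inv_mul_mem_of_firstCol_eq {α β : SL(2, ℤ)} (h : firstCol α = firstCol β) :
    α⁻¹ * β ∈ Gamma1 12 := by
  have h0 := congrArg (fun p => p.1.1) h
  have h1 := congrArg (fun p => p.1.2) h
  simp only [firstCol] at h0 h1
  have hα := det_mod 12 α
  have hβ := det_mod 12 β
  rw [Gamma1_mem]
  simp only [Matrix.SpecialLinearGroup.coe_mul, Matrix.SpecialLinearGroup.coe_inv,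
    Matrix.adjugate_fin_two, Matrix.mul_apply, Fin.sum_univ_two, Matrix.of_apply, Matrix.cons_val',
    Matrix.cons_val_zero, Matrix.cons_val_one, Matrix.cons_val_fin_one, Int.cast_add, Int.cast_mul,
    Int.cast_neg]
  refine ⟨?_, ?_, ?_⟩
  · linear_combination -(α 1 1 : ZMod 12) * h0 + (α 0 1 : ZMod 12) * h1 + hα
  · linear_combination -(β 0 1 : ZMod 12) * h1 + (β 1 1 : ZMod 12) * h0 + hβ
  · linear_combination (α 1 0 : ZMod 12) * h0 - (α 0 0 : ZMod 12) * h1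

/-- The first column modulo 12 separates left cosets. An upper bound is all that the valence
argument needs, so surjectivity onto columns plays no role. -/
lemma index_Gamma1_twelve_le : (Gamma1 12).index ≤ 96 := by
  rw [← card_colMod, Subgroup.index]
  have : Finite colMod := Nat.finite_of_card_ne_zero (by rw [card_colMod]; norm_num)
  refine Nat.card_le_card_of_injective (fun x => firstCol x.out) fun x y hxy => ?_
  have := inv_mul_mem_of_firstCol_eq hxy
  rwa [← QuotientGroup.eq, QuotientGroup.out_eq', QuotientGroup.out_eq'] at this

/-- The image of `Γ₁(12)` in `GL₂(ℝ)`. -/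
abbrev Gamma1Twelve : Subgroup (GL (Fin 2) ℝ) :=
  (Gamma1 12).map (Matrix.SpecialLinearGroup.mapGL ℝ)

lemma card_quotient_le : Nat.card (𝒮ℒ ⧸ Gamma1Twelve.subgroupOf 𝒮ℒ) ≤ 96 := by
  have h : Gamma1Twelve.relIndex 𝒮ℒ = (Gamma1 12).index := by
    rw [MonoidHom.range_eq_map, ← Subgroup.relIndex_top_right]
    exact Subgroup.relIndex_map_map_of_injective _ _ Matrix.SpecialLinearGroup.mapGL_injective
  exact (h.trans_le index_Gamma1_twelve_le)

/-- A modular form on `Γ₁(12)` of weight `k` that vanishes at `i∞` to order more than `4k` is zero. -/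
lemma eq_zero_of_isBigO_weight {k n : ℕ} (g : ModularForm Gamma1Twelve (k : ℤ))
    (hn : 4 * k < n) (hg : (g : ℍ → ℂ) =O[atImInfty] fun z => qp z ^ n) : (g : ℍ → ℂ) = 0 := by
  rw [← ModularForm.norm_eq_zero_iff (ℋ := 𝒮ℒ)]
  set N := Nat.card (𝒮ℒ ⧸ Gamma1Twelve.subgroupOf 𝒮ℒ) with hN
  -- The norm has weight at most 96k, so level one allows order at most 8k. Its order is at least
  -- 2n: since -1 is not in Γ₁(12), the cosets of 1 and -1 are distinct, and each contributes n.
  refine ModularForm.sturm_bound_levelOne (lt_of_lt_of_le ?_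
    (le_order_qExpansion_of_isBigO (n := 2 * n) _ ?_))
  · have : ((k : ℤ) * N).toNat = k * N := by rw [← Nat.cast_mul, Int.toNat_natCast]
    rw [this]
    have h1 : k * N ≤ k * 96 := Nat.mul_le_mul_left _ card_quotient_le
    exact_mod_cast show k * N / 12 < 2 * n by omega
  · let := Fintype.ofFinite (𝒮ℒ ⧸ Gamma1Twelve.subgroupOf 𝒮ℒ)
    let a : 𝒮ℒ ⧸ Gamma1Twelve.subgroupOf 𝒮ℒ := QuotientGroup.mk 1
    let m1 : 𝒮ℒ := ⟨Matrix.SpecialLinearGroup.mapGL ℝ (-1 : SL(2, ℤ)), ⟨-1, rfl⟩⟩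
    let b : 𝒮ℒ ⧸ Gamma1Twelve.subgroupOf 𝒮ℒ := QuotientGroup.mk m1
    have hab : a ≠ b := by
      intro h
      rw [QuotientGroup.eq, Subgroup.mem_subgroupOf] at h
      simp only [inv_one, one_mul, m1] at h
      obtain ⟨γ, hγ, h⟩ := h
      rw [Matrix.SpecialLinearGroup.mapGL_injective h] at hγ
      rw [SetLike.mem_coe, Gamma1_mem] at hγ
      have := hγ.1
      simp at this
      exact absurd this (by decide)
    have hqa : SlashInvariantForm.quotientFunc g a =O[atImInfty] fun z => qp z ^ n := by
      have : SlashInvariantForm.quotientFunc g a = g := by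
        refine (SlashInvariantForm.quotientFunc_mk g 1).trans ?_
        simp
      rwa [this]
    have hqb : SlashInvariantForm.quotientFunc g b =O[atImInfty] fun z => qp z ^ n := by
      have h1 : SlashInvariantForm.quotientFunc g b = (g : ℍ → ℂ) ∣[(k : ℤ)] (m1 : GL (Fin 2) ℝ)⁻¹ :=
        SlashInvariantForm.quotientFunc_mk g m1
      have h2 : ∀ z, ‖SlashInvariantForm.quotientFunc g b z‖ = ‖g z‖ := by
        intro z
        rw [h1]
        have : (m1 : GL (Fin 2) ℝ)⁻¹ = Matrix.SpecialLinearGroup.mapGL ℝ (-1 : SL(2, ℤ)) := by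
          simp only [m1, ← map_inv]
          congr 1
          exact inv_eq_of_mul_eq_one_left (by simp)
        rw [this]
        have := ModularForm.SL_slash_apply (k := (k : ℤ)) (g : ℍ → ℂ) (-1 : SL(2, ℤ)) z
        refine (congrArg norm this).trans ?_
        simp [denom]
      exact (IsBigO.of_norm_left (hg.norm_left.congr_left fun z => (h2 z).symm))
    have hq : ∀ x : 𝒮ℒ ⧸ Gamma1Twelve.subgroupOf 𝒮ℒ, SlashInvariantForm.quotientFunc g x =O[atImInfty] fun z => (1 : ℂ) := by
      intro x
      induction x using QuotientGroup.induction_on with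
      | H r =>
        obtain ⟨_, α, rfl⟩ := r
        have h := ModularFormClass.bdd_at_infty_slash g α⁻¹
        let r : 𝒮ℒ := ⟨Matrix.SpecialLinearGroup.mapGL ℝ α, ⟨α, rfl⟩⟩
        have h1 : SlashInvariantForm.quotientFunc g
            (QuotientGroup.mk r : 𝒮ℒ ⧸ Gamma1Twelve.subgroupOf 𝒮ℒ) =
            (g : ℍ → ℂ) ∣[(k : ℤ)] (Matrix.SpecialLinearGroup.mapGL ℝ α)⁻¹ :=
          SlashInvariantForm.quotientFunc_mk g _
        rw [← map_inv] at h1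
        refine IsBigO.congr_left ?_ fun z => (congrFun h1 z).symm
        exact IsBoundedAtImInfty.isBigO_one h
    rw [ModularForm.coe_norm]
    classical
    have key : (fun z => ∏ x : 𝒮ℒ ⧸ Gamma1Twelve.subgroupOf 𝒮ℒ, SlashInvariantForm.quotientFunc g x z) =O[atImInfty]
        fun z => ∏ x : 𝒮ℒ ⧸ Gamma1Twelve.subgroupOf 𝒮ℒ, (if x = a ∨ x = b then qp z ^ n else 1) := by
      refine IsBigO.finsetProd fun x _ => ?_
      by_cases hx : x = a ∨ x = b
      · simp only [hx, if_true]
        rcases hx with rfl | rfl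
        · exact hqa
        · exact hqb
      · simpa only [hx, if_false] using hq x
    refine (key.congr_left fun z => ?_).congr_right fun z => ?_
    · rw [Finset.prod_apply]
    · rw [Finset.prod_ite, Finset.prod_const_one, mul_one, Finset.prod_const]
      have : (Finset.univ.filter fun x => x = a ∨ x = b) = {a, b} := by
        ext; simp
      rw [this, Finset.card_pair hab, ← pow_mul, mul_comm]

/-- A form of weight `m/2` on `Γ₁(12)` that vanishes at `i∞` to order more than `2m` is zero. -/
theorem eq_zero_of_isBigO {m : ℕ} {f : ℍ → ℂ} (hf : f ∈ M (Gamma1 12) m)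
    (h : f =O[atImInfty] fun z => qp z ^ (2 * m + 1)) : f = 0 := by
  -- The square has integral weight m and order at least 4m + 2, which exceeds 4m.
  have h2 : f * f ∈ M (Gamma1 12) (2 * m) := two_mul m ▸ SetLike.mul_mem_graded hf hf
  obtain ⟨g, hg⟩ := (mem_M_even 12 m _).mp h2
  have h3 : (g : ℍ → ℂ) = 0 := by
    refine eq_zero_of_isBigO_weight (n := 4 * m + 2) g (by omega) ?_
    rw [hg]
    refine (h.mul h).congr_right fun z => ?_
    rw [← pow_add]
    ring_nf
  rw [hg] at h3
  funext z
  simpa using congrFun h3 z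

/-! ### Generators of Γ₁(3) and Γ₁(4). -/

/-- The matrix with rows `(1, 0)` and `(n, 1)`. -/
def U (n : ℤ) : SL(2, ℤ) := ⟨!![1, 0; n, 1], by simp⟩

@[simp] lemma U_apply_zero_zero (n : ℤ) : U n 0 0 = 1 := rfl
@[simp] lemma U_apply_zero_one (n : ℤ) : U n 0 1 = 0 := rfl
@[simp] lemma U_apply_one_zero (n : ℤ) : U n 1 0 = n := rfl
@[simp] lemma U_apply_one_one (n : ℤ) : U n 1 1 = 1 := rfl

lemma U_eq_conj (n : ℤ) : U n = ModularGroup.S * ModularGroup.T ^ (-n) * ModularGroup.S⁻¹ := by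
  rw [eq_mul_inv_iff_mul_eq]
  ext i j
  rw [Matrix.SpecialLinearGroup.coe_mul, Matrix.SpecialLinearGroup.coe_mul,
    ModularGroup.coe_T_zpow, ModularGroup.coe_S]
  fin_cases i <;> fin_cases j <;> simp [U, Matrix.mul_apply, Fin.sum_univ_two]

lemma U_zpow (n i : ℤ) : U n ^ i = U (n * i) := by
  rw [U_eq_conj, conj_zpow, ← zpow_mul, neg_mul, ← U_eq_conj]

lemma exists_two_mul_abs_add_mul_le (a : ℤ) {b : ℤ} (hb : b ≠ 0) :
    ∃ j : ℤ, 2 * |a + j * b| ≤ |b| := by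
  have hb' : 0 < b.natAbs := Int.natAbs_pos.mpr hb
  have h1 := Int.le_bmod (x := a) hb'
  have h2 := Int.bmod_le (x := a) hb'
  have h3 : (b : ℤ) ∣ Int.bmod a b.natAbs - a := by
    rw [← Int.natAbs_dvd]
    exact Int.ModEq.dvd (Int.bmod_emod (x := a)).symm
  obtain ⟨j, hj⟩ := h3
  refine ⟨j, ?_⟩
  have h4 : a + j * b = Int.bmod a b.natAbs := by linarith [mul_comm b j]
  rw [h4, Int.abs_eq_natAbs b]
  rcases abs_cases (Int.bmod a b.natAbs) with ⟨h, _⟩ | ⟨h, _⟩ <;> rw [h] <;> omega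

lemma T_mem_Gamma1 (N : ℕ) : ModularGroup.T ∈ Gamma1 N := by
  rw [Gamma1_mem]
  simp [ModularGroup.T]

lemma U_mem_Gamma1 (N : ℕ) : U N ∈ Gamma1 N := by
  rw [Gamma1_mem]
  simp

lemma mem_Gamma1_iff (N : ℕ) (γ : SL(2, ℤ)) : γ ∈ Gamma1 N ↔
    (N : ℤ) ∣ γ 0 0 - 1 ∧ (N : ℤ) ∣ γ 1 1 - 1 ∧ (N : ℤ) ∣ γ 1 0 := by
  rw [Gamma1_mem, ← ZMod.intCast_zmod_eq_zero_iff_dvd, ← ZMod.intCast_zmod_eq_zero_iff_dvd,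
    ← ZMod.intCast_zmod_eq_zero_iff_dvd]
  simp [sub_eq_zero]

lemma eq_T_zpow_of_mem_Gamma1 {N : ℕ} (hN : 3 ≤ N) {γ : SL(2, ℤ)} (hγ : γ ∈ Gamma1 N)
    (hc : γ 1 0 = 0) : γ = ModularGroup.T ^ (γ 0 1) := by
  obtain ⟨ha, hd, -⟩ := (mem_Gamma1_iff N γ).mp hγ
  have hdet := γ.det_coe
  rw [Matrix.det_fin_two, hc, mul_zero, sub_zero] at hdet
  have hN' : (3 : ℤ) ≤ N := by exact_mod_cast hN
  have h1 : γ 0 0 = 1 ∧ γ 1 1 = 1 := by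
    rcases Int.mul_eq_one_iff_eq_one_or_neg_one.mp hdet with h | ⟨h, h'⟩
    · exact h
    · rw [h] at ha
      have := Int.le_of_dvd (by norm_num) ((Int.dvd_neg).mpr ha)
      omega
  ext i j
  rw [ModularGroup.coe_T_zpow]
  fin_cases i <;> fin_cases j <;> simp [h1.1, h1.2, hc]

/-- `Γ₁(3)` and `Γ₁(4)` are generated by two unipotent matrices. -/
lemma closure_T_U {N : ℕ} (hN : N = 3 ∨ N = 4) :
    Subgroup.closure {ModularGroup.T, U N} = Gamma1 N := by
  set H := Subgroup.closure {ModularGroup.T, U N} with hH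
  have hT : ModularGroup.T ∈ H := Subgroup.subset_closure (by simp)
  have hU : U N ∈ H := Subgroup.subset_closure (by simp)
  refine le_antisymm ?_ ?_
  · rw [hH, Subgroup.closure_le]
    rintro _ (rfl | rfl)
    · exact T_mem_Gamma1 N
    · exact U_mem_Gamma1 N
  suffices ∀ n : ℕ, ∀ γ ∈ Gamma1 N, (γ 1 0).natAbs = n → γ ∈ H from fun γ hγ => this _ γ hγ rfl
  intro n
  induction n using Nat.strong_induction_on with
  | _ n ih =>
    intro γ hγ hn
    by_cases hc : γ 1 0 = 0
    · rw [eq_T_zpow_of_mem_Gamma1 (by omega) hγ hc]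
      exact zpow_mem hT _
    obtain ⟨j, hj⟩ := exists_two_mul_abs_add_mul_le (γ 1 1) hc
    obtain ⟨ha, hd, hcN⟩ := (mem_Gamma1_iff N γ).mp hγ
    set d := γ 1 1 + j * γ 1 0 with hd'
    have hdN : (N : ℤ) ∣ d - 1 := by
      have : d - 1 = (γ 1 1 - 1) + j * γ 1 0 := by rw [hd']; ring
      rw [this]
      exact dvd_add hd (hcN.mul_left _)
    have hd0 : d ≠ 0 := by
      intro h
      rw [h] at hdN
      rcases hN with rfl | rfl <;> omega
    have hNd : (N : ℤ) * d ≠ 0 := mul_ne_zero (by rcases hN with rfl | rfl <;> norm_num) hd0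
    obtain ⟨i, hi⟩ := exists_two_mul_abs_add_mul_le (γ 1 0) hNd
    set δ := γ * ModularGroup.T ^ j * U N ^ i with hδ
    have hδmem : δ ∈ Gamma1 N :=
      mul_mem (mul_mem hγ (zpow_mem (T_mem_Gamma1 N) _)) (zpow_mem (U_mem_Gamma1 N) _)
    have hδc : δ 1 0 = γ 1 0 + i * (N * d) := by
      rw [hδ, U_zpow]
      simp only [Matrix.SpecialLinearGroup.coe_mul, ModularGroup.coe_T_zpow, Matrix.mul_apply,
        Fin.sum_univ_two]
      simp [hd']
      ring
    -- Euclidean descent on |c|: the power of T gives 2|d| ≤ |c|, the power of U gives 2|c'| ≤ N|d|,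
    -- so |c'| ≤ N|c|/4. For N = 4 this alone is not strict; there c' = 4e with 2|e| ≤ |d| and d
    -- odd, hence 2|e| < |d|.
    have hlt : (δ 1 0).natAbs < n := by
      obtain ⟨e, he⟩ := ((mem_Gamma1_iff N δ).mp hδmem).2.2
      obtain ⟨w, hw⟩ := hdN
      rw [← hδc] at hi
      rw [abs_mul, Int.abs_eq_natAbs d, Int.abs_eq_natAbs (δ 1 0)] at hi
      rw [Int.abs_eq_natAbs d, Int.abs_eq_natAbs (γ 1 0)] at hj
      rcases hN with rfl | rfl
      · simp only [Nat.cast_ofNat] at *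
        rw [show |(3 : ℤ)| = 3 by norm_num] at hi
        omega
      · simp only [Nat.cast_ofNat] at *
        rw [show |(4 : ℤ)| = 4 by norm_num] at hi
        omega
    have := ih _ hlt δ hδmem rfl
    rw [hδ] at this
    exact (H.mul_mem_cancel_right (zpow_mem hT j)).mp
      ((H.mul_mem_cancel_right (zpow_mem hU i)).mp this)

/-! ### Periodicity of the Kronecker symbol in its lower argument. -/

section Kronecker

lemma jacobiSym_four_mul (e : ℤ) {b : ℕ} (hb : Odd b) : jacobiSym (4 * e) b = jacobiSym e b := by
  rw [jacobiSym.mul_left, jacobiSym.at_four hb, one_mul]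

lemma jacobiSym_eq_of_modEq {e : ℤ} {b b' : ℕ} (hb : Odd b) (hb' : Odd b')
    (h : b ≡ b' [MOD 4 * e.natAbs]) : jacobiSym (4 * e) b = jacobiSym (4 * e) b' := by
  rw [jacobiSym_four_mul e hb, jacobiSym_four_mul e hb', jacobiSym.mod_right e hb,
    jacobiSym.mod_right e hb', h]

/-- For e > 0 the symbol is even in the lower argument modulo 4e: 4e - 1 represents -1, and (4e / 4e
- 1) = (1 / 4e - 1) = 1. -/
lemma jacobiSym_eq_of_add_dvd {e : ℕ} (he : 0 < e) {b b' : ℕ} (hb : Odd b) (hb' : Odd b')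
    (h : 4 * e ∣ b + b') : jacobiSym (4 * e) b = jacobiSym (4 * e) b' := by
  have ho : Odd (4 * e - 1) := ⟨2 * e - 1, by omega⟩
  have h1 : jacobiSym (4 * e) (4 * e - 1 : ℕ) = 1 := by
    rw [← jacobiSym.one_left (4 * e - 1)]
    apply jacobiSym.mod_left'
    rw [show (4 * e : ℤ) = 1 + ((4 * e - 1 : ℕ) : ℤ) by omega, Int.add_emod_right]
  have : NeZero (4 * e - 1) := ⟨by omega⟩
  have : NeZero b := ⟨by rintro rfl; simp at hb⟩
  have h2 : jacobiSym (4 * e) ((4 * e - 1) * b) = jacobiSym (4 * e) b' := by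
    refine jacobiSym_eq_of_modEq (ho.mul hb) hb' ?_
    rw [Int.natAbs_natCast]
    have h3 : (4 * e - 1) * b + b = 4 * e * b := by
      obtain ⟨n, hn⟩ : ∃ n, 4 * e = n + 1 := ⟨4 * e - 1, by omega⟩
      rw [hn, Nat.add_sub_cancel]
      ring
    refine Nat.ModEq.add_right_cancel' b ?_
    rw [h3, add_comm b']
    exact (Nat.modEq_zero_iff_dvd.mpr (dvd_mul_right _ _)).trans (Nat.modEq_zero_iff_dvd.mpr h).symm
  rw [← h2, jacobiSym.mul_right, h1, one_mul]

lemma jacobiSym_neg_left (a : ℤ) {b : ℕ} (hb : b % 4 = 1) : jacobiSym (-a) b = jacobiSym a b := by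
  rw [jacobiSym.neg a (Nat.odd_iff.mpr (by omega)), ZMod.χ₄_nat_one_mod_four hb, one_mul]

lemma jacobiSym_neg_left' (a : ℤ) {b : ℕ} (hb : b % 4 = 3) : jacobiSym (-a) b = -jacobiSym a b := by
  rw [jacobiSym.neg a (Nat.odd_iff.mpr (by omega)), ZMod.χ₄_nat_three_mod_four hb, neg_one_mul]

/-- The sign convention matters when c < 0 and d changes sign: then |c + d| ≡ 3 while d ≡ 1 modulo
4, and the factor (-1 / |c + d|) = -1 compensates the explicit sign. -/
lemma kronecker_add_right {c d : ℤ} (hc : 4 ∣ c) (hd : 4 ∣ d - 1) :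
    kronecker c (c + d) = kronecker c d := by
  obtain ⟨e, rfl⟩ := hc
  have hod : Odd d.natAbs := Nat.odd_iff.mpr (by omega)
  have hod' : Odd (4 * e + d).natAbs := Nat.odd_iff.mpr (by omega)
  unfold kronecker
  rcases lt_trichotomy e 0 with he | rfl | he
  · rcases lt_or_gt_of_ne (show d ≠ 0 by omega) with hd0 | hd0
    · rw [if_pos ⟨by omega, by omega⟩, if_pos ⟨by omega, by omega⟩, jacobiSym_eq_of_modEq hod' hod]
      exact Nat.modEq_iff_dvd.mpr ⟨-1, by omega⟩
    · rw [if_neg (c := _ ∧ d < 0) (by omega)]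
      rcases lt_or_gt_of_ne (show 4 * e + d ≠ 0 by omega) with hd1 | hd1
      · rw [if_pos ⟨by omega, by omega⟩]
        have h1 := jacobiSym_neg_left' (4 * e) (b := (4 * e + d).natAbs) (by omega)
        have h2 := jacobiSym_neg_left (4 * e) (b := d.natAbs) (by omega)
        have h3 := jacobiSym_eq_of_add_dvd (e := e.natAbs) (by omega) hod hod' ⟨1, by omega⟩
        rw [show (4 : ℤ) * (e.natAbs : ℤ) = -(4 * e) by omega] at h3
        rw [neg_one_mul, one_mul, ← h1, ← h2, h3]
      · rw [if_neg (by omega), jacobiSym_eq_of_modEq hod' hod]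
        exact Nat.modEq_iff_dvd.mpr ⟨1, by omega⟩
  · simp
  · rw [if_neg (by omega), if_neg (by omega)]
    rcases lt_or_gt_of_ne (show d ≠ 0 by omega) with hd0 | hd0
    · rcases lt_or_gt_of_ne (show 4 * e + d ≠ 0 by omega) with hd1 | hd1
      · rw [jacobiSym_eq_of_modEq hod' hod]
        exact Nat.modEq_iff_dvd.mpr ⟨1, by omega⟩
      · have h3 := jacobiSym_eq_of_add_dvd (e := e.natAbs) (by omega) hod' hod ⟨1, by omega⟩
        rw [show (4 : ℤ) * (e.natAbs : ℤ) = 4 * e by omega] at h3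
        rw [h3]
    · rw [jacobiSym_eq_of_modEq hod' hod]
      exact Nat.modEq_iff_dvd.mpr ⟨-1, by omega⟩

lemma jacobiSym_add_four_mul (c d : ℤ) :
    jacobiSym (c + 4 * d) d.natAbs = jacobiSym c d.natAbs := by
  apply jacobiSym.mod_left'
  refine Int.ModEq.symm (Int.modEq_iff_dvd.mpr ?_)
  rw [add_sub_cancel_left]
  exact (Int.natAbs_dvd.mpr dvd_rfl).mul_left 4

end Kronecker

/-! ### Multiplicativity of the principal square root, up to an explicit sign. -/

section SquareRoot

lemma re_cpow_half_nonneg (z : ℂ) : 0 ≤ (z ^ (1 / 2 : ℂ)).re := by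
  rcases eq_or_ne z 0 with rfl | hz
  · simp
  rw [Complex.cpow_def_of_ne_zero hz, Complex.exp_re]
  refine mul_nonneg (Real.exp_pos _).le (Real.cos_nonneg_of_mem_Icc ?_)
  have : (Complex.log z * (1 / 2)).im = z.arg / 2 := by
    rw [show (1 / 2 : ℂ) = ((1 / 2 : ℝ) : ℂ) by norm_num, Complex.im_mul_ofReal, Complex.log_im]
    ring
  rw [this]
  constructor <;> linarith [Complex.neg_pi_lt_arg z, Complex.arg_le_pi z]

lemma cpow_half_sq (z : ℂ) : (z ^ (1 / 2 : ℂ)) ^ 2 = z := by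
  rw [← Complex.cpow_nat_mul]
  norm_num

lemma re_im_cpow_half (z : ℂ) : (z ^ (1 / 2 : ℂ)).re ^ 2 - (z ^ (1 / 2 : ℂ)).im ^ 2 = z.re ∧
    2 * ((z ^ (1 / 2 : ℂ)).re * (z ^ (1 / 2 : ℂ)).im) = z.im := by
  have h := cpow_half_sq z
  constructor
  · have := congrArg Complex.re h
    rw [sq, Complex.mul_re] at this
    nlinarith
  · have := congrArg Complex.im h
    rw [sq, Complex.mul_im] at this
    nlinarith

lemma cpow_half_of_im_pos {z : ℂ} (hz : 0 < z.im) :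
    0 < (z ^ (1 / 2 : ℂ)).re ∧ 0 < (z ^ (1 / 2 : ℂ)).im := by
  have h1 := re_cpow_half_nonneg z
  have h2 := (re_im_cpow_half z).2
  have h3 : 0 < (z ^ (1 / 2 : ℂ)).re := by
    refine lt_of_le_of_ne h1 fun h => ?_
    rw [← h] at h2
    linarith
  refine ⟨h3, ?_⟩
  by_contra h
  nlinarith

lemma cpow_half_of_im_neg {z : ℂ} (hz : z.im < 0) :
    0 < (z ^ (1 / 2 : ℂ)).re ∧ (z ^ (1 / 2 : ℂ)).im < 0 := by
  have h1 := re_cpow_half_nonneg z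
  have h2 := (re_im_cpow_half z).2
  have h3 : 0 < (z ^ (1 / 2 : ℂ)).re := by
    refine lt_of_le_of_ne h1 fun h => ?_
    rw [← h] at h2
    linarith
  refine ⟨h3, ?_⟩
  by_contra h
  nlinarith

/-- Both sides square to ab. The lemmas below decide the sign from the quadrant in which the roots
lie. -/
lemma cpow_half_mul_eq_or (a b : ℂ) : (a * b) ^ (1 / 2 : ℂ) = a ^ (1 / 2 : ℂ) * b ^ (1 / 2 : ℂ) ∨
    (a * b) ^ (1 / 2 : ℂ) = -(a ^ (1 / 2 : ℂ) * b ^ (1 / 2 : ℂ)) := by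
  rw [← sq_eq_sq_iff_eq_or_eq_neg, mul_pow, cpow_half_sq, cpow_half_sq, cpow_half_sq]

lemma cpow_half_mul_of_re_pos {a b : ℂ}
    (h : 0 < (a ^ (1 / 2 : ℂ) * b ^ (1 / 2 : ℂ)).re) :
    (a * b) ^ (1 / 2 : ℂ) = a ^ (1 / 2 : ℂ) * b ^ (1 / 2 : ℂ) := by
  refine (cpow_half_mul_eq_or a b).resolve_right fun h' => ?_
  have := re_cpow_half_nonneg (a * b)
  rw [h', Complex.neg_re] at this
  linarith

lemma cpow_half_mul_of_im_neg {a b : ℂ} (ha : a.im < 0) (hb : 0 < b.im) :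
    (a * b) ^ (1 / 2 : ℂ) = a ^ (1 / 2 : ℂ) * b ^ (1 / 2 : ℂ) := by
  have h1 := cpow_half_of_im_neg ha
  have h2 := cpow_half_of_im_pos hb
  refine cpow_half_mul_of_re_pos ?_
  rw [Complex.mul_re]
  nlinarith [mul_pos h1.1 h2.1, mul_pos (neg_pos.mpr h1.2) h2.2]

lemma cpow_half_mul_of_im_pos {a b : ℂ} (ha : 0 < a.im) (hb : 0 < b.im) :
    0 < (a ^ (1 / 2 : ℂ) * b ^ (1 / 2 : ℂ)).im := by
  have h1 := cpow_half_of_im_pos ha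
  have h2 := cpow_half_of_im_pos hb
  rw [Complex.mul_im]
  nlinarith [mul_pos h1.1 h2.2, mul_pos h1.2 h2.1]

lemma cpow_half_mul_of_im_pos_of_im_pos {a b : ℂ} (ha : 0 < a.im) (hb : 0 < b.im)
    (hab : 0 < (a * b).im) : (a * b) ^ (1 / 2 : ℂ) = a ^ (1 / 2 : ℂ) * b ^ (1 / 2 : ℂ) := by
  refine (cpow_half_mul_eq_or a b).resolve_right fun h' => ?_
  have h1 := (cpow_half_of_im_pos hab).2
  rw [h', Complex.neg_im] at h1
  linarith [cpow_half_mul_of_im_pos ha hb]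

/-- The arguments add up to more than π, so the branch cut is crossed. This is the sign that the
Kronecker symbol has to absorb. -/
lemma cpow_half_mul_of_im_pos_of_im_neg {a b : ℂ} (ha : 0 < a.im) (hb : 0 < b.im)
    (hab : (a * b).im < 0) : (a * b) ^ (1 / 2 : ℂ) = -(a ^ (1 / 2 : ℂ) * b ^ (1 / 2 : ℂ)) := by
  refine (cpow_half_mul_eq_or a b).resolve_left fun h' => ?_
  have h1 := (cpow_half_of_im_neg hab).2
  rw [h'] at h1
  linarith [cpow_half_mul_of_im_pos ha hb]

lemma cpow_half_mul_of_pos_of_pos {a b : ℂ} (ha : 0 < a.re) (hb : 0 < b.re) :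
    (a * b) ^ (1 / 2 : ℂ) = a ^ (1 / 2 : ℂ) * b ^ (1 / 2 : ℂ) := by
  refine cpow_half_mul_of_re_pos ?_
  have key : ∀ z : ℂ, 0 < z.re → |(z ^ (1 / 2 : ℂ)).im| < (z ^ (1 / 2 : ℂ)).re := by
    intro z hz
    refine abs_lt_of_sq_lt_sq ?_ (re_cpow_half_nonneg z)
    linarith [(re_im_cpow_half z).1]
  have h1 := key a ha
  have h2 := key b hb
  rw [Complex.mul_re, sub_pos]
  calc _ ≤ |(a ^ (1 / 2 : ℂ)).im * (b ^ (1 / 2 : ℂ)).im| := le_abs_self _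
    _ = |(a ^ (1 / 2 : ℂ)).im| * |(b ^ (1 / 2 : ℂ)).im| := abs_mul _ _
    _ < _ := mul_lt_mul'' h1 h2 (abs_nonneg _) (abs_nonneg _)

end SquareRoot

/-! ### The cocycle relation of J for right multiplication by generators. -/

section AutomorphyFactor

/-- The automorphy factor `cz + d`. -/
def den (γ : SL(2, ℤ)) (z : ℍ) : ℂ := ((γ 1 0 : ℤ) : ℂ) * (z : ℂ) + ((γ 1 1 : ℤ) : ℂ)

lemma coe_SL_smul (γ : SL(2, ℤ)) (z : ℍ) : ((γ • z : ℍ) : ℂ) =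
    (((γ 0 0 : ℤ) : ℂ) * (z : ℂ) + ((γ 0 1 : ℤ) : ℂ)) / den γ z := by
  rw [coe_specialLinearGroup_apply]
  simp [den]

lemma den_eq_denom (γ : SL(2, ℤ)) (z : ℍ) :
    den γ z = denom (Matrix.SpecialLinearGroup.mapGL ℝ γ) (z : ℂ) := by
  simp [den, denom]

lemma den_ne_zero (γ : SL(2, ℤ)) (z : ℍ) : den γ z ≠ 0 := by
  rw [den_eq_denom]
  exact denom_ne_zero _ _

lemma den_mul (γ δ : SL(2, ℤ)) (z : ℍ) : den (γ * δ) z = den γ (δ • z) * den δ z := by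
  have h := den_ne_zero δ z
  rw [den, den, coe_SL_smul]
  simp only [Matrix.SpecialLinearGroup.coe_mul, Matrix.mul_apply, Fin.sum_univ_two, Int.cast_add,
    Int.cast_mul]
  field_simp
  rw [den]
  ring

lemma slash_apply_eq (k : ℕ) (f : ℍ → ℂ) (α : SL(2, ℤ)) (z : ℍ) :
    (f ∣[(k : ℤ)] α) z = (den α z ^ k)⁻¹ * f (α • z) := by
  rw [ModularForm.SL_slash_apply, mul_comm, zpow_neg, zpow_natCast]
  simp [denom, den]

/-- The Jacobi symbol is unchanged under c ↦ c + 4d. The square root changes branch only if c > 0 >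
c + 4d; then d < 0, and exactly then the symbol for (c + 4d, d) acquires its extra sign. -/
lemma J_U_mul {γ : SL(2, ℤ)} (hγ : γ ∈ Gamma1 4) (z : ℍ) :
    J (γ * U 4) z = J γ (U 4 • z) * J (U 4) z := by
  obtain ⟨ha, hd, hc⟩ := (mem_Gamma1_iff 4 γ).mp hγ
  have hdet := γ.det_coe
  rw [Matrix.det_fin_two] at hdet
  have e10 : (γ * U 4) 1 0 = γ 1 0 + 4 * γ 1 1 := by
    simp [Matrix.mul_apply, Fin.sum_univ_two, mul_comm]
  have e11 : (γ * U 4) 1 1 = γ 1 1 := by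
    simp [Matrix.mul_apply, Fin.sum_univ_two]
  have hJ : J (U 4) z = den (U 4) z ^ (1 / 2 : ℂ) := by
    simp [J, kronecker, sqrtDenom, den]
  have hsq : ∀ δ w, sqrtDenom δ w = den δ w ^ (1 / 2 : ℂ) := fun _ _ => rfl
  have hB : 0 < (den (U 4) z).im := by
    simp [den, z.im_pos]
  have him : ∀ (δ : SL(2, ℤ)) (w : ℍ), (den δ w).im = ((δ 1 0 : ℤ) : ℝ) * w.im := by
    intro δ w
    simp [den]
  have hmul := den_mul γ (U 4) z
  have hA := him γ (U 4 • z)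
  have hAB := him (γ * U 4) z
  rw [hmul, e10] at hAB
  rw [hJ, J, J, hsq, hsq, e10, e11, hmul, kronecker, kronecker, jacobiSym_add_four_mul]
  push_cast at hd hc
  have hw := (U 4 • z).im_pos
  have hz := z.im_pos
  rcases lt_trichotomy (γ 1 0) 0 with h0 | h0 | h0
  · have hs : (if γ 1 0 + 4 * γ 1 1 < 0 ∧ γ 1 1 < 0 then (-1 : ℤ) else 1) =
        if γ 1 0 < 0 ∧ γ 1 1 < 0 then -1 else 1 := by
      congr 1
      rw [eq_iff_iff]
      omega
    rw [hs, cpow_half_mul_of_im_neg ?_ hB, mul_assoc]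
    rw [hA]
    exact mul_neg_of_neg_of_pos (by exact_mod_cast h0) hw
  · have h1 : γ 1 1 = 1 := by
      rw [h0, mul_zero, sub_zero] at hdet
      rcases Int.mul_eq_one_iff_eq_one_or_neg_one.mp hdet with h | h <;> omega
    have h2 : den γ (U 4 • z) = 1 := by simp [den, h0, h1]
    rw [h2, h0, h1]
    simp
  · have h1 : γ 1 0 + 4 * γ 1 1 ≠ 0 := by
      intro h
      have h3 : γ 1 0 = -4 * γ 1 1 := by linarith
      rw [h3] at hdet
      have : γ 1 1 * (γ 0 0 + 4 * γ 0 1) = 1 := by linarith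
      rcases Int.mul_eq_one_iff_eq_one_or_neg_one.mp this with h | h <;> omega
    have hA' : 0 < (den γ (U 4 • z)).im := by
      rw [hA]
      exact mul_pos (by exact_mod_cast h0) hw
    rcases lt_or_gt_of_ne h1 with h1 | h1
    · rw [if_pos ⟨h1, by omega⟩, if_neg (by omega),
        cpow_half_mul_of_im_pos_of_im_neg hA' hB ?_]
      · push_cast
        ring
      · rw [hAB]
        exact mul_neg_of_neg_of_pos (by exact_mod_cast h1) hz
    · rw [if_neg (by omega), if_neg (by omega), cpow_half_mul_of_im_pos_of_im_pos hA' hB ?_,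
        mul_assoc]
      rw [hAB]
      exact mul_pos (by exact_mod_cast h1) hz

lemma coe_T_smul (z : ℍ) : ((ModularGroup.T • z : ℍ) : ℂ) = z + 1 := by
  rw [coe_SL_smul]
  simp [den, ModularGroup.T]

lemma J_mul_T {γ : SL(2, ℤ)} (hγ : γ ∈ Gamma1 4) (z : ℍ) :
    J (γ * ModularGroup.T) z = J γ (ModularGroup.T • z) := by
  obtain ⟨ha, hd, hc⟩ := (mem_Gamma1_iff 4 γ).mp hγ
  have e10 : (γ * ModularGroup.T) 1 0 = γ 1 0 := by
    simp [Matrix.mul_apply, Fin.sum_univ_two, ModularGroup.coe_T]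
  have e11 : (γ * ModularGroup.T) 1 1 = γ 1 0 + γ 1 1 := by
    simp [Matrix.mul_apply, Fin.sum_univ_two, ModularGroup.coe_T]
  rw [J, J, e10, e11, kronecker_add_right hc hd, sqrtDenom, sqrtDenom, e10, e11, coe_T_smul]
  push_cast
  ring_nf

end AutomorphyFactor

/-! ### The theta series under Γ₁(4). -/

section Theta

/-- The theta series as a function of a complex variable. -/
def thetaC (w : ℂ) : ℂ := jacobiTheta (2 * w)

lemma theta_eq_thetaC (z : ℍ) : theta z = thetaC z := by
  refine tsum_congr fun n => ?_
  ring_nf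

lemma dilate_theta_apply (h : ℕ+) (z : ℍ) : dilate h theta z = thetaC ((h : ℕ) * z) :=
  theta_eq_thetaC _

lemma thetaC_add_one (w : ℂ) : thetaC (w + 1) = thetaC w := by
  rw [thetaC, thetaC, mul_add, mul_one, add_comm, jacobiTheta_two_add]

lemma thetaC_neg_inv {w : ℂ} (hw : 0 < w.im) :
    thetaC (-1 / (4 * w)) = (-2 * Complex.I * w) ^ (1 / 2 : ℂ) * thetaC w := by
  have h0 : w ≠ 0 := by
    rintro rfl
    simp at hw
  let τ : ℍ := ⟨2 * w, by simpa using hw⟩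
  have h := jacobiTheta_S_smul τ
  rw [modular_S_smul] at h
  have e1 : 2 * (-1 / (4 * w)) = (-(2 * w))⁻¹ := by
    field_simp
    norm_num
  have e2 : -2 * Complex.I * w = -Complex.I * (2 * w) := by ring
  rw [thetaC, thetaC, e1, e2]
  exact h

lemma differentiableAt_thetaC {w : ℂ} (hw : 0 < w.im) : DifferentiableAt ℂ thetaC w := by
  have h : DifferentiableAt ℂ jacobiTheta (2 * w) :=
    differentiableAt_jacobiTheta (by simpa using hw)
  exact h.comp w (differentiableAt_id.const_mul 2)

lemma mdifferentiable_of_coe {F : ℂ → ℂ} (hF : ∀ w : ℂ, 0 < w.im → DifferentiableAt ℂ F w)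
    {f : ℍ → ℂ} (hf : ∀ z : ℍ, f z = F z) : MDiff f := by
  rw [UpperHalfPlane.mdifferentiable_iff]
  intro w hw
  refine ((hF w hw).congr_of_eventuallyEq ?_).differentiableWithinAt
  filter_upwards [isOpen_upperHalfPlaneSet.mem_nhds hw] with v hv
  rw [Function.comp_apply, hf, ofComplex_apply_of_im_pos hv]

/-- With W z = -1/(4z) one has U 4 = W T⁻¹ W as Möbius maps, so two inversions suffice. Both factors
-2iw and -2iz lie in the right half plane, hence their roots multiply without sign. -/
lemma thetaC_U {z : ℍ} : thetaC (U 4 • z : ℍ) = den (U 4) z ^ (1 / 2 : ℂ) * thetaC z := by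
  have h0 : (z : ℂ) ≠ 0 := ne_zero z
  have h1 : den (U 4) z = 4 * z + 1 := by simp [den]
  have h2 := den_ne_zero (U 4) z
  have hz := z.im_pos
  set w : ℂ := -1 / (4 * z) + (-1) with hw
  have hwim : 0 < w.im := by
    have h3 : w = ((1 / 4 : ℝ) : ℂ) * (-(z : ℂ))⁻¹ + (-1) := by
      rw [hw]
      push_cast
      field_simp
    have h4 := z.im_inv_neg_coe_pos
    rw [h3, Complex.add_im, Complex.im_ofReal_mul]
    simp only [Complex.neg_im, Complex.one_im]
    linarith
  have e1 : ((U 4 • z : ℍ) : ℂ) = -1 / (4 * w) := by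
    have hw0 : w ≠ 0 := by
      intro h
      rw [h] at hwim
      simp at hwim
    rw [coe_SL_smul, div_eq_div_iff h2 (by simpa using hw0), h1, hw]
    simp
    field_simp
  have e2 : thetaC w = thetaC (-1 / (4 * z)) := by
    rw [← thetaC_add_one w, hw]
    ring_nf
  have e3 : den (U 4) z = (-2 * Complex.I * w) * (-2 * Complex.I * z) := by
    have : (-2 * Complex.I * w) * (-2 * Complex.I * z) = 4 * Complex.I ^ 2 * w * z := by ring
    rw [this, Complex.I_sq, h1, hw]
    field_simp
    ring
  have e4 : ((-2 * Complex.I * w) * (-2 * Complex.I * z)) ^ (1 / 2 : ℂ) =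
      (-2 * Complex.I * w) ^ (1 / 2 : ℂ) * (-2 * Complex.I * z) ^ (1 / 2 : ℂ) :=
    cpow_half_mul_of_pos_of_pos (by simpa using hwim) (by simpa using hz)
  rw [e1, thetaC_neg_inv hwim, e2, thetaC_neg_inv hz, e3, e4]
  ring

/-- The transformation law of the theta series under `Γ₁(4)`. -/
lemma theta_smul {γ : SL(2, ℤ)} (hγ : γ ∈ Gamma1 4) (z : ℍ) : theta (γ • z) = J γ z * theta z := by
  have hT : ∀ z : ℍ, theta (ModularGroup.T • z) = theta z := fun z => by
    rw [theta_eq_thetaC, theta_eq_thetaC, coe_T_smul, thetaC_add_one]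
  have hU : ∀ z : ℍ, theta (U 4 • z) = J (U 4) z * theta z := fun z => by
    rw [theta_eq_thetaC, theta_eq_thetaC, thetaC_U]
    simp [J, kronecker, sqrtDenom, den]
  have hcl := closure_T_U (N := 4) (Or.inr rfl)
  rw [← hcl] at hγ
  -- Growing the word on the right needs the cocycle relation only for T and U 4, not for arbitrary
  -- pairs in Γ₁(4).
  induction hγ using Subgroup.closure_induction_right generalizing z with
  | one => simp [J, kronecker, sqrtDenom]
  | mul_right x hx y hy ih =>
    rw [hcl] at hx
    rw [mul_smul]
    rcases hy with rfl | rfl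
    · rw [ih, J_mul_T hx, hT]
    · rw [ih, Nat.cast_ofNat, J_U_mul hx, hU, mul_assoc]
  | mul_inv_cancel x hx y hy ih =>
    rw [hcl] at hx
    have hmem : x * y⁻¹ ∈ Gamma1 4 := by
      refine mul_mem hx (inv_mem ?_)
      rcases hy with rfl | rfl
      · exact T_mem_Gamma1 4
      · exact U_mem_Gamma1 4
    obtain ⟨w, rfl⟩ : ∃ w : ℍ, z = y • w := ⟨y⁻¹ • z, by rw [smul_inv_smul]⟩
    rw [mul_smul, inv_smul_smul, ih]
    rcases hy with rfl | rfl
    · have := J_mul_T hmem w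
      rw [inv_mul_cancel_right] at this
      rw [this, hT]
    · rw [Nat.cast_ofNat] at hmem ⊢
      have := J_U_mul hmem w
      rw [inv_mul_cancel_right] at this
      rw [this, hU, mul_assoc]

end Theta

/-! ### Boundedness at all cusps. -/

section Cusps

lemma summable_theta {w : ℂ} (hw : 0 < w.im) :
    Summable fun n : ℤ => Complex.exp (Real.pi * Complex.I * (n : ℂ) ^ 2 * (2 * w)) := by
  have h := (hasSum_jacobiTheta₂_term 0 (τ := 2 * w) (by simpa using hw)).summable
  refine h.congr fun n => ?_
  simp [jacobiTheta₂_term]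

/-- Splitting the theta series by the parity of the summation index. -/
lemma thetaC_quarter {w ε : ℂ} (hw : 0 < w.im) {v : ℂ}
    (hv : ∀ n : ℤ, Complex.exp (Real.pi * Complex.I * (n : ℂ) ^ 2 * (2 * v)) =
      (if Even n then 1 else ε) * Complex.exp (Real.pi * Complex.I * (n : ℂ) ^ 2 * (2 * (w / 4)))) :
    thetaC v = (1 - ε) * thetaC w + ε * thetaC (w / 4) := by
  have hs := summable_theta (w := w / 4) (by simpa using hw)
  set t : ℤ → ℂ := fun n => Complex.exp (Real.pi * Complex.I * (n : ℂ) ^ 2 * (2 * (w / 4))) with ht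
  have h1 : HasSum (fun n : ℤ => if Even n then t n else 0) (thetaC w) := by
    have hinj : Function.Injective fun n : ℤ => 2 * n := mul_right_injective₀ two_ne_zero
    rw [← hinj.hasSum_iff]
    · refine (summable_theta hw).hasSum.congr_fun fun n => ?_
      simp only [Function.comp_apply, even_two_mul, if_true, ht]
      push_cast
      ring_nf
    · intro n hn
      rw [if_neg]
      rintro ⟨m, hm⟩
      exact hn ⟨m, by simp only; omega⟩
  have h2 : HasSum (fun n : ℤ => (1 - ε) * (if Even n then t n else 0) + ε * t n)
      ((1 - ε) * thetaC w + ε * thetaC (w / 4)) := (h1.mul_left _).add (hs.hasSum.mul_left _)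
  rw [← h2.tsum_eq]
  refine tsum_congr fun n => ?_
  rw [hv n]
  split_ifs
  · ring
  · ring

lemma exp_add_quarter {ε : ℂ} (w : ℂ) {r : ℤ} (hr : Complex.exp (Real.pi * Complex.I / 2 * r) = ε)
    (n : ℤ) :
    Complex.exp (Real.pi * Complex.I * (n : ℂ) ^ 2 * (2 * ((w + r) / 4))) =
      (if Even n then 1 else ε) *
        Complex.exp (Real.pi * Complex.I * (n : ℂ) ^ 2 * (2 * (w / 4))) := by
  rcases Int.even_or_odd' n with ⟨m, rfl | rfl⟩
  · rw [if_pos (even_two_mul m), one_mul, Complex.exp_eq_exp_iff_exists_int]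
    refine ⟨m ^ 2 * r, ?_⟩
    push_cast
    ring
  · rw [if_neg (by simp), ← hr, ← Complex.exp_add, Complex.exp_eq_exp_iff_exists_int]
    refine ⟨(m ^ 2 + m) * r, ?_⟩
    push_cast
    ring

lemma thetaC_quarter_add_one {w : ℂ} (hw : 0 < w.im) :
    thetaC ((w + 1) / 4) = (1 - Complex.I) * thetaC w + Complex.I * thetaC (w / 4) := by
  refine thetaC_quarter hw fun n => ?_
  have := exp_add_quarter w (r := 1) (ε := Complex.I) (by
    rw [Int.cast_one, mul_one, show (Real.pi : ℂ) * Complex.I / 2 = Real.pi / 2 * Complex.I by ring,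
      Complex.exp_pi_div_two_mul_I]) n
  rwa [Int.cast_one] at this

lemma thetaC_quarter_sub_one {w : ℂ} (hw : 0 < w.im) :
    thetaC ((w - 1) / 4) = (1 + Complex.I) * thetaC w - Complex.I * thetaC (w / 4) := by
  have h : thetaC ((w - 1) / 4) = (1 - -Complex.I) * thetaC w + -Complex.I * thetaC (w / 4) := by
    refine thetaC_quarter hw fun n => ?_
    have := exp_add_quarter w (r := -1) (ε := -Complex.I) (by
      rw [Int.cast_neg, Int.cast_one, show (Real.pi : ℂ) * Complex.I / 2 * -1 =
        -(Real.pi / 2 * Complex.I) by ring, Complex.exp_neg, Complex.exp_pi_div_two_mul_I,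
        Complex.inv_I]) n
    rwa [Int.cast_neg, Int.cast_one] at this
  rw [h]
  ring

lemma thetaC_S {w : ℂ} (hw : 0 < w.im) (a b : ℂ) :
    (a * thetaC (-w⁻¹) + b * thetaC (-w⁻¹ / 4)) ^ 2 =
      w * (-Complex.I / 2) * (2 * b * thetaC w + a * thetaC (w / 4)) ^ 2 := by
  have h0 : w ≠ 0 := by
    rintro rfl
    simp at hw
  have h1 := thetaC_neg_inv (w := w / 4) (by simpa using hw)
  have h2 := thetaC_neg_inv hw
  have e1 : -1 / (4 * (w / 4)) = -w⁻¹ := by field_simp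
  have e2 : -1 / (4 * w) = -w⁻¹ / 4 := by field_simp
  have e3 : (-2 * Complex.I * w) ^ (1 / 2 : ℂ) = 2 * (-2 * Complex.I * (w / 4)) ^ (1 / 2 : ℂ) := by
    have h3 : -2 * Complex.I * w = 4 * (-2 * Complex.I * (w / 4)) := by ring
    have h4 : (4 : ℂ) ^ (1 / 2 : ℂ) = 2 := by
      have h5 : ((4 : ℂ) ^ (1 / 2 : ℂ)) ^ 2 = 2 ^ 2 := by
        rw [cpow_half_sq]
        norm_num
      refine (sq_eq_sq_iff_eq_or_eq_neg.mp h5).resolve_right fun h => ?_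
      have := re_cpow_half_nonneg 4
      rw [h] at this
      norm_num at this
    rw [h3, cpow_half_mul_of_pos_of_pos (by norm_num) (by simpa using hw), h4]
  have e4 := cpow_half_sq (-2 * Complex.I * (w / 4))
  rw [e1] at h1
  rw [e2, e3] at h2
  rw [h1, h2]
  linear_combination (2 * b * thetaC w + a * thetaC (w / 4)) ^ 2 * e4

/-- The plane spanned by ϑ(z) and ϑ(z/4) is stable under SL₂(ℤ) in weight 1/2: S exchanges the two
up to constants, and T mixes them by the parity of the summation index. Squaring avoids tracking the
branch of the root. -/
lemma exists_theta_slash (α : SL(2, ℤ)) (a b : ℂ) : ∃ a' b' : ℂ, ∀ z : ℍ,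
    (a * thetaC (α • z : ℍ) + b * thetaC ((α • z : ℍ) / 4)) ^ 2 =
      den α z * (a' * thetaC z + b' * thetaC (z / 4)) ^ 2 := by
  have hα : α ∈ Subgroup.closure {ModularGroup.S, ModularGroup.T} := by
    rw [SpecialLinearGroup.SL2Z_generators]
    exact Subgroup.mem_top α
  have step : ∀ x y : SL(2, ℤ),
      (∀ a b : ℂ, ∃ a' b' : ℂ, ∀ z : ℍ,
        (a * thetaC (x • z : ℍ) + b * thetaC ((x • z : ℍ) / 4)) ^ 2 =
          den x z * (a' * thetaC z + b' * thetaC (z / 4)) ^ 2) →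
      (∀ a b : ℂ, ∃ a' b' : ℂ, ∀ z : ℍ,
        (a * thetaC (y • z : ℍ) + b * thetaC ((y • z : ℍ) / 4)) ^ 2 =
          den y z * (a' * thetaC z + b' * thetaC (z / 4)) ^ 2) →
      ∀ a b : ℂ, ∃ a' b' : ℂ, ∀ z : ℍ,
        (a * thetaC ((x * y) • z : ℍ) + b * thetaC (((x * y) • z : ℍ) / 4)) ^ 2 =
          den (x * y) z * (a' * thetaC z + b' * thetaC (z / 4)) ^ 2 := by
    intro x y hx hy a b
    obtain ⟨a1, b1, h1⟩ := hx a b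
    obtain ⟨a2, b2, h2⟩ := hy a1 b1
    refine ⟨a2, b2, fun z => ?_⟩
    rw [mul_smul, h1, h2, den_mul, mul_assoc]
  have hS : ∀ a b : ℂ, ∃ a' b' : ℂ, ∀ z : ℍ,
      (a * thetaC (ModularGroup.S • z : ℍ) + b * thetaC ((ModularGroup.S • z : ℍ) / 4)) ^ 2 =
        den ModularGroup.S z * (a' * thetaC z + b' * thetaC (z / 4)) ^ 2 := by
    intro a b
    set c := (-Complex.I / 2) ^ (1 / 2 : ℂ) with hc
    refine ⟨c * (2 * b), c * a, fun z => ?_⟩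
    have hc2 : c ^ 2 = -Complex.I / 2 := cpow_half_sq _
    have e1 : ((ModularGroup.S • z : ℍ) : ℂ) = -(z : ℂ)⁻¹ := by
      rw [coe_SL_smul]
      simp [den, ModularGroup.S, neg_div]
    have e2 : den ModularGroup.S z = z := by simp [den, ModularGroup.S]
    rw [e1, e2, thetaC_S z.im_pos, ← hc2]
    ring
  have hS' : ∀ a b : ℂ, ∃ a' b' : ℂ, ∀ z : ℍ,
      (a * thetaC (ModularGroup.S⁻¹ • z : ℍ) + b * thetaC ((ModularGroup.S⁻¹ • z : ℍ) / 4)) ^ 2 =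
        den ModularGroup.S⁻¹ z * (a' * thetaC z + b' * thetaC (z / 4)) ^ 2 := by
    intro a b
    set c := (Complex.I / 2) ^ (1 / 2 : ℂ) with hc
    refine ⟨c * (2 * b), c * a, fun z => ?_⟩
    have hc2 : c ^ 2 = Complex.I / 2 := cpow_half_sq _
    have e0 : ModularGroup.S⁻¹ = -ModularGroup.S := by
      refine inv_eq_of_mul_eq_one_right ?_
      ext i j
      fin_cases i <;> fin_cases j <;> simp [ModularGroup.coe_S]
    have e1 : ((ModularGroup.S⁻¹ • z : ℍ) : ℂ) = -(z : ℂ)⁻¹ := by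
      rw [e0, coe_SL_smul]
      simp [den, ModularGroup.coe_S]
    have e2 : den ModularGroup.S⁻¹ z = -z := by
      rw [e0]
      simp [den, ModularGroup.coe_S]
    rw [e1, e2, thetaC_S z.im_pos]
    linear_combination (z : ℂ) * (2 * b * thetaC z + a * thetaC (z / 4)) ^ 2 * hc2
  have hT : ∀ a b : ℂ, ∃ a' b' : ℂ, ∀ z : ℍ,
      (a * thetaC (ModularGroup.T • z : ℍ) + b * thetaC ((ModularGroup.T • z : ℍ) / 4)) ^ 2 =
        den ModularGroup.T z * (a' * thetaC z + b' * thetaC (z / 4)) ^ 2 := by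
    intro a b
    refine ⟨a + b * (1 - Complex.I), b * Complex.I, fun z => ?_⟩
    have e2 : den ModularGroup.T z = 1 := by simp [den, ModularGroup.T]
    rw [coe_T_smul, e2, thetaC_quarter_add_one z.im_pos, thetaC_add_one]
    ring
  have hT' : ∀ a b : ℂ, ∃ a' b' : ℂ, ∀ z : ℍ,
      (a * thetaC (ModularGroup.T⁻¹ • z : ℍ) + b * thetaC ((ModularGroup.T⁻¹ • z : ℍ) / 4)) ^ 2 =
        den ModularGroup.T⁻¹ z * (a' * thetaC z + b' * thetaC (z / 4)) ^ 2 := by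
    intro a b
    refine ⟨a + b * (1 + Complex.I), -b * Complex.I, fun z => ?_⟩
    have e1 : ((ModularGroup.T⁻¹ • z : ℍ) : ℂ) = z - 1 := by
      have := coe_T_smul (ModularGroup.T⁻¹ • z)
      rw [smul_inv_smul] at this
      rw [this]
      ring
    have e2 : den ModularGroup.T⁻¹ z = 1 := by
      rw [den, ModularGroup.coe_T_inv]
      simp
    have e3 : thetaC ((z : ℂ) - 1) = thetaC z := by
      rw [← thetaC_add_one]
      ring_nf
    rw [e1, e2, thetaC_quarter_sub_one z.im_pos, e3]
    ring
  revert a b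
  induction hα using Subgroup.closure_induction_right with
  | one =>
    intro a b
    exact ⟨a, b, fun z => by simp [den]⟩
  | mul_right x hx y hy ih =>
    rcases hy with rfl | rfl
    · exact step x _ ih hS
    · exact step x _ ih hT
  | mul_inv_cancel x hx y hy ih =>
    rcases hy with rfl | rfl
    · exact step x _ ih hS'
    · exact step x _ ih hT'

lemma tendsto_thetaC_mul {r : ℝ} (hr : 0 < r) :
    Tendsto (fun z : ℍ => thetaC (r * z)) atImInfty (𝓝 1) := by
  have h1 : Tendsto (fun τ : ℂ => Real.exp (-Real.pi * τ.im)) (comap Complex.im atTop) (𝓝 0) := by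
    refine Real.tendsto_exp_atBot.comp ?_
    exact (tendsto_comap.const_mul_atTop_of_neg (by linarith [Real.pi_pos]))
  have h2 := isBigO_at_im_infty_jacobiTheta_sub_one.trans_tendsto h1
  have h3 : Tendsto (fun z : ℍ => 2 * ((r : ℂ) * z)) atImInfty (comap Complex.im atTop) := by
    rw [tendsto_comap_iff]
    have : (Complex.im ∘ fun z : ℍ => 2 * ((r : ℂ) * z)) = fun z : ℍ => (2 * r) * z.im := by
      funext z
      simp [mul_assoc]
    rw [this]
    exact tendsto_comap.const_mul_atTop (by positivity)
  have h4 := (h2.comp h3).add_const 1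
  simpa [thetaC, Function.comp_def] using h4

lemma tendsto_theta : Tendsto theta atImInfty (𝓝 1) := by
  have := tendsto_thetaC_mul one_pos
  refine this.congr fun z => ?_
  rw [theta_eq_thetaC]
  simp

lemma tendsto_dilate_theta (h : ℕ+) : Tendsto (dilate h theta) atImInfty (𝓝 1) := by
  refine (tendsto_thetaC_mul (r := ((h : ℕ) : ℝ)) (by exact_mod_cast h.pos)).congr fun z => ?_
  rw [dilate_theta_apply]
  simp

lemma isBoundedAtImInfty_theta_sq_slash (α : SL(2, ℤ)) :
    IsBoundedAtImInfty ((theta ^ 2) ∣[((1 : ℕ) : ℤ)] α) := by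
  obtain ⟨a, b, h⟩ := exists_theta_slash α 1 0
  have h1 : ((theta ^ 2) ∣[((1 : ℕ) : ℤ)] α) =
      fun z : ℍ => (a * thetaC ((1 : ℝ) * z) + b * thetaC ((1 / 4 : ℝ) * z)) ^ 2 := by
    funext z
    have h2 := h z
    rw [one_mul, zero_mul, add_zero] at h2
    rw [slash_apply_eq, Pi.pow_apply, theta_eq_thetaC, h2, pow_one,
      inv_mul_cancel_left₀ (den_ne_zero α z)]
    push_cast
    ring_nf
  rw [h1]
  have := (((tendsto_thetaC_mul one_pos).const_mul a).add
    ((tendsto_thetaC_mul (r := 1 / 4) (by norm_num)).const_mul b)).pow 2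
  exact this.isBigO_one ℝ

/-- Boundedness at all cusps may be tested on squares. -/
lemma isBoundedAtImInfty_iff_sq (m : ℕ) (f : ℍ → ℂ) (α : SL(2, ℤ)) :
    (IsBoundedAtImInfty fun z : ℍ => (sqrtDenom α z ^ m)⁻¹ * f (α • z)) ↔
      IsBoundedAtImInfty ((f ^ 2) ∣[(m : ℤ)] α) := by
  have h : ((f ^ 2) ∣[(m : ℤ)] α) = (fun z : ℍ => (sqrtDenom α z ^ m)⁻¹ * f (α • z)) ^ 2 := by
    funext z
    rw [slash_apply_eq, Pi.pow_apply, Pi.pow_apply, mul_pow, inv_pow, ← pow_mul, mul_comm m 2,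
      pow_mul, sqrtDenom_sq]
    rfl
  rw [h]
  constructor
  · intro h1
    exact (IsBigO.pow h1 2).congr_right fun _ => one_pow 2
  · intro h1
    refine IsBigO.of_pow (n := 2) two_ne_zero ?_
    exact IsBigO.congr_right h1 fun _ => (one_pow 2).symm

/-- Boundedness at all cusps is preserved by `f(z) ↦ f(hz)`. -/
lemma isBoundedAtImInfty_dilate_slash {k : ℕ} {f : ℍ → ℂ}
    (hf : ∀ α : SL(2, ℤ), IsBoundedAtImInfty (f ∣[(k : ℤ)] α)) (h : ℕ+) (α : SL(2, ℤ)) :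
    IsBoundedAtImInfty (dilate h f ∣[(k : ℤ)] α) := by
  have h0 : ((h : ℕ) : ℚ) ≠ 0 := by exact_mod_cast h.ne_zero
  have h0' : (0 : ℝ) < ((h : ℕ) : ℝ) := by exact_mod_cast h.pos
  -- Dilation is, up to a scalar, the slash action of diag(h, 1). Being rational, this matrix
  -- permutes the cusps of SL₂(ℤ).
  let gQ : GL (Fin 2) ℚ := Matrix.GeneralLinearGroup.mkOfDetNeZero !![((h : ℕ) : ℚ), 0; 0, 1]
    (by simp)
  let g : GL (Fin 2) ℝ := gQ.map (Rat.castHom ℝ)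
  have hdet : g.det.val = (h : ℕ) := by
    simp [g, gQ, Matrix.GeneralLinearGroup.mkOfDetNeZero, Matrix.det_fin_two]
  have hslash : f ∣[(k : ℤ)] g = (((h : ℕ) : ℂ) ^ ((k : ℤ) - 1)) • dilate h f := by
    funext z
    have hd : 0 < g.det.val := by rw [hdet]; exact h0'
    have hz : g • z = ⟨((h : ℕ) : ℂ) * (z : ℂ), by simpa using mul_pos h0' z.im_pos⟩ := by
      ext
      rw [coe_smul_of_det_pos hd]
      simp [num, denom, g, gQ, Matrix.GeneralLinearGroup.mkOfDetNeZero]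
    rw [ModularForm.slash_apply, hz, hdet, σ, if_pos hd]
    simp [dilate, denom, g, gQ, Matrix.GeneralLinearGroup.mkOfDetNeZero, mul_comm]
  have hcusp : IsCusp (g • (Matrix.SpecialLinearGroup.mapGL ℝ α • OnePoint.infty)) 𝒮ℒ := by
    rw [isCusp_SL2Z_iff]
    refine ⟨gQ • (Matrix.SpecialLinearGroup.mapGL ℚ α • OnePoint.infty), ?_⟩
    rw [← Rat.coe_castHom, OnePoint.map_smul, OnePoint.map_smul, OnePoint.map_infty]
    congr 2
    ext i j
    simp
  have h1 : OnePoint.IsBoundedAt (g • (Matrix.SpecialLinearGroup.mapGL ℝ α • OnePoint.infty)) f k :=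
    (OnePoint.isBoundedAt_iff_forall_SL2Z hcusp).mpr fun γ _ => hf γ
  rw [OnePoint.IsBoundedAt.smul_iff, hslash, OnePoint.IsBoundedAt.smul_iff,
    OnePoint.isBoundedAt_infty_iff] at h1
  have h2 : ((((h : ℕ) : ℂ) ^ ((k : ℤ) - 1)) • dilate h f) ∣[(k : ℤ)]
      (Matrix.SpecialLinearGroup.mapGL ℝ α) =
      (((h : ℕ) : ℂ) ^ ((k : ℤ) - 1)) • (dilate h f ∣[(k : ℤ)] α) :=
    ModularForm.SL_smul_slash _ _ _ _
  rw [h2] at h1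
  have h3 : ((h : ℕ) : ℂ) ^ ((k : ℤ) - 1) ≠ 0 := zpow_ne_zero _ (by exact_mod_cast h.ne_zero)
  have h4 := h1.smul (((h : ℕ) : ℂ) ^ ((k : ℤ) - 1))⁻¹
  rwa [inv_smul_smul₀ h3] at h4

end Cusps

/-! ### Dilation, and membership of the two theta series. -/

section Dilation

/-- The point `hz` of the upper half plane. -/
def dilatePt (h : ℕ+) (z : ℍ) : ℍ := ⟨((h : ℕ) : ℂ) * (z : ℂ), by
  have h0 : (0 : ℝ) < ((h : ℕ) : ℝ) := by exact_mod_cast h.pos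
  simpa using mul_pos h0 z.im_pos⟩

lemma dilate_apply (h : ℕ+) (f : ℍ → ℂ) (z : ℍ) : dilate h f z = f (dilatePt h z) := rfl

lemma coe_dilatePt (h : ℕ+) (z : ℍ) : (dilatePt h z : ℂ) = (h : ℕ) * z := rfl

/-- Conjugation by diag(h, 1) turns (a, b; c, d) into (a, hb; c/h, d) and preserves cz + d. -/
lemma exists_dilatePt_smul (h : ℕ+) (γ : SL(2, ℤ)) (hc : ((h : ℕ) : ℤ) ∣ γ 1 0) :
    ∃ γ' : SL(2, ℤ), γ' 0 0 = γ 0 0 ∧ γ' 1 1 = γ 1 1 ∧ ((h : ℕ) : ℤ) * γ' 1 0 = γ 1 0 ∧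
      ∀ z, dilatePt h (γ • z) = γ' • dilatePt h z ∧ den γ' (dilatePt h z) = den γ z := by
  obtain ⟨e, he⟩ := hc
  have hdet := γ.det_coe
  rw [Matrix.det_fin_two, he] at hdet
  let γ' : SL(2, ℤ) := ⟨!![γ 0 0, (h : ℕ) * γ 0 1; e, γ 1 1], by
    rw [Matrix.det_fin_two_of]
    linarith⟩
  have h00 : γ' 0 0 = γ 0 0 := rfl
  have h01 : γ' 0 1 = (h : ℕ) * γ 0 1 := rfl
  have h10 : γ' 1 0 = e := rfl
  have h11 : γ' 1 1 = γ 1 1 := rfl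
  have hden : ∀ z, den γ' (dilatePt h z) = den γ z := by
    intro z
    rw [den, den, h10, h11, he, coe_dilatePt]
    push_cast
    ring
  refine ⟨γ', h00, h11, by rw [h10, he], fun z => ⟨?_, hden z⟩⟩
  ext
  rw [coe_SL_smul, hden, coe_dilatePt, coe_SL_smul, h00, h01, coe_dilatePt]
  push_cast
  ring

lemma mdifferentiable_dilate (h : ℕ+) {f : ℍ → ℂ} (hf : MDiff f) : MDiff (dilate h f) := by
  have h0 : (0 : ℝ) < ((h : ℕ) : ℝ) := by exact_mod_cast h.pos
  rw [UpperHalfPlane.mdifferentiable_iff] at hf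
  refine mdifferentiable_of_coe (F := fun w => (f ∘ ofComplex) ((h : ℕ) * w)) ?_ ?_
  · intro w hw
    have hw' : 0 < (((h : ℕ) : ℂ) * w).im := by simpa using mul_pos h0 hw
    have := (hf _ hw').differentiableAt (isOpen_upperHalfPlaneSet.mem_nhds hw')
    exact this.comp w (differentiableAt_id.const_mul _)
  · intro z
    rw [dilate_apply, Function.comp_apply]
    congr 1
    rw [← coe_dilatePt, ofComplex_apply]

end Dilation

lemma M_mono {Γ Γ' : Subgroup SL(2, ℤ)} (h : Γ ≤ Γ') (m : ℕ) : M Γ' m ≤ M Γ m :=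
  fun _ hf => ⟨hf.1, fun γ hγ => hf.2.1 γ (h hγ), hf.2.2⟩

lemma Gamma1_le_of_dvd {N N' : ℕ} (h : N ∣ N') : Gamma1 N' ≤ Gamma1 N := by
  intro γ hγ
  have hd : (N : ℤ) ∣ N' := by exact_mod_cast h
  obtain ⟨ha, hb, hc⟩ := (mem_Gamma1_iff N' γ).mp hγ
  exact (mem_Gamma1_iff N γ).mpr ⟨hd.trans ha, hd.trans hb, hd.trans hc⟩

lemma J_ne_zero (γ : SL(2, ℤ)) (z : ℍ) : J γ z ≠ 0 := by
  intro h
  have := J_sq γ z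
  rw [h, zero_pow two_ne_zero] at this
  exact den_ne_zero γ z this.symm

theorem theta_mem : theta ∈ M (Gamma1 4) 1 := by
  refine ⟨mdifferentiable_of_coe (fun w hw => differentiableAt_thetaC hw) theta_eq_thetaC, ?_, ?_⟩
  · intro γ hγ z
    rw [theta_smul hγ, pow_one, inv_mul_cancel_left₀ (J_ne_zero γ z)]
  · intro α
    rw [isBoundedAtImInfty_iff_sq]
    exact isBoundedAtImInfty_theta_sq_slash α

lemma jacobiSym_three {b : ℕ} (hb : b % 12 = 1 ∨ b % 12 = 11) : jacobiSym 3 b = 1 := by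
  have ho : Odd b := Nat.odd_iff.mpr (by omega)
  rw [jacobiSym.mod_right 3 ho, show 4 * (3 : ℤ).natAbs = 12 from rfl]
  rcases hb with h | h <;> rw [h] <;> norm_num

lemma kronecker_three_mul {c d : ℤ} (hd : 12 ∣ d - 1) : kronecker (3 * c) d = kronecker c d := by
  rw [kronecker, kronecker, jacobiSym.mul_left, jacobiSym_three (by omega), one_mul]
  congr 2
  rw [eq_iff_iff]
  omega

/-- Conjugation replaces (c / d) by (c/3 / d). No character appears because (3 / |d|) = 1 for d ≡ 1
modulo 12. -/
theorem dilate_three_theta_mem : dilate 3 theta ∈ M (Gamma1 12) 1 := by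
  refine ⟨mdifferentiable_dilate 3 theta_mem.1, ?_, ?_⟩
  · intro γ hγ z
    obtain ⟨ha, hd, hc⟩ := (mem_Gamma1_iff 12 γ).mp hγ
    obtain ⟨γ', h00, h11, h10, h⟩ := exists_dilatePt_smul 3 γ (Dvd.dvd.trans (by norm_num) hc)
    have h10' : γ 1 0 = 3 * γ' 1 0 := by rw [← h10]; rfl
    have hmem : γ' ∈ Gamma1 4 := by
      rw [mem_Gamma1_iff, h00, h11]
      push_cast at ha hd hc ⊢
      refine ⟨?_, ?_, ?_⟩ <;> omega
    have hJ : J γ' (dilatePt 3 z) = J γ z := by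
      have hs : sqrtDenom γ' (dilatePt 3 z) = sqrtDenom γ z :=
        congrArg (fun w : ℂ => w ^ (1 / 2 : ℂ)) (h z).2
      rw [J, J, hs, h11, h10', kronecker_three_mul (by exact_mod_cast hd)]
    rw [dilate_apply, dilate_apply, (h z).1, theta_smul hmem, hJ, pow_one,
      inv_mul_cancel_left₀ (J_ne_zero γ z)]
  · intro α
    rw [isBoundedAtImInfty_iff_sq]
    exact isBoundedAtImInfty_dilate_slash isBoundedAtImInfty_theta_sq_slash 3 α

/-! ### Lambert series of the weight one Eisenstein series. -/

section Lambert

/-- The nontrivial character modulo `3`. -/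
def rho (n : ℕ) : ℂ := (legendreSym 3 (n : ℤ) : ℂ)

lemma rho_add_three (n : ℕ) : rho (n + 3) = rho n := by
  rw [rho, rho, legendreSym.mod, Nat.cast_add, Nat.cast_ofNat]
  conv_rhs => rw [legendreSym.mod]
  simp

lemma rho_zero : rho 0 = 0 := by simp [rho]

lemma rho_one : rho 1 = 1 := by simp [rho]

lemma rho_two : rho 2 = -1 := by
  have : legendreSym 3 2 = -1 := by norm_num
  simp [rho, this]

lemma norm_rho_le (n : ℕ) : ‖rho n‖ ≤ 1 := by
  induction n using Nat.strong_induction_on with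
  | _ n ih =>
    match n, ih with
    | 0, _ => simp [rho_zero]
    | 1, _ => simp [rho_one]
    | 2, _ => simp [rho_two]
    | n + 3, ih => rw [rho_add_three]; exact ih n (by omega)

variable {x : ℂ}

lemma summable_rho_mul_pow (hx : ‖x‖ < 1) : Summable fun k : ℕ => rho k * x ^ k := by
  refine Summable.of_norm_bounded (summable_geometric_of_lt_one (norm_nonneg x) hx) fun k => ?_
  rw [norm_mul, norm_pow]
  exact mul_le_of_le_one_left (by positivity) (norm_rho_le k)

lemma one_add_add_sq_ne_zero (hx : ‖x‖ < 1) : 1 + x + x ^ 2 ≠ 0 := by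
  intro h
  have h3 : x ^ 3 = 1 := by linear_combination (x - 1) * h
  have : ‖x‖ ^ 3 = 1 := by rw [← norm_pow, h3, norm_one]
  have h4 : ‖x‖ ^ 3 < 1 := pow_lt_one₀ (norm_nonneg x) hx (by norm_num)
  linarith

/-- By periodicity the sum is (x - x²)/(1 - x³). -/
lemma hasSum_rho_mul_pow (hx : ‖x‖ < 1) :
    HasSum (fun k : ℕ+ => rho k * x ^ (k : ℕ)) (x / (1 + x + x ^ 2)) := by
  have hs := summable_rho_mul_pow hx
  have h1 := hs.sum_add_tsum_nat_add 3
  have h2 : ∑' k, rho (k + 3) * x ^ (k + 3) = x ^ 3 * ∑' k, rho k * x ^ k := by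
    rw [← tsum_mul_left]
    refine tsum_congr fun k => ?_
    rw [rho_add_three, pow_add]
    ring
  have h3 : 1 - x ≠ 0 := by
    intro h
    rw [← sub_eq_zero.mp h, norm_one] at hx
    exact lt_irrefl _ hx
  have h4 : ∑' k, rho k * x ^ k = x / (1 + x + x ^ 2) := by
    rw [eq_div_iff (one_add_add_sq_ne_zero hx)]
    refine mul_left_cancel₀ h3 ?_
    rw [h2] at h1
    simp only [Finset.sum_range_succ, Finset.sum_range_zero, rho_zero, rho_one, rho_two] at h1
    linear_combination -h1
  rw [← h4]
  have hinj : Function.Injective (fun k : ℕ+ => (k : ℕ)) := PNat.coe_injective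
  refine (hinj.hasSum_iff (f := fun k : ℕ => rho k * x ^ k) ?_).mpr hs.hasSum
  intro k hk
  rcases Nat.eq_zero_or_pos k with rfl | h
  · simp [rho_zero]
  · exact absurd ⟨⟨k, h⟩, rfl⟩ hk

lemma hasSum_pow_pnat (hx : ‖x‖ < 1) : HasSum (fun m : ℕ+ => x ^ (m : ℕ)) (x / (1 - x)) := by
  have h := (hasSum_geometric_of_norm_lt_one hx).mul_left x
  rw [← Equiv.pnatEquivNat.symm.hasSum_iff]
  rw [← div_eq_mul_inv] at h
  refine h.congr_fun fun n => ?_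
  simp [Equiv.pnatEquivNat, pow_succ']

lemma summable_rho_prod (hx : ‖x‖ < 1) :
    Summable fun p : ℕ+ × ℕ+ => rho p.2 * x ^ ((p.1 : ℕ) * (p.2 : ℕ)) := by
  have h := (summable_prod_mul_pow 0 hx).norm
  refine Summable.of_norm_bounded h fun p => ?_
  rw [norm_mul, norm_mul, pow_zero, norm_one]
  exact mul_le_mul_of_nonneg_right (norm_rho_le _) (norm_nonneg _)

lemma hasSum_rho_divisors (hx : ‖x‖ < 1) :
    HasSum (fun n : ℕ+ => (∑ d ∈ (n : ℕ).divisors, rho d) * x ^ (n : ℕ))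
      (∑' p : ℕ+ × ℕ+, rho p.2 * x ^ ((p.1 : ℕ) * (p.2 : ℕ))) := by
  refine (sigmaAntidiagonalEquivProd.hasSum_iff.mpr (summable_rho_prod hx).hasSum).sigma fun n => ?_
  have h1 : ∀ c : {y // y ∈ (n : ℕ).divisorsAntidiagonal},
      ((fun p : ℕ+ × ℕ+ => rho p.2 * x ^ ((p.1 : ℕ) * (p.2 : ℕ))) ∘ sigmaAntidiagonalEquivProd)
        ⟨n, c⟩ = rho c.1.2 * x ^ (n : ℕ) := by
    intro c
    have := (Nat.mem_divisorsAntidiagonal.mp c.2).1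
    simp only [Function.comp_apply, sigmaAntidiagonalEquivProd, divisorsAntidiagonalFactors,
      Equiv.coe_fn_mk, PNat.mk_coe, this]
  have h2 := (n : ℕ).divisorsAntidiagonal.sum_coe_sort (fun p => rho p.2 * x ^ (n : ℕ))
  rw [Nat.sum_divisorsAntidiagonal' (fun _ b => rho b * x ^ (n : ℕ))] at h2
  rw [Finset.sum_mul, ← h2]
  exact (hasSum_fintype _).congr_fun fun c => h1 c

lemma fRho_eq_tsum (z : ℍ) : fRho z =
    1 + 6 * ∑' p : ℕ+ × ℕ+, rho p.2 * qp z ^ ((p.1 : ℕ) * (p.2 : ℕ)) := by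
  rw [← (hasSum_rho_divisors (norm_qp_lt_one z)).tsum_eq, fRho]
  congr 2
  refine tsum_congr fun n => ?_
  rw [qp_pow]
  rfl

lemma norm_pow_lt_one (hx : ‖x‖ < 1) (m : ℕ+) : ‖x ^ (m : ℕ)‖ < 1 := by
  rw [norm_pow]
  exact pow_lt_one₀ (norm_nonneg x) hx m.ne_zero

lemma hasSum_fRho (z : ℍ) : HasSum
    (fun m : ℕ => qp z ^ (m + 1) / (1 + qp z ^ (m + 1) + (qp z ^ (m + 1)) ^ 2))
      ((fRho z - 1) / 6) := by
  have hx := norm_qp_lt_one z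
  have h1 := (summable_rho_prod hx).hasSum
  have h2 : ∀ m : ℕ+, HasSum (fun k : ℕ+ => rho k * qp z ^ ((m : ℕ) * (k : ℕ)))
      (qp z ^ (m : ℕ) / (1 + qp z ^ (m : ℕ) + (qp z ^ (m : ℕ)) ^ 2)) := by
    intro m
    refine (hasSum_rho_mul_pow (norm_pow_lt_one hx m)).congr_fun fun k => ?_
    rw [pow_mul]
  have h3 := h1.prod_fiberwise h2
  rw [← Equiv.pnatEquivNat.symm.hasSum_iff] at h3
  rw [fRho_eq_tsum, add_sub_cancel_left, mul_div_cancel_left₀ _ (by norm_num)]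
  refine h3.congr_fun fun m => ?_
  simp [Equiv.pnatEquivNat]

/-- The same double series as in `hasSum_fRho`, summed in the other order. The two forms match the
two sides of the inversion z ↦ -1/(3z). -/
lemma hasSum_fRho' (z : ℍ) : HasSum
    (fun k : ℕ => rho k * (qp z ^ k / (1 - qp z ^ k))) ((fRho z - 1) / 6) := by
  have hx := norm_qp_lt_one z
  have h1 := (Equiv.prodComm ℕ+ ℕ+).hasSum_iff.mpr (summable_rho_prod hx).hasSum
  have h2 : ∀ k : ℕ+, HasSum (fun m : ℕ+ => rho k * qp z ^ ((m : ℕ) * (k : ℕ)))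
      (rho k * (qp z ^ (k : ℕ) / (1 - qp z ^ (k : ℕ)))) := by
    intro k
    refine ((hasSum_pow_pnat (norm_pow_lt_one hx k)).mul_left _).congr_fun fun m => ?_
    rw [mul_comm (m : ℕ), pow_mul]
  have h3 := h1.prod_fiberwise h2
  have hinj : Function.Injective (fun k : ℕ+ => (k : ℕ)) := PNat.coe_injective
  refine (hinj.hasSum_iff (f := fun k : ℕ => rho k * (qp z ^ k / (1 - qp z ^ k))) ?_).mp ?_
  · intro k hk
    rcases Nat.eq_zero_or_pos k with rfl | h
    · simp [rho_zero]
    · exact absurd ⟨⟨k, h⟩, rfl⟩ hk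
  · rw [fRho_eq_tsum, add_sub_cancel_left, mul_div_cancel_left₀ _ (by norm_num)]
    exact h3

end Lambert

/-! ### Inversion formula of the Eisenstein series. -/

section Eisenstein

open EisensteinSeries SummationFilter

lemma summable_inv_mul_inv (x y : ℂ) : Summable fun n : ℤ => (x + n)⁻¹ * (y + n)⁻¹ := by
  have h : Summable fun n : ℤ => ((x + n) * (y + n))⁻¹ := by
    apply summable_inv_of_isBigO_rpow_inv (a := 2) (by norm_num)
    simpa [pow_two, mul_comm] using (linear_inv_isBigO_right 1 x).mul (linear_inv_isBigO_right 1 y)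
  exact h.congr fun n => mul_inv _ _

lemma hasSum_inv_sub_inv {x y : ℂ} (hx : x ∈ Complex.integerComplement)
    (hy : y ∈ Complex.integerComplement) :
    HasSum (fun n : ℤ => (x + n)⁻¹ - (y + n)⁻¹)
      (Real.pi * Complex.cot (Real.pi * x) - Real.pi * Complex.cot (Real.pi * y)) := by
  have hs : Summable fun n : ℤ => (x + n)⁻¹ - (y + n)⁻¹ := by
    refine ((summable_inv_mul_inv x y).mul_left (y - x)).congr fun n => ?_
    have h1 := Complex.integerComplement_add_ne_zero hx n
    have h2 := Complex.integerComplement_add_ne_zero hy n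
    field_simp
    ring
  have h := (hasSum_symmetricIcc_iff (f := fun n : ℤ => (x + n)⁻¹ - (y + n)⁻¹)).mp
    (Tendsto.mono_left hs.hasSum (LeAtTop.le_atTop (L := symmetricIcc ℤ)))
  have h3 : ∀ N : ℕ, ∑ n ∈ Finset.Icc (-(N : ℤ)) N, ((x + n)⁻¹ - (y + n)⁻¹) =
      (∑ j ∈ Finset.range N, cotTerm x j + 1 / x) - (∑ j ∈ Finset.range N, cotTerm y j + 1 / y) := by
    intro N
    induction N with
    | zero => simp
    | succ N ih =>
      rw [Nat.cast_add, Nat.cast_one, Finset.Icc_succ_succ, Finset.sum_union (by simp),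
        Finset.sum_pair (by lia), ih, Finset.sum_range_succ, Finset.sum_range_succ, cotTerm, cotTerm]
      push_cast
      ring
  have h4 := ((tendsto_logDeriv_euler_cot_sub hx).add_const (1 / x)).sub
    ((tendsto_logDeriv_euler_cot_sub hy).add_const (1 / y))
  simp only [sub_add_cancel] at h4
  rw [← tendsto_nhds_unique h (h4.congr fun N => (h3 N).symm)]
  exact hs.hasSum

lemma tsum_inv_sq_sub_sq {x a : ℂ} (ha : a ≠ 0) (h1 : x - a ∈ Complex.integerComplement)
    (h2 : x + a ∈ Complex.integerComplement) :
    ∑' n : ℤ, ((x + n) ^ 2 - a ^ 2)⁻¹ = Real.pi / (2 * a) *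
      (Complex.cot (Real.pi * (x - a)) - Complex.cot (Real.pi * (x + a))) := by
  have h := (hasSum_inv_sub_inv h1 h2).mul_left (1 / (2 * a))
  rw [show Real.pi / (2 * a) * (Complex.cot (Real.pi * (x - a)) - Complex.cot (Real.pi * (x + a))) =
    1 / (2 * a) * (Real.pi * Complex.cot (Real.pi * (x - a)) -
      Real.pi * Complex.cot (Real.pi * (x + a))) by ring, ← h.tsum_eq]
  refine tsum_congr fun n => ?_
  have h3 := Complex.integerComplement_add_ne_zero h1 n
  have h4 := Complex.integerComplement_add_ne_zero h2 n
  rw [inv_sub_inv h3 h4, show (x + n) ^ 2 - a ^ 2 = (x - a + n) * (x + a + n) by ring]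
  field_simp
  ring

lemma norm_le_norm_three_mul (m : Fin 2 → ℤ) {e : ℤ} (he : e = 1 ∨ e = -1) :
    ‖m‖ ≤ ‖![3 * m 0, 3 * m 1 + e]‖ := by
  rw [norm_eq_max_natAbs, norm_eq_max_natAbs]
  simp only [Matrix.cons_val_zero, Matrix.cons_val_one]
  norm_cast
  omega

lemma three_mul_linear_ne_zero (z : ℍ) (m : Fin 2 → ℤ) {e : ℤ} (he : e = 1 ∨ e = -1) :
    3 * ((m 0 : ℂ) * z + m 1) + e ≠ 0 := by
  have := linear_ne_zero (cd := ![3 * (m 0 : ℝ), 3 * m 1 + e]) z (by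
    intro h
    have := congrFun h 1
    simp at this
    norm_cast at this
    omega)
  intro h
  apply this
  simp
  rw [← h]
  ring

lemma isBigO_inv_three_mul_linear (z : ℍ) {e : ℤ} (he : e = 1 ∨ e = -1) :
    (fun m : Fin 2 → ℤ => (3 * ((m 0 : ℂ) * z + m 1) + e)⁻¹) =O[cofinite] fun m => ‖m‖⁻¹ := by
  refine IsBigO.of_bound (r z)⁻¹ ?_
  filter_upwards [eventually_cofinite_ne 0] with m hm
  have h1 := r_mul_max_le z (x := ![3 * m 0, 3 * m 1 + e]) (by
    intro h
    have := congrFun h 1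
    simp at this
    omega)
  have h2 := (mul_le_mul_of_nonneg_left (norm_le_norm_three_mul m he) (r_pos z).le).trans h1
  have h3 : ((![3 * m 0, 3 * m 1 + e] 0 : ℤ) : ℂ) * (z : ℂ) + ((![3 * m 0, 3 * m 1 + e] 1 : ℤ) : ℂ)
      = 3 * ((m 0 : ℂ) * z + m 1) + e := by
    simp
    ring
  rw [h3] at h2
  rw [norm_inv, norm_inv, norm_norm, ← mul_inv]
  have : 0 < r z * ‖m‖ := mul_pos (r_pos z) (norm_pos_iff.mpr hm)
  exact inv_anti₀ this h2

/-- The regularized terms of the double series. -/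
def regTerm (z : ℍ) (a : ℂ) (p : ℤ × ℤ) : ℂ :=
  (((p.1 : ℂ) * z + p.2) ^ 2 - a ^ 2)⁻¹ - (((p.1 : ℂ) * z + p.2) ^ 2)⁻¹

/-- With r = mz + n the difference is a²/(r²(r² - a²)), of order ‖(m, n)‖⁻⁴; subtracting r⁻² has
made the double series absolutely convergent. -/
lemma summable_regTerm_third (z : ℍ) : Summable (regTerm z (1 / 3)) := by
  have h : Summable fun m : Fin 2 → ℤ => regTerm z (1 / 3) (m 0, m 1) := by
    apply summable_of_isBigO_rpow_norm (a := 4) (by norm_num)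
    have h1 := ((isBigO_linear_add_const_vec z 0 0).mul (isBigO_linear_add_const_vec z 0 0)).mul
      ((isBigO_inv_three_mul_linear z (Or.inl rfl)).mul (isBigO_inv_three_mul_linear z (Or.inr rfl)))
    refine IsBigO.congr' h1 ?_ ?_
    · filter_upwards [eventually_cofinite_ne 0] with m hm
      have h2 := three_mul_linear_ne_zero z m (Or.inl rfl)
      have h3 := three_mul_linear_ne_zero z m (Or.inr rfl)
      have h4 : (m 0 : ℂ) * z + m 1 ≠ 0 := by
        have := linear_ne_zero (cd := fun i => (m i : ℝ)) z (by
          intro h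
          apply hm
          funext i
          simpa using congrFun h i)
        simpa using this
      simp only [Int.cast_zero, add_zero, regTerm]
      generalize (m 0 : ℂ) * z + m 1 = r at h2 h3 h4
      push_cast at h2 h3 ⊢
      have h5 : r ^ 2 - (1 / 3) ^ 2 ≠ 0 := by
        intro h
        apply mul_ne_zero h2 h3
        linear_combination 9 * h
      rw [← mul_inv, ← mul_inv, ← mul_inv, inv_sub_inv h5 (pow_ne_zero 2 h4), eq_div_iff (by positivity), inv_mul_eq_div, div_eq_iff]
      · ring
      · exact mul_ne_zero (mul_ne_zero h4 h4) (mul_ne_zero h2 h3)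
    · refine Eventually.of_forall fun m => ?_
      norm_num
      ring
  exact (finTwoArrowEquiv ℤ).symm.summable_iff.mpr h

/-- Restoring the subtracted terms r⁻² in Eisenstein's order of summation contributes G2. At (0, 0)
the convention 0⁻¹ = 0 makes both subtracted and restored terms vanish. -/
lemma tendsto_sum_tsum_inv (z : ℍ) (a : ℂ) (h : Summable (regTerm z a)) :
    Tendsto (fun N : ℕ => ∑ m ∈ Finset.Icc (-(N : ℤ)) N,
      ∑' n : ℤ, (((m : ℂ) * z + n) ^ 2 - a ^ 2)⁻¹) atTop (𝓝 (∑' p, regTerm z a p + G2 z)) := by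
  rw [← hasSum_symmetricIcc_iff (f := fun m : ℤ => ∑' n : ℤ, (((m : ℂ) * z + n) ^ 2 - a ^ 2)⁻¹)]
  have h1 : HasSum (fun m => ∑' n, regTerm z a (m, n)) (∑' p, regTerm z a p) := by
    rw [h.tsum_prod]
    exact h.prod.hasSum
  have h2 := (Tendsto.mono_left h1 (LeAtTop.le_atTop (L := symmetricIcc ℤ)) :
    HasSum _ _ (symmetricIcc ℤ))
  have h3 : HasSum _ _ (symmetricIcc ℤ) := HasSum.add h2 (summable_e2Summand_symmetricIcc z).hasSum
  refine Eq.mp (congrArg (fun f => HasSum f _ (symmetricIcc ℤ)) ?_) h3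
  funext m
  rw [e2Summand, ← (h.prod_factor m).tsum_add (e2Summand_summable m z)]
  refine tsum_congr fun n => ?_
  simp [regTerm, eisSummand, zpow_ofNat]

lemma coe_S_smul (z : ℍ) : ((ModularGroup.S • z : ℍ) : ℂ) = -1 / z := by
  rw [coe_SL_smul, den]
  simp [ModularGroup.S]

/-- Rotating the lattice divides mz + n by z and turns the shift 1/3 into ±(-1/z)/3. The sign is
invisible since only its square enters. -/
lemma regTerm_S_smul (z : ℍ) (p : ℤ × ℤ) :
    regTerm (ModularGroup.S • z) ((ModularGroup.S • z : ℍ) / 3) (-p.2, p.1) =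
      (z : ℂ) ^ 2 * regTerm z (1 / 3) p := by
  have hz := ne_zero z
  have h : ((-p.2 : ℤ) : ℂ) * (ModularGroup.S • z : ℍ) + (p.1 : ℤ) = (p.1 * z + p.2) / z := by
    rw [coe_S_smul]
    field_simp
    push_cast
    ring
  rw [regTerm, regTerm, h, coe_S_smul]
  generalize (p.1 : ℂ) * z + p.2 = r
  rw [show (r / z) ^ 2 - (-1 / (z : ℂ) / 3) ^ 2 = (r ^ 2 - (1 / 3) ^ 2) / z ^ 2 by ring,
    div_pow r, inv_div, inv_div]
  ring

/-- Rotation by a right angle of `ℤ²`. -/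
def rotInt : ℤ × ℤ ≃ ℤ × ℤ where
  toFun p := (-p.2, p.1)
  invFun p := (p.2, -p.1)
  left_inv p := by simp
  right_inv p := by simp

lemma hasSum_regTerm_S_smul (z : ℍ) :
    HasSum (regTerm (ModularGroup.S • z) ((ModularGroup.S • z : ℍ) / 3))
      ((z : ℂ) ^ 2 * ∑' p, regTerm z (1 / 3) p) := by
  rw [← rotInt.hasSum_iff]
  exact ((summable_regTerm_third z).hasSum.mul_left _).congr_fun fun p => regTerm_S_smul z p

/-- A primitive cube root of unity. -/
def cubeRoot : ℂ := Complex.exp (2 * Real.pi * Complex.I / 3)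

lemma cubeRoot_quadratic : cubeRoot ^ 2 + cubeRoot + 1 = 0 := by
  have h := (Complex.isPrimitiveRoot_exp 3 (by norm_num)).geom_sum_eq_zero (by norm_num)
  simp only [Finset.sum_range_succ, Finset.sum_range_zero] at h
  rw [cubeRoot]
  push_cast at h
  linear_combination h

/-- The square root `ω - ω²` of `-3`. -/
def sqrtNegThree : ℂ := cubeRoot - cubeRoot ^ 2

lemma sqrtNegThree_sq : sqrtNegThree ^ 2 = -3 := by
  rw [sqrtNegThree]
  linear_combination (cubeRoot ^ 2 - 3 * cubeRoot + 3) * cubeRoot_quadratic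

lemma sub_third_mem_integerComplement (z : ℍ) (m : ℤ) :
    (m : ℂ) * z - 1 / 3 ∈ Complex.integerComplement := by
  rw [Complex.mem_integerComplement_iff]
  rintro ⟨n, hn⟩
  refine three_mul_linear_ne_zero z ![m, -n] (Or.inr rfl) ?_
  simp
  linear_combination -3 * hn

lemma add_third_mem_integerComplement (z : ℍ) (m : ℤ) :
    (m : ℂ) * z + 1 / 3 ∈ Complex.integerComplement := by
  rw [Complex.mem_integerComplement_iff]
  rintro ⟨n, hn⟩
  refine three_mul_linear_ne_zero z ![m, -n] (Or.inl rfl) ?_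
  simp
  linear_combination -3 * hn

lemma qp_zpow (z : ℍ) (m : ℤ) :
    qp z ^ m = Complex.exp (2 * Real.pi * Complex.I * ((m : ℂ) * z)) := by
  rw [qp_eq, ← Complex.exp_int_mul]
  ring_nf

/-- The shifts ±1/3 multiply q^m by the two primitive cube roots of unity ω, ω², and (1 - xω)(1 -
xω²) = 1 + x + x². -/
lemma tsum_inv_third (z : ℍ) (m : ℤ) :
    ∑' n : ℤ, (((m : ℂ) * z + n) ^ 2 - (1 / 3) ^ 2)⁻¹ =
      3 * Real.pi * sqrtNegThree * Complex.I * (qp z ^ m / (1 + qp z ^ m + (qp z ^ m) ^ 2)) := by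
  have hw := cubeRoot_quadratic
  have h1 := sub_third_mem_integerComplement z m
  have h2 := add_third_mem_integerComplement z m
  have hw3 : cubeRoot ^ 3 = 1 := by linear_combination (cubeRoot - 1) * hw
  have e2 : Complex.exp (2 * Real.pi * Complex.I * ((m : ℂ) * z + 1 / 3)) = qp z ^ m * cubeRoot := by
    rw [qp_zpow, cubeRoot, ← Complex.exp_add]
    ring_nf
  have e1 : Complex.exp (2 * Real.pi * Complex.I * ((m : ℂ) * z - 1 / 3)) =
      qp z ^ m * cubeRoot ^ 2 := by
    have h3 : Complex.exp (2 * Real.pi * Complex.I * ((m : ℂ) * z - 1 / 3)) * cubeRoot = qp z ^ m := by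
      rw [qp_zpow, cubeRoot, ← Complex.exp_add]
      ring_nf
    linear_combination cubeRoot ^ 2 * h3 -
      Complex.exp (2 * Real.pi * Complex.I * ((m : ℂ) * z - 1 / 3)) * hw3
  have hne : ∀ y ∈ Complex.integerComplement, 1 - Complex.exp (2 * Real.pi * Complex.I * y) ≠ 0 := by
    intro y hy h
    rw [sub_eq_zero, eq_comm, Complex.exp_eq_one_iff] at h
    obtain ⟨n, hn⟩ := h
    refine hy ⟨n, ?_⟩
    have := Complex.two_pi_I_ne_zero
    refine mul_left_cancel₀ this ?_
    rw [hn]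
    ring
  have n1 := hne _ h1
  have n2 := hne _ h2
  rw [tsum_inv_sq_sub_sq (by norm_num) h1 h2, Complex.cot_pi_eq_exp_ratio,
    Complex.cot_pi_eq_exp_ratio]
  rw [e1] at n1 ⊢
  rw [e2] at n2 ⊢
  generalize qp z ^ m = x at *
  have h5 : (1 - x * cubeRoot ^ 2) * (1 - x * cubeRoot) = 1 + x + x ^ 2 := by
    linear_combination -x * hw + x ^ 2 * hw3
  rw [← h5, sqrtNegThree]
  have hI := Complex.I_ne_zero
  field_simp
  rw [Complex.I_sq]
  ring

lemma tendsto_sum_third (z : ℍ) : Tendsto (fun N : ℕ => ∑ m ∈ Finset.Icc (-(N : ℤ)) N,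
      ∑' n : ℤ, (((m : ℂ) * z + n) ^ 2 - (1 / 3) ^ 2)⁻¹) atTop
    (𝓝 (Real.pi * sqrtNegThree * Complex.I * fRho z)) := by
  have heven : Function.Even (fun m : ℤ => ∑' n : ℤ, (((m : ℂ) * z + n) ^ 2 - (1 / 3) ^ 2)⁻¹) := by
    intro m
    simp only [tsum_inv_third, zpow_neg]
    have := zpow_ne_zero m (qp_ne_zero z)
    congr 1
    rw [← mul_div_mul_right _ _ (pow_ne_zero 2 this)]
    congr 1 <;> field_simp
    ring
  -- The 1/3 is the term m = 0, where q^m = 1; the factor 2 pairs m with -m.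
  have h := ((hasSum_fRho z).tendsto_sum_nat.const_mul 2).const_add (1 / 3 : ℂ) |>.const_mul
    (3 * Real.pi * sqrtNegThree * Complex.I)
  convert h using 1
  · funext N
    rw [Finset.sum_Icc_of_even_eq_range heven, Finset.sum_range_succ']
    simp only [tsum_inv_third]
    rw [← Finset.mul_sum, nsmul_eq_mul]
    have : ∀ i ∈ Finset.range N, qp z ^ ((i + 1 : ℕ) : ℤ) /
        (1 + qp z ^ ((i + 1 : ℕ) : ℤ) + (qp z ^ ((i + 1 : ℕ) : ℤ)) ^ 2) =
        qp z ^ (i + 1) / (1 + qp z ^ (i + 1) + (qp z ^ (i + 1)) ^ 2) := by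
      intro i _
      rw [zpow_natCast]
    rw [Finset.sum_congr rfl this]
    norm_num
    ring
  · congr 1
    ring

/-- The function `(1 + q^k) / (1 - q^k)` of `k`. -/
def cotRatio (z : ℍ) (k : ℤ) : ℂ := (qp z ^ k + 1) / (1 - qp z ^ k)

lemma qp_zpow_ne_one (z : ℍ) {k : ℤ} (hk : k ≠ 0) : 1 - qp z ^ k ≠ 0 := by
  intro h
  have h1 : ‖qp z‖ ^ k = 1 := by rw [← norm_zpow, ← sub_eq_zero.mp h, norm_one]
  have h2 := (zpow_eq_one_iff_right₀ (norm_nonneg _) (norm_qp_lt_one z).ne).mp h1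
  exact hk h2

lemma cotRatio_neg (z : ℍ) (k : ℤ) : cotRatio z (-k) = -cotRatio z k := by
  rw [cotRatio, cotRatio, zpow_neg]
  have := zpow_ne_zero k (qp_ne_zero z)
  rw [← mul_div_mul_right _ _ this, ← div_neg]
  congr 1 <;> field_simp <;> ring

lemma cotRatio_natCast (z : ℍ) {k : ℕ} (hk : k ≠ 0) :
    cotRatio z k = 1 + 2 * (qp z ^ k / (1 - qp z ^ k)) := by
  have := qp_zpow_ne_one z (k := k) (by exact_mod_cast hk)
  rw [cotRatio, zpow_natCast] at *
  field_simp
  ring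

lemma tsum_inv_self {w τ : ℍ} (h : (w : ℂ) = 3 * τ) (m : ℤ) :
    ∑' n : ℤ, (((m : ℂ) * w + n) ^ 2 - (τ : ℂ) ^ 2)⁻¹ =
      Real.pi / (2 * τ * Complex.I) * (cotRatio τ (3 * m - 1) - cotRatio τ (3 * m + 1)) := by
  have hmem : ∀ k : ℤ, k ≠ 0 → (k : ℂ) * τ ∈ Complex.integerComplement := by
    intro k hk
    rw [Complex.mem_integerComplement_iff]
    rintro ⟨n, hn⟩
    have := congrArg Complex.im hn
    simp [hk, τ.im_ne_zero] at this
  have e1 : (m : ℂ) * w - τ = ((3 * m - 1 : ℤ) : ℂ) * τ := by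
    rw [h]
    push_cast
    ring
  have e2 : (m : ℂ) * w + τ = ((3 * m + 1 : ℤ) : ℂ) * τ := by
    rw [h]
    push_cast
    ring
  rw [tsum_inv_sq_sub_sq (ne_zero τ) (e1 ▸ hmem _ (by omega)) (e2 ▸ hmem _ (by omega)), e1, e2,
    Complex.cot_pi_eq_exp_ratio, Complex.cot_pi_eq_exp_ratio, ← qp_zpow, ← qp_zpow, cotRatio,
    cotRatio]
  have hI := Complex.I_ne_zero
  have n1 := qp_zpow_ne_one τ (k := 3 * m - 1) (by omega)
  have n2 := qp_zpow_ne_one τ (k := 3 * m + 1) (by omega)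
  field_simp

lemma rho_three_mul_add (N i : ℕ) : rho (3 * N + i) = rho i := by
  induction N with
  | zero => simp
  | succ N ih => rw [show 3 * (N + 1) + i = 3 * N + i + 3 by ring, rho_add_three, ih]

/-- Since `cotRatio` is odd, the terms m and -m combine, and the residues 3m ± 1 carry the values of
ρ₃. Their constants cancel except for the -2 of m = 0, the source of the summand 2 in
`tendsto_sum_self`. -/
lemma sum_cotRatio (τ : ℍ) (N : ℕ) :
    ∑ m ∈ Finset.Icc (-(N : ℤ)) N, (cotRatio τ (3 * m - 1) - cotRatio τ (3 * m + 1)) =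
      -2 - 4 * ∑ k ∈ Finset.range (3 * N + 2), rho k * (qp τ ^ k / (1 - qp τ ^ k)) := by
  induction N with
  | zero =>
    have h1 := cotRatio_natCast τ one_ne_zero
    have h2 := cotRatio_neg τ 1
    simp [Finset.sum_range_succ, rho_zero, rho_one] at h1 h2 ⊢
    rw [h2, h1]
    ring
  | succ N ih =>
    rw [Nat.cast_add, Nat.cast_one, Finset.Icc_succ_succ, Finset.sum_union (by simp),
      Finset.sum_pair (by lia), ih, show 3 * (N + 1) + 2 = 3 * N + 2 + 1 + 1 + 1 by ring,
      Finset.sum_range_succ _ (3 * N + 2 + 1 + 1), Finset.sum_range_succ _ (3 * N + 2 + 1),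
      Finset.sum_range_succ _ (3 * N + 2)]
    have hr := rho_three_mul_add N
    have h2 := cotRatio_neg τ (3 * (N + 1) - 1)
    have h4 := cotRatio_neg τ (3 * (N + 1) + 1)
    have h1 := cotRatio_natCast τ (k := 3 * N + 2) (by omega)
    have h3 := cotRatio_natCast τ (k := 3 * N + 4) (by omega)
    rw [show 3 * N + 2 + 1 + 1 = 3 * N + 4 by ring, show 3 * N + 2 + 1 = 3 * N + 3 by ring,
      hr, hr, hr, rho_two, rho_add_three 0, rho_add_three 1, rho_zero, rho_one]
    rw [show (3 : ℤ) * -(N + 1) - 1 = -(3 * (N + 1) + 1) by ring,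
      show (3 : ℤ) * -(N + 1) + 1 = -(3 * (N + 1) - 1) by ring, h2, h4,
      show (3 : ℤ) * (N + 1) - 1 = ((3 * N + 2 : ℕ) : ℤ) by push_cast; ring,
      show (3 : ℤ) * (N + 1) + 1 = ((3 * N + 4 : ℕ) : ℤ) by push_cast; ring, h1, h3]
    ring

lemma tendsto_sum_self {w τ : ℍ} (h : (w : ℂ) = 3 * τ) :
    Tendsto (fun N : ℕ => ∑ m ∈ Finset.Icc (-(N : ℤ)) N,
      ∑' n : ℤ, (((m : ℂ) * w + n) ^ 2 - (τ : ℂ) ^ 2)⁻¹) atTop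
    (𝓝 (Real.pi * Complex.I / (3 * τ) * (fRho τ + 2))) := by
  have ht : Tendsto (fun N : ℕ => 3 * N + 2) atTop atTop :=
    tendsto_atTop_mono (fun N => by simp only [id]; omega) tendsto_id
  have h1 := (((hasSum_fRho' τ).tendsto_sum_nat.comp ht).const_mul 4).const_sub (-2) |>.const_mul
    ((Real.pi : ℂ) / (2 * (τ : ℂ) * Complex.I))
  convert h1 using 1
  · funext N
    simp only [tsum_inv_self h]
    rw [← Finset.mul_sum, sum_cotRatio]
    rfl
  · congr 1
    have := ne_zero τ
    have hI := Complex.I_ne_zero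
    field_simp
    rw [Complex.I_sq]
    ring

/-- The transformation of `fRho` under the Fricke involution `z ↦ -1/(3z)`. -/
theorem fRho_fricke {z τ : ℍ} (h : (τ : ℂ) = -1 / (3 * z)) :
    fRho τ = -sqrtNegThree * z * fRho z := by
  have hz := ne_zero z
  have hw : ((ModularGroup.S • z : ℍ) : ℂ) = 3 * τ := by
    rw [coe_S_smul, h]
    field_simp
  have hτ : ((ModularGroup.S • z : ℍ) : ℂ) / 3 = τ := by
    rw [hw]
    field_simp
  have h1 := tendsto_nhds_unique (tendsto_sum_tsum_inv z (1 / 3) (summable_regTerm_third z))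
    (tendsto_sum_third z)
  have h2 := hasSum_regTerm_S_smul z
  rw [hτ] at h2
  have h3 := tendsto_nhds_unique (tendsto_sum_tsum_inv _ _ h2.summable) (tendsto_sum_self hw)
  rw [h2.tsum_eq, h] at h3
  have h4 := G2_S_transform z
  -- The anomaly -2πiz of G2 cancels exactly the extra summand 2 beside `fRho τ`; the regularised
  -- sums cancel as well, leaving a homogeneous law.
  have h5 : G2 (ModularGroup.S • z) = z ^ 2 * G2 z - 2 * Real.pi * Complex.I * z := by
    rw [h4]
    field_simp
    ring
  rw [h5] at h3
  have h6 : Real.pi * Complex.I / (3 * (-1 / (3 * (z : ℂ)))) = - (Real.pi * Complex.I * z) := by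
    field_simp
  rw [h6] at h3
  have hne : (Real.pi * Complex.I * z : ℂ) ≠ 0 := by
    simp [Real.pi_ne_zero, hz]
  refine mul_left_cancel₀ hne ?_
  linear_combination h3 - (z : ℂ) ^ 2 * h1

end Eisenstein

/-! ### Modularity of the Eisenstein series and its dilates. -/

lemma mdifferentiable_of_hasSum {f : ℍ → ℂ} {c : ℕ → ℂ}
    (hf : ∀ z, HasSum (fun m => c m * qp z ^ m) (f z)) : MDiff f := by
  refine mdifferentiable_of_coe
    (F := fun w => ∑' m : ℕ, c m * Complex.exp (2 * Real.pi * Complex.I * m * w)) ?_ ?_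
  · intro w hw
    -- Convergence at this point dominates the series uniformly on the half plane above it, which
    -- contains w.
    let z0 : ℍ := ⟨Complex.I * (w.im / 2 : ℝ), by simpa using hw⟩
    have hs : IsOpen {v : ℂ | w.im / 2 < v.im} := isOpen_lt continuous_const Complex.continuous_im
    have h := Complex.differentiableOn_tsum_of_summable_norm (hf z0).summable.norm
      (F := fun (m : ℕ) v => c m * Complex.exp (2 * Real.pi * Complex.I * m * v)) (fun m => ?_) hs ?_
    · exact h.differentiableAt (hs.mem_nhds (by simpa using hw))
    · fun_prop
    · intro m v hv
      rw [norm_mul, norm_mul, qp_pow, Complex.norm_exp, Complex.norm_exp]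
      refine mul_le_mul_of_nonneg_left (Real.exp_le_exp.mpr ?_) (norm_nonneg _)
      have h1 : (z0 : ℂ) = Complex.I * (w.im / 2 : ℝ) := rfl
      have h2 : ∀ v : ℂ, (2 * Real.pi * Complex.I * m * v).re = -(2 * Real.pi * m * v.im) := by
        intro v
        simp [Complex.mul_re, Complex.mul_im]
      rw [h2, h2, neg_le_neg_iff]
      refine mul_le_mul_of_nonneg_left ?_ (by positivity)
      rw [h1]
      simpa using le_of_lt hv
  · intro z
    rw [← (hf z).tsum_eq]
    refine tsum_congr fun m => ?_
    rw [qp_pow]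

/-- The Fourier coefficients of `fRho`. -/
def fRhoCoeff (n : ℕ) : ℂ := if n = 0 then 1 else 6 * ∑ d ∈ n.divisors, rho d

lemma hasSum_fRhoCoeff (z : ℍ) : HasSum (fun m => fRhoCoeff m * qp z ^ m) (fRho z) := by
  have hx := norm_qp_lt_one z
  have h := (hasSum_rho_divisors hx).mul_left 6
  rw [← Equiv.pnatEquivNat.symm.hasSum_iff] at h
  rw [← hasSum_nat_add_iff' 1, fRho_eq_tsum]
  simp only [Finset.sum_range_one, fRhoCoeff, if_true, pow_zero, mul_one, add_sub_cancel_left]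
  refine h.congr_fun fun n => ?_
  simp [Equiv.pnatEquivNat]
  ring

lemma isBoundedAtImInfty_fRho : IsBoundedAtImInfty fRho :=
  isBoundedAtImInfty_of_hasSum_qExpansion one_pos hasSum_fRhoCoeff

lemma mdifferentiable_fRho : MDiff fRho := mdifferentiable_of_hasSum hasSum_fRhoCoeff

lemma qp_T_zpow_smul (n : ℤ) (z : ℍ) : qp (ModularGroup.T ^ n • z) = qp z := by
  rw [qp_eq, qp_eq, modular_T_zpow_smul, coe_vadd, mul_add, Complex.exp_add]
  have := Complex.exp_int_mul_two_pi_mul_I n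
  push_cast
  rw [show 2 * Real.pi * Complex.I * (n : ℂ) = n * (2 * Real.pi * Complex.I) by ring, this, one_mul]

lemma fRho_eq_of_qp_eq {z w : ℍ} (h : qp z = qp w) : fRho z = fRho w := by
  refine (hasSum_fRhoCoeff z).unique ?_
  rw [h]
  exact hasSum_fRhoCoeff w

lemma fRho_T_zpow_smul (n : ℤ) (z : ℍ) : fRho (ModularGroup.T ^ n • z) = fRho z :=
  fRho_eq_of_qp_eq (qp_T_zpow_smul n z)

/-- The Fricke involution `z ↦ -1/(3z)`. -/
def fricke (z : ℍ) : ℍ := ⟨-1 / (3 * z), by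
  have h : (-1 / (3 * (z : ℂ))).im = z.im / (3 * Complex.normSq z) := by
    rw [Complex.div_im]
    have := Complex.normSq_pos.mpr (ne_zero z)
    simp
    field_simp
  rw [h]
  exact div_pos z.im_pos (mul_pos three_pos (Complex.normSq_pos.mpr (ne_zero z)))⟩

lemma coe_fricke (z : ℍ) : (fricke z : ℂ) = -1 / (3 * z) := rfl

lemma fRho_fricke_apply (z : ℍ) : fRho (fricke z) = -sqrtNegThree * z * fRho z := fRho_fricke rfl

lemma sqrtNegThree_ne_zero : sqrtNegThree ≠ 0 := by
  intro h
  have := sqrtNegThree_sq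
  rw [h] at this
  norm_num at this

/-- U 3 is T⁻¹ conjugated by the Fricke involution. -/
lemma fRho_U_smul (z : ℍ) : fRho (U 3 • z) = den (U 3) z * fRho z := by
  have hz := ne_zero z
  have hd := den_ne_zero (U 3) z
  have hU : ((U 3 • z : ℍ) : ℂ) = z / den (U 3) z := by
    rw [coe_SL_smul]
    simp
  have h : ModularGroup.T ^ (-1 : ℤ) • fricke z = fricke (U 3 • z) := by
    ext
    rw [modular_T_zpow_smul, coe_vadd, coe_fricke, coe_fricke, hU]
    field_simp
    simp [den]
    ring
  have h1 := fRho_T_zpow_smul (-1) (fricke z)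
  rw [h, fRho_fricke_apply, fRho_fricke_apply, hU] at h1
  have := sqrtNegThree_ne_zero
  field_simp at h1
  linear_combination -h1

lemma fRho_smul {γ : SL(2, ℤ)} (hγ : γ ∈ Gamma1 3) : ∀ z, fRho (γ • z) = den γ z * fRho z := by
  have h := closure_T_U (N := 3) (Or.inl rfl)
  rw [← h] at hγ
  induction hγ using Subgroup.closure_induction with
  | mem γ hγ =>
    intro z
    rcases hγ with rfl | rfl
    · have := fRho_T_zpow_smul 1 z
      rw [zpow_one] at this
      rw [this]
      simp [den, ModularGroup.T]
    · exact fRho_U_smul z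
  | one => intro z; simp [den]
  | mul γ δ _ _ hγ hδ =>
    intro z
    rw [mul_smul, hγ, hδ, den_mul, mul_assoc]
  | inv γ _ hγ =>
    intro z
    have h1 := hγ (γ⁻¹ • z)
    have h2 := den_mul γ γ⁻¹ z
    rw [smul_inv_smul] at h1
    rw [mul_inv_cancel] at h2
    have h3 : den 1 z = 1 := by simp [den]
    rw [h1, ← mul_assoc, mul_comm (den γ⁻¹ z), ← h2, h3, one_mul]

/-- Either γ or -γ lies in Γ₁(3), and the norm does not see the sign. -/
lemma norm_fRho_smul {γ : SL(2, ℤ)} (hγ : 3 ∣ γ 1 0) (z : ℍ) :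
    ‖fRho (γ • z)‖ = ‖den γ z‖ * ‖fRho z‖ := by
  have hdet := γ.det_coe
  rw [Matrix.det_fin_two] at hdet
  obtain ⟨e, he⟩ := hγ
  have h1 : (γ 0 0 * γ 1 1) % 3 = 1 := by
    rw [he] at hdet
    have : γ 0 0 * γ 1 1 = 1 + 3 * (γ 0 1 * e) := by linarith
    omega
  have h2 : (γ 0 0 % 3 = 1 ∧ γ 1 1 % 3 = 1) ∨ (γ 0 0 % 3 = 2 ∧ γ 1 1 % 3 = 2) := by
    rw [Int.mul_emod] at h1
    have ha := Int.emod_nonneg (γ 0 0) (show (3 : ℤ) ≠ 0 by norm_num)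
    have hb := Int.emod_nonneg (γ 1 1) (show (3 : ℤ) ≠ 0 by norm_num)
    have ha' := Int.emod_lt_of_pos (γ 0 0) (show (0 : ℤ) < 3 by norm_num)
    have hb' := Int.emod_lt_of_pos (γ 1 1) (show (0 : ℤ) < 3 by norm_num)
    generalize γ 0 0 % 3 = a at *
    generalize γ 1 1 % 3 = b at *
    interval_cases a <;> interval_cases b <;> simp_all
  rcases h2 with ⟨ha, hd⟩ | ⟨ha, hd⟩
  · rw [fRho_smul ((mem_Gamma1_iff 3 γ).mpr ⟨by omega, by omega, ⟨e, he⟩⟩), norm_mul]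
  · have hm : -γ ∈ Gamma1 3 := by
      rw [mem_Gamma1_iff]
      simp only [Matrix.SpecialLinearGroup.coe_neg, Matrix.neg_apply]
      exact ⟨by omega, by omega, by omega⟩
    rw [← ModularGroup.SL_neg_smul, fRho_smul hm, norm_mul]
    congr 1
    have : den (-γ) z = -den γ z := by
      simp [den]
      ring
    rw [this, norm_neg]

/-- The point `z/3` of the upper half plane. -/
def thirdPt (z : ℍ) : ℍ := ⟨z / 3, by simpa using z.im_pos⟩

lemma fRho_S_smul (z : ℍ) : fRho (ModularGroup.S • z) = -sqrtNegThree / 3 * z * fRho (thirdPt z) := by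
  have hz := ne_zero z
  have : ModularGroup.S • z = fricke (thirdPt z) := by
    ext
    rw [coe_S_smul, coe_fricke]
    change _ = -1 / (3 * ((z : ℂ) / 3))
    field_simp
  rw [this, fRho_fricke_apply]
  change -sqrtNegThree * ((z : ℂ) / 3) * _ = _
  ring

/-- Γ₀(3) has the two cusps ∞ and 0: α lies in Γ₀(3) or in Γ₀(3) S T^j, and S turns `fRho` into a
multiple of its value at z/3. -/
lemma isBoundedAtImInfty_fRho_slash (α : SL(2, ℤ)) :
    IsBoundedAtImInfty (fRho ∣[((1 : ℕ) : ℤ)] α) := by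
  obtain ⟨B, A, hB⟩ := isBoundedAtImInfty_iff.mp isBoundedAtImInfty_fRho
  rw [isBoundedAtImInfty_iff]
  by_cases hc : 3 ∣ α 1 0
  · refine ⟨B, A, fun z hz => ?_⟩
    rw [slash_apply_eq, pow_one, norm_mul, norm_fRho_smul hc, norm_inv, inv_mul_cancel_left₀]
    · exact hB z hz
    · exact norm_ne_zero_iff.mpr (den_ne_zero α z)
  · obtain ⟨j, hj⟩ : ∃ j : ℤ, 3 ∣ α 1 1 - j * α 1 0 := by
      -- With j = cd one has d - jc = (1 - c²)d, and c² ≡ 1 modulo 3.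
      refine ⟨α 1 0 * α 1 1, ?_⟩
      have h1 : α 1 0 * α 1 0 % 3 = 1 := by
        rw [Int.mul_emod]
        have h2 : α 1 0 % 3 = 1 ∨ α 1 0 % 3 = 2 := by omega
        rcases h2 with h | h <;> rw [h] <;> norm_num
      have h2 : 3 ∣ 1 - α 1 0 * α 1 0 := by omega
      rw [show α 1 1 - α 1 0 * α 1 1 * α 1 0 = (1 - α 1 0 * α 1 0) * α 1 1 by ring]
      exact h2.mul_right _
    obtain ⟨γ, hα, h10⟩ : ∃ γ : SL(2, ℤ),
        α = γ * (ModularGroup.S * ModularGroup.T ^ j) ∧ 3 ∣ γ 1 0 := by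
      refine ⟨α * ModularGroup.T ^ (-j) * ModularGroup.S⁻¹, by group, ?_⟩
      have : (α * ModularGroup.T ^ (-j) * ModularGroup.S⁻¹) 1 0 = -(α 1 1 - j * α 1 0) := by
        rw [ModularGroup.S_inv]
        simp [ModularGroup.coe_S, ModularGroup.coe_T_zpow, Matrix.mul_apply, Fin.sum_univ_two]
        ring
      rw [this]
      exact (dvd_neg).mpr hj
    refine ⟨‖sqrtNegThree / 3‖ * B, 3 * A, fun z hz => ?_⟩
    have hdS : ∀ w : ℍ, den ModularGroup.S w = w := by
      intro w
      simp [den, ModularGroup.S]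
    have hdT : den (ModularGroup.T ^ j) z = 1 := by
      simp [den, ModularGroup.coe_T_zpow]
    have hn : ‖den γ ((ModularGroup.S * ModularGroup.T ^ j) • z)‖ ≠ 0 :=
      norm_ne_zero_iff.mpr (den_ne_zero _ _)
    have hw : ‖((ModularGroup.T ^ j • z : ℍ) : ℂ)‖ ≠ 0 := norm_ne_zero_iff.mpr (ne_zero _)
    have hi : A ≤ (thirdPt (ModularGroup.T ^ j • z)).im := by
      have h1 : (thirdPt (ModularGroup.T ^ j • z)).im = (ModularGroup.T ^ j • z).im / 3 := by
        change ((((ModularGroup.T ^ j • z : ℍ) : ℂ)) / 3).im = _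
        simp
      rw [h1, ModularGroup.im_T_zpow_smul]
      linarith
    rw [slash_apply_eq, pow_one, hα, mul_smul, den_mul, den_mul, hdS, hdT, norm_mul,
      norm_fRho_smul h10, mul_smul, fRho_S_smul, norm_inv, norm_mul, norm_mul, norm_mul, norm_mul, norm_one, ← mul_smul]
    have := hB _ hi
    calc _ = ‖-sqrtNegThree / 3‖ * ‖fRho (thirdPt (ModularGroup.T ^ j • z))‖ := by
          field_simp
      _ ≤ _ := by
          rw [neg_div, norm_neg]
          exact mul_le_mul_of_nonneg_left this (norm_nonneg _)

lemma dilate_fRho_mem {h : ℕ+} (hh : (h : ℕ) ∣ 4) : dilate h fRho ∈ M (Gamma1 12) 2 := by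
  refine ⟨mdifferentiable_dilate h mdifferentiable_fRho, ?_, ?_⟩
  · intro γ hγ z
    obtain ⟨ha, hd, hc⟩ := (mem_Gamma1_iff 12 γ).mp hγ
    have hh' : ((h : ℕ) : ℤ) ∣ 4 := by exact_mod_cast hh
    obtain ⟨γ', h00, h11, h10, h1⟩ := exists_dilatePt_smul h γ
      ((hh'.trans (by norm_num)).trans hc)
    have hmem : γ' ∈ Gamma1 3 := by
      rw [mem_Gamma1_iff, h00, h11]
      push_cast at ha hd hc ⊢
      refine ⟨by omega, by omega, ?_⟩
      obtain ⟨s, hs⟩ := hh'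
      obtain ⟨t, ht⟩ := hc
      have h0 : ((h : ℕ) : ℤ) ≠ 0 := by exact_mod_cast h.ne_zero
      refine ⟨s * t, mul_left_cancel₀ h0 ?_⟩
      rw [h10, ht]
      linear_combination 3 * t * hs
    have hJ : J γ z ^ 2 = den γ z := J_sq γ z
    rw [dilate_apply, dilate_apply, (h1 z).1, fRho_smul hmem, (h1 z).2, hJ,
      inv_mul_cancel_left₀ (den_ne_zero γ z)]
  · intro α
    have := isBoundedAtImInfty_dilate_slash isBoundedAtImInfty_fRho_slash h α
    refine this.congr_left fun z => ?_
    rw [slash_apply_eq, pow_one, sqrtDenom_sq]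
    rfl

/-! ### Calculus of truncated q-expansions. -/

section Truncation

/-- `f` agrees with the polynomial `P` in `q` up to `O(q^n)` at `i∞`. -/
def HasTrunc (n : ℕ) (f : ℍ → ℂ) (P : Polynomial ℂ) : Prop :=
  (fun z => f z - P.eval (qp z)) =O[atImInfty] fun z => qp z ^ n

variable {n : ℕ} {f g : ℍ → ℂ} {P Q : Polynomial ℂ}

lemma tendsto_eval_qp (P : Polynomial ℂ) :
    Tendsto (fun z => P.eval (qp z)) atImInfty (𝓝 (P.eval 0)) :=
  (P.continuous.tendsto 0).comp tendsto_qp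

lemma isBigO_qp_pow_one (n : ℕ) : (fun z => qp z ^ n) =O[atImInfty] fun _ => (1 : ℂ) :=
  (isBigO_qp_pow (Nat.zero_le n)).congr_right fun _ => pow_zero _

lemma HasTrunc.isBigO_one (h : HasTrunc n f P) : f =O[atImInfty] fun _ => (1 : ℂ) := by
  have h1 := (h.trans (isBigO_qp_pow_one n)).add ((tendsto_eval_qp P).isBigO_one ℂ)
  exact h1.congr_left fun z => sub_add_cancel _ _

lemma HasTrunc.add (hf : HasTrunc n f P) (hg : HasTrunc n g Q) : HasTrunc n (f + g) (P + Q) := by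
  refine (IsBigO.add hf hg).congr_left fun z => ?_
  rw [Pi.add_apply, Polynomial.eval_add]
  ring

lemma HasTrunc.smul (a : ℂ) (hf : HasTrunc n f P) : HasTrunc n (a • f) (Polynomial.C a * P) := by
  refine (IsBigO.const_mul_left hf a).congr_left fun z => ?_
  rw [Pi.smul_apply, Polynomial.eval_mul, Polynomial.eval_C, smul_eq_mul]
  ring

lemma HasTrunc.sub (hf : HasTrunc n f P) (hg : HasTrunc n g Q) : HasTrunc n (f - g) (P - Q) := by
  refine (IsBigO.sub hf hg).congr_left fun z => ?_
  rw [Pi.sub_apply, Polynomial.eval_sub]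
  ring

lemma HasTrunc.mul (hf : HasTrunc n f P) (hg : HasTrunc n g Q) : HasTrunc n (f * g) (P * Q) := by
  have h1 : (fun z => (f z - P.eval (qp z)) * g z) =O[atImInfty] fun z => qp z ^ n := by
    simpa only [mul_one] using! IsBigO.mul hf hg.isBigO_one
  have h2 : (fun z => P.eval (qp z) * (g z - Q.eval (qp z))) =O[atImInfty] fun z => qp z ^ n := by
    simpa only [one_mul] using! IsBigO.mul ((tendsto_eval_qp P).isBigO_one ℂ) hg
  refine (h1.add h2).congr_left fun z => ?_
  rw [Pi.mul_apply, Polynomial.eval_mul]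
  ring

lemma HasTrunc.one : HasTrunc n 1 1 := by
  simp [HasTrunc, isBigO_zero]

lemma HasTrunc.pow (hf : HasTrunc n f P) (k : ℕ) : HasTrunc n (f ^ k) (P ^ k) := by
  induction k with
  | zero => simpa only [pow_zero] using HasTrunc.one
  | succ k ih => simpa only [pow_succ] using ih.mul hf

lemma isBigO_qp_pow_mul_eval (n : ℕ) (Q : Polynomial ℂ) :
    (fun z => qp z ^ n * Q.eval (qp z)) =O[atImInfty] fun z => qp z ^ n := by
  simpa only [mul_one] using!
    IsBigO.mul (isBigO_refl (fun z => qp z ^ n) atImInfty) ((tendsto_eval_qp Q).isBigO_one ℂ)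

lemma HasTrunc.isBigO (hf : HasTrunc n f P) (hP : Polynomial.X ^ n ∣ P) :
    f =O[atImInfty] fun z => qp z ^ n := by
  obtain ⟨Q, rfl⟩ := hP
  refine (IsBigO.add hf (isBigO_qp_pow_mul_eval n Q)).congr_left fun z => ?_
  rw [Polynomial.eval_mul, Polynomial.eval_pow, Polynomial.eval_X]
  ring

lemma HasTrunc.mono {m : ℕ} (h : m ≤ n) (hf : HasTrunc n f P) : HasTrunc m f P :=
  IsBigO.trans hf (isBigO_qp_pow h)

lemma HasTrunc.add_monomial (hf : HasTrunc n f (P + Polynomial.X ^ n * Q)) : HasTrunc n f P := by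
  refine (IsBigO.add hf (isBigO_qp_pow_mul_eval n Q)).congr_left fun z => ?_
  simp only [Polynomial.eval_add, Polynomial.eval_mul, Polynomial.eval_pow, Polynomial.eval_X]
  ring

lemma qp_dilatePt (h : ℕ+) (z : ℍ) : qp (dilatePt h z) = qp z ^ (h : ℕ) := by
  rw [qp_pow, qp_eq, coe_dilatePt]
  ring_nf

lemma tendsto_dilatePt (h : ℕ+) : Tendsto (dilatePt h) atImInfty atImInfty := by
  have h0 : (1 : ℝ) ≤ ((h : ℕ) : ℝ) := by exact_mod_cast h.pos
  refine tendsto_comap_iff.mpr (tendsto_atTop_mono (fun z => ?_) tendsto_comap)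
  have : (dilatePt h z).im = (h : ℕ) * z.im := by
    change (((h : ℕ) : ℂ) * (z : ℂ)).im = _
    simp
  rw [Function.comp_apply, this]
  exact le_mul_of_one_le_left z.im_pos.le h0

lemma HasTrunc.dilate (h : ℕ+) (hf : HasTrunc n f P) :
    HasTrunc (h * n) (dilate h f) (P.comp (Polynomial.X ^ (h : ℕ))) := by
  have := IsBigO.comp_tendsto hf (tendsto_dilatePt h)
  refine (this.congr_left fun z => ?_).congr_right fun z => ?_
  · rw [Function.comp_apply, dilate_apply, Polynomial.eval_comp, Polynomial.eval_pow,
      Polynomial.eval_X, qp_dilatePt]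
  · rw [Function.comp_apply, qp_dilatePt, pow_mul]

lemma hasTrunc_of_hasSum {c : ℕ → ℂ} (hf : ∀ z, HasSum (fun m => c m * qp z ^ m) (f z)) (n : ℕ) :
    HasTrunc n f (∑ m ∈ Finset.range n, Polynomial.C (c m) * Polynomial.X ^ m) := by
  refine (isBigO_sub_sum_of_hasSum hf n).congr_left fun z => ?_
  simp [Polynomial.eval_finsetSum]

end Truncation

/-! ### Expansions of the generators. -/

section Expansions

/-- Precision 7 = 2·3 + 1 is what `eq_zero_of_isBigO` demands in weight 3/2, where the first two
relations live. -/
lemma hasTrunc_fRho : HasTrunc 7 fRho (1 + 6 * Polynomial.X + 6 * Polynomial.X ^ 3 + 6 * Polynomial.X ^ 4) := by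
  have h := hasTrunc_of_hasSum hasSum_fRhoCoeff 7
  have r3 : rho 3 = 0 := by rw [rho_add_three 0, rho_zero]
  have r4 : rho 4 = 1 := by rw [rho_add_three 1, rho_one]
  have r5 : rho 5 = -1 := by rw [rho_add_three 2, rho_two]
  have r6 : rho 6 = 0 := by rw [rho_add_three 3, r3]
  have d2 : Nat.divisors 2 = {1, 2} := by decide
  have d3 : Nat.divisors 3 = {1, 3} := by decide
  have d4 : Nat.divisors 4 = {1, 2, 4} := by decide
  have d5 : Nat.divisors 5 = {1, 5} := by decide
  have d6 : Nat.divisors 6 = {1, 2, 3, 6} := by decide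
  have h6 : Polynomial.C (6 : ℂ) = 6 := map_ofNat _ 6
  convert h using 1
  simp [h6, Finset.sum_range_succ, fRhoCoeff, d2, d3, d4, d5, d6, rho_one, rho_two, r3, r4, r5, r6]

/-- The indicator function of the nonzero squares. -/
def squareCoeff (m : ℕ) : ℂ := if m ≠ 0 ∧ IsSquare m then 1 else 0

lemma hasSum_theta (z : ℍ) : HasSum (fun m => squareCoeff m * qp z ^ m) ((theta z - 1) / 2) := by
  have hz : 0 < (2 * (z : ℂ)).im := by simpa using z.im_pos
  have h := hasSum_nat_jacobiTheta hz
  have hinj : Function.Injective fun n : ℕ => (n + 1) ^ 2 := by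
    intro a b hab
    have := Nat.pow_left_injective two_ne_zero hab
    omega
  rw [theta_eq_thetaC, thetaC, ← hinj.hasSum_iff]
  · refine h.congr_fun fun n => ?_
    have : squareCoeff ((n + 1) ^ 2) = 1 := by
      rw [squareCoeff, if_pos ⟨by positivity, ⟨n + 1, sq _⟩⟩]
    rw [Function.comp_apply, this, one_mul, qp_pow]
    push_cast
    ring_nf
  · intro m hm
    rw [squareCoeff, if_neg, zero_mul]
    rintro ⟨h0, r, rfl⟩
    refine hm ⟨r - 1, ?_⟩
    have : r ≠ 0 := by
      rintro rfl
      exact h0 rfl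
    dsimp only
    rw [Nat.sub_add_cancel (by omega), sq]

lemma HasTrunc.of_half {n : ℕ} {P : Polynomial ℂ}
    (h : HasTrunc n (fun z => (theta z - 1) / 2) P) : HasTrunc n theta (1 + 2 * P) := by
  refine (IsBigO.const_mul_left h 2).congr_left fun z => ?_
  rw [Polynomial.eval_add, Polynomial.eval_mul, Polynomial.eval_one, Polynomial.eval_ofNat]
  ring

lemma hasTrunc_theta : HasTrunc 7 theta (1 + 2 * (Polynomial.X + Polynomial.X ^ 4)) := by
  have h := (hasTrunc_of_hasSum hasSum_theta 7)
  refine HasTrunc.of_half ?_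
  have s2 : ¬ IsSquare (2 : ℕ) := by norm_num
  have s3 : ¬ IsSquare (3 : ℕ) := by norm_num
  have s4 : IsSquare (4 : ℕ) := by norm_num
  have s5 : ¬ IsSquare (5 : ℕ) := by norm_num
  have s6 : ¬ IsSquare (6 : ℕ) := by norm_num
  convert h using 1
  simp [Finset.sum_range_succ, squareCoeff, s2, s3, s4, s5, s6]

lemma hasTrunc_dilate_three_theta : HasTrunc 7 (dilate 3 theta) (1 + 2 * Polynomial.X ^ 3) := by
  have h := (hasTrunc_theta.dilate 3).mono (show 7 ≤ _ by norm_num)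
  refine HasTrunc.add_monomial (Q := 2 * Polynomial.X ^ 5) ?_
  convert h using 1
  simp
  ring

lemma dilate_two_dilate_two (f : ℍ → ℂ) : dilate 2 (dilate 2 f) = dilate 4 f := by
  funext z
  rw [dilate_apply, dilate_apply, dilate_apply]
  congr 1
  ext
  rw [coe_dilatePt, coe_dilatePt, coe_dilatePt]
  push_cast
  ring

lemma u12_eq : u12 = fRho + (2 : ℂ) • dilate 2 fRho - (2 : ℂ) • dilate 4 fRho := by
  have h : dilate 2 alpha6 = (1 / 6 : ℂ) • (dilate 2 fRho - dilate 4 fRho) := by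
    rw [← dilate_two_dilate_two]
    rfl
  rw [u12, alpha12, h, alpha6]
  module

lemma v12_eq : v12 = (2 / 3 : ℂ) • dilate 4 fRho + (2 / 3 : ℂ) • dilate 2 fRho -
    (1 / 3 : ℂ) • fRho := by
  have h : dilate 2 alpha6 = (1 / 6 : ℂ) • (dilate 2 fRho - dilate 4 fRho) := by
    rw [← dilate_two_dilate_two]
    rfl
  rw [v12, alpha12, h, alpha6]
  module

lemma fRho_mem : fRho ∈ M (Gamma1 12) 2 := by
  have h : dilate 1 fRho = fRho := by
    funext z
    rw [dilate_apply]
    congr 1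
    ext
    rw [coe_dilatePt]
    simp
  rw [← h]
  exact dilate_fRho_mem (by norm_num)

lemma dilate_two_fRho_mem : dilate 2 fRho ∈ M (Gamma1 12) 2 :=
  dilate_fRho_mem (h := 2) (show (2 : ℕ) ∣ 4 by norm_num)

lemma dilate_four_fRho_mem : dilate 4 fRho ∈ M (Gamma1 12) 2 :=
  dilate_fRho_mem (h := 4) (show (4 : ℕ) ∣ 4 by norm_num)

lemma u12_mem : u12 ∈ M (Gamma1 12) 2 := by
  rw [u12_eq]
  exact sub_mem (add_mem fRho_mem (Submodule.smul_mem _ _ dilate_two_fRho_mem))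
    (Submodule.smul_mem _ _ dilate_four_fRho_mem)

lemma v12_mem : v12 ∈ M (Gamma1 12) 2 := by
  rw [v12_eq]
  exact sub_mem (add_mem (Submodule.smul_mem _ _ dilate_four_fRho_mem)
    (Submodule.smul_mem _ _ dilate_two_fRho_mem)) (Submodule.smul_mem _ _ fRho_mem)

lemma theta_mem_twelve : theta ∈ M (Gamma1 12) 1 :=
  M_mono (Gamma1_le_of_dvd (by norm_num)) 1 theta_mem

lemma hasTrunc_dilate_two_fRho : HasTrunc 7 (dilate 2 fRho) (1 + 6 * Polynomial.X ^ 2 + 6 * Polynomial.X ^ 6) := by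
  have h := (hasTrunc_fRho.dilate 2).mono (show 7 ≤ _ by norm_num)
  refine HasTrunc.add_monomial (Q := 6 * Polynomial.X) ?_
  convert h using 1
  simp
  ring

lemma hasTrunc_dilate_four_fRho : HasTrunc 7 (dilate 4 fRho) (1 + 6 * Polynomial.X ^ 4) := by
  have h := (hasTrunc_fRho.dilate 4).mono (show 7 ≤ _ by norm_num)
  refine HasTrunc.add_monomial (Q := 6 * Polynomial.X ^ 5 + 6 * Polynomial.X ^ 9) ?_
  convert h using 1
  simp
  ring

lemma hasTrunc_u12 : HasTrunc 7 u12
    (1 + 6 * Polynomial.X + 12 * Polynomial.X ^ 2 + 6 * Polynomial.X ^ 3 - 6 * Polynomial.X ^ 4 + 12 * Polynomial.X ^ 6) := by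
  rw [u12_eq]
  convert (hasTrunc_fRho.add (hasTrunc_dilate_two_fRho.smul 2)).sub
    (hasTrunc_dilate_four_fRho.smul 2) using 1
  simp only [map_ofNat]
  ring

lemma hasTrunc_v12 : HasTrunc 7 v12
    (1 - 2 * Polynomial.X + 4 * Polynomial.X ^ 2 - 2 * Polynomial.X ^ 3 + 2 * Polynomial.X ^ 4 + 4 * Polynomial.X ^ 6) := by
  rw [v12_eq]
  convert ((hasTrunc_dilate_four_fRho.smul (2 / 3)).add (hasTrunc_dilate_two_fRho.smul (2 / 3))).sub
    (hasTrunc_fRho.smul (1 / 3)) using 1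
  have h3 : (Polynomial.C (2 / 3) : Polynomial ℂ) = 2 * Polynomial.C (1 / 3) := by
    rw [← map_ofNat Polynomial.C 2, ← map_mul]
    norm_num
  have h1 : (3 : Polynomial ℂ) * Polynomial.C (1 / 3) = 1 := by
    rw [← map_ofNat Polynomial.C 3, ← map_mul]
    norm_num
  rw [h3]
  linear_combination -(1 - 2 * Polynomial.X + 4 * Polynomial.X ^ 2 - 2 * Polynomial.X ^ 3 + 2 * Polynomial.X ^ 4 + 4 * Polynomial.X ^ 6) * h1

end Expansions

/-! ### The three relations between the generators. -/

section Relations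

lemma mul_mem_M {Γ : Subgroup SL(2, ℤ)} {a b c : ℕ} (h : a + b = c) {f g : ℍ → ℂ} (hf : f ∈ M Γ a)
    (hg : g ∈ M Γ b) : f * g ∈ M Γ c :=
  h ▸ SetLike.mul_mem_graded hf hg

lemma pow_mem_M {Γ : Subgroup SL(2, ℤ)} {f : ℍ → ℂ} (n : ℕ) (hf : f ∈ M Γ 1) : f ^ n ∈ M Γ n := by
  simpa using SetLike.pow_mem_graded n hf

lemma eq_of_hasTrunc {m n : ℕ} (hn : n = 2 * m + 1) {f g : ℍ → ℂ} {P Q : Polynomial ℂ}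
    (hf : f ∈ M (Gamma1 12) m) (hg : g ∈ M (Gamma1 12) m) (hP : HasTrunc n f P)
    (hQ : HasTrunc n g Q) (h : Polynomial.X ^ n ∣ P - Q) : f = g := by
  subst hn
  exact sub_eq_zero.mp (eq_zero_of_isBigO (sub_mem hf hg) ((hP.sub hQ).isBigO h))

theorem u12_mul_dilate_three_theta : u12 * dilate 3 theta = theta ^ 3 := by
  refine eq_of_hasTrunc (n := 7) (by norm_num)
    (mul_mem_M (show 2 + 1 = 3 by norm_num) u12_mem dilate_three_theta_mem)
    (pow_mem_M 3 theta_mem_twelve) (hasTrunc_u12.mul hasTrunc_dilate_three_theta)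
    (hasTrunc_theta.pow 3) ?_
  exact ⟨-12 - 12 * Polynomial.X - 8 * Polynomial.X ^ 5, by ring⟩

theorem v12_mul_theta : v12 * theta = dilate 3 theta ^ 3 := by
  refine eq_of_hasTrunc (n := 7) (by norm_num)
    (mul_mem_M (show 2 + 1 = 3 by norm_num) v12_mem theta_mem_twelve)
    (pow_mem_M 3 dilate_three_theta_mem) (hasTrunc_v12.mul hasTrunc_theta)
    (hasTrunc_dilate_three_theta.pow 3) ?_
  exact ⟨4 + 4 * Polynomial.X - 8 * Polynomial.X ^ 2 + 8 * Polynomial.X ^ 3, by ring⟩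

/-- This permits division by ϑ and ϑ(3z), which are known to be nonzero only near i∞. -/
lemma eq_of_eventuallyEq {m : ℕ} {f g : ℍ → ℂ} (hf : f ∈ M (Gamma1 12) m)
    (hg : g ∈ M (Gamma1 12) m) (h : f =ᶠ[atImInfty] g) : f = g := by
  refine sub_eq_zero.mp (eq_zero_of_isBigO (sub_mem hf hg) ?_)
  refine EventuallyEq.trans_isBigO (f₂ := fun _ => (0 : ℂ)) ?_ (isBigO_zero _ _)
  filter_upwards [h] with z hz
  rw [Pi.sub_apply, hz, sub_self]

lemma eventually_theta_ne_zero : ∀ᶠ z in atImInfty, theta z ≠ 0 ∧ dilate 3 theta z ≠ 0 := by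
  filter_upwards [tendsto_theta.eventually_ne one_ne_zero,
    (tendsto_dilate_theta 3).eventually_ne one_ne_zero] with z h1 h2
  exact ⟨h1, h2⟩

/-- Multiply the other two relations and cancel st near i∞; expansions to order 9 are avoided. -/
theorem u12_mul_v12 : u12 * v12 = theta ^ 2 * dilate 3 theta ^ 2 := by
  refine eq_of_eventuallyEq (m := 4) (mul_mem_M (by norm_num) u12_mem v12_mem)
    (mul_mem_M (by norm_num) (pow_mem_M 2 theta_mem_twelve) (pow_mem_M 2 dilate_three_theta_mem)) ?_
  filter_upwards [eventually_theta_ne_zero] with z hz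
  have h1 := congrFun u12_mul_dilate_three_theta z
  have h2 := congrFun v12_mul_theta z
  simp only [Pi.mul_apply, Pi.pow_apply] at *
  refine mul_right_cancel₀ (mul_ne_zero hz.1 hz.2) ?_
  linear_combination v12 z * theta z * h1 + theta z ^ 3 * h2

end Relations

/-! ### Normal forms of monomials modulo the relations. -/

section NormalForm

variable {A B : Type*} [CommRing A] [CommRing B]

/-- The monomial of weight `2k + r` in normal form whose value is `s^r u^k (t/s)^n`. -/
def normalForm (x : Fin 4 → A) (k r n : ℕ) : A :=
  if n < k then x 0 ^ (2 * n + r) * x 2 ^ (k - n)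
  else if n ≤ 3 * k + r then x 0 ^ (3 * k + r - n) * x 1 ^ (n - k)
  else x 1 ^ (8 * k + 3 * r - 2 * n) * x 3 ^ (n - (3 * k + r))

lemma map_normalForm (φ : A →+* B) (x : Fin 4 → A) (k r n : ℕ) :
    φ (normalForm x k r n) = normalForm (fun i => φ (x i)) k r n := by
  unfold normalForm
  split_ifs <;> simp only [map_mul, map_pow]

/-- Reduction of monomials to normal form. -/
lemma monomial_eq_normalForm {x : Fin 4 → A} (h0 : x 0 ^ 3 = x 1 * x 2) (h1 : x 1 ^ 3 = x 0 * x 3)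
    (h2 : x 0 ^ 2 * x 1 ^ 2 = x 2 * x 3) {k r : ℕ} (hr : r ≤ 1) :
    ∀ N a b c e : ℕ, c + e = N → a + b + 2 * c + 2 * e = 2 * k + r →
      x 0 ^ a * x 1 ^ b * x 2 ^ c * x 3 ^ e = normalForm x k r (k + b + 3 * e - c) := by
  -- The induction is on c + e, which each of tu → s³, sv → t³, uv → s²t² lowers. They preserve n =
  -- k + b + 3e - c, the exponent of t/s once t = sx, u = s²/x, v = s²x³ are substituted. The
  -- subtraction is a true one, since c ≤ k by the weight.
  intro N
  induction N using Nat.strong_induction_on with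
  | _ N ih =>
    intro a b c e hN hw
    by_cases hbc : 0 < b ∧ 0 < c
    · obtain ⟨b, rfl⟩ := Nat.exists_eq_add_one_of_ne_zero hbc.1.ne'
      obtain ⟨c, rfl⟩ := Nat.exists_eq_add_one_of_ne_zero hbc.2.ne'
      have := ih (c + e) (by omega) (a + 3) b c e rfl (by omega)
      rw [show k + (b + 1) + 3 * e - (c + 1) = k + b + 3 * e - c by omega, ← this]
      linear_combination -x 0 ^ a * x 1 ^ b * x 2 ^ c * x 3 ^ e * h0
    by_cases hae : 0 < a ∧ 0 < e
    · obtain ⟨a, rfl⟩ := Nat.exists_eq_add_one_of_ne_zero hae.1.ne'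
      obtain ⟨e, rfl⟩ := Nat.exists_eq_add_one_of_ne_zero hae.2.ne'
      have := ih (c + e) (by omega) a (b + 3) c e rfl (by omega)
      rw [show k + b + 3 * (e + 1) - c = k + (b + 3) + 3 * e - c by omega, ← this]
      linear_combination -x 0 ^ a * x 1 ^ b * x 2 ^ c * x 3 ^ e * h1
    by_cases hce : 0 < c ∧ 0 < e
    · obtain ⟨c, rfl⟩ := Nat.exists_eq_add_one_of_ne_zero hce.1.ne'
      obtain ⟨e, rfl⟩ := Nat.exists_eq_add_one_of_ne_zero hce.2.ne'
      have := ih (c + e) (by omega) (a + 2) (b + 2) c e rfl (by omega)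
      rw [show k + b + 3 * (e + 1) - (c + 1) = k + (b + 2) + 3 * e - c by omega, ← this]
      linear_combination -x 0 ^ a * x 1 ^ b * x 2 ^ c * x 3 ^ e * h2
    unfold normalForm
    rcases Nat.eq_zero_or_pos c with rfl | hc
    · rcases Nat.eq_zero_or_pos e with rfl | he
      · rw [if_neg (by omega), if_pos (by omega), pow_zero, pow_zero, mul_one, mul_one]
        congr 2 <;> omega
      · obtain rfl : a = 0 := by omega
        rw [if_neg (by omega), if_neg (by omega), pow_zero, pow_zero, mul_one, one_mul]
        congr 2 <;> omega
    · obtain rfl : b = 0 := by omega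
      obtain rfl : e = 0 := by omega
      rw [if_pos (by omega), pow_zero, pow_zero, mul_one, mul_one]
      congr 2 <;> omega

lemma normalForm_eq {K : Type*} [Field K] {x : Fin 4 → K} (hs : x 0 ≠ 0) (ht : x 1 ≠ 0)
    (hu : x 2 * x 1 = x 0 ^ 3) (hv : x 3 * x 0 = x 1 ^ 3) {k r n : ℕ} (hn : n ≤ 4 * k + r) :
    normalForm x k r n = x 0 ^ r * x 2 ^ k * (x 1 / x 0) ^ n := by
  have hu' : x 2 * (x 1 / x 0) = x 0 ^ 2 := by
    field_simp
    linear_combination hu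
  have hv' : x 3 = x 1 ^ 2 * (x 1 / x 0) := by
    field_simp
    linear_combination hv
  have ht' : x 1 = x 0 * (x 1 / x 0) := by field_simp
  generalize hy : x 1 / x 0 = y at *
  have huk : ∀ n, x 2 ^ n * y ^ n = x 0 ^ (2 * n) := by
    intro n
    rw [← mul_pow, hu', pow_mul]
  unfold normalForm
  split_ifs with h1 h2
  · obtain ⟨j, rfl⟩ := Nat.exists_eq_add_of_lt h1
    rw [show n + j + 1 - n = j + 1 by omega, pow_add, ← huk]
    ring
  · obtain ⟨i, rfl⟩ := Nat.exists_eq_add_of_le (not_lt.mp h1)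
    obtain ⟨l, hl⟩ := Nat.exists_eq_add_of_le h2
    rw [show 3 * k + r - (k + i) = l by omega, show k + i - k = i by omega, pow_add y,
      show x 0 ^ r * x 2 ^ k * (y ^ k * y ^ i) = x 0 ^ r * (x 2 ^ k * y ^ k) * y ^ i by ring, huk,
      ← pow_add, show r + 2 * k = i + l by omega, ht', mul_pow]
    ring
  · obtain ⟨j, rfl⟩ := Nat.exists_eq_add_of_lt (not_le.mp h2)
    obtain ⟨i, rfl⟩ := Nat.exists_eq_add_of_le (show j + 1 ≤ k by omega)
    rw [show 8 * (j + 1 + i) + 3 * r - 2 * (3 * (j + 1 + i) + r + j + 1) = 2 * i + r by omega,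
      show 3 * (j + 1 + i) + r + j + 1 - (3 * (j + 1 + i) + r) = j + 1 by omega, hv',
      show 3 * (j + 1 + i) + r + j + 1 = (j + 1 + i) + (2 * i + r + 2 * (j + 1) + (j + 1)) by ring,
      pow_add y (j + 1 + i),
      show ∀ w, x 0 ^ r * x 2 ^ (j + 1 + i) * (y ^ (j + 1 + i) * w) =
        x 0 ^ r * (x 2 ^ (j + 1 + i) * y ^ (j + 1 + i)) * w from fun w => by ring, huk, ht']
    ring

end NormalForm

/-! ### Forms attached to polynomials in the Hauptmodul. -/

section Generators

lemma gen_mem (i : Fin 4) : gen i ∈ M (Gamma1 12) (wt i) := by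
  fin_cases i
  · exact theta_mem_twelve
  · exact dilate_three_theta_mem
  · exact u12_mem
  · exact v12_mem

lemma pow_gen_mem (i : Fin 4) (n : ℕ) : gen i ^ n ∈ M (Gamma1 12) (n * wt i) := by
  simpa using SetLike.pow_mem_graded n (gen_mem i)

lemma normalForm_mem {k r n : ℕ} (hn : n ≤ 4 * k + r) :
    normalForm gen k r n ∈ M (Gamma1 12) (2 * k + r) := by
  have w0 : wt 0 = 1 := rfl
  have w1 : wt 1 = 1 := rfl
  have w2 : wt 2 = 2 := rfl
  have w3 : wt 3 = 2 := rfl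
  unfold normalForm
  split_ifs <;> refine mul_mem_M ?_ (pow_gen_mem _ _) (pow_gen_mem _ _)
  · rw [w0, w2]; omega
  · rw [w0, w1]; omega
  · rw [w1, w3]; omega

/-- The Hauptmodul `ϑ(3z) / ϑ(z)`. -/
def hauptmodul (z : ℍ) : ℂ := dilate 3 theta z / theta z

lemma eventually_normalForm {k r n : ℕ} (hn : n ≤ 4 * k + r) :
    ∀ᶠ z in atImInfty, normalForm gen k r n z = theta z ^ r * u12 z ^ k * hauptmodul z ^ n := by
  filter_upwards [eventually_theta_ne_zero] with z hz
  have h := map_normalForm (Pi.evalRingHom (fun _ : ℍ => ℂ) z) gen k r n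
  refine h.trans (normalForm_eq (x := fun i => gen i z) hz.1 hz.2 ?_ ?_ hn)
  · exact congrFun u12_mul_dilate_three_theta z
  · exact congrFun v12_mul_theta z

/-- The form `ϑ^r u^k p(ϑ(3z)/ϑ(z))` attached to a polynomial `p` of degree at most `4k + r`. -/
def formOfPoly (k r : ℕ) : Polynomial ℂ →ₗ[ℂ] (ℍ → ℂ) :=
  ∑ n ∈ Finset.range (4 * k + r + 1), (Polynomial.lcoeff ℂ n).smulRight (normalForm gen k r n)

lemma formOfPoly_apply (k r : ℕ) (p : Polynomial ℂ) : formOfPoly k r p =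
    ∑ n ∈ Finset.range (4 * k + r + 1), p.coeff n • normalForm gen k r n := by
  simp [formOfPoly, LinearMap.sum_apply]

lemma formOfPoly_mem (k r : ℕ) (p : Polynomial ℂ) : formOfPoly k r p ∈ M (Gamma1 12) (2 * k + r) := by
  rw [formOfPoly_apply]
  exact sum_mem fun _ hn => Submodule.smul_mem _ _
    (normalForm_mem (Nat.lt_succ_iff.mp (Finset.mem_range.mp hn)))

lemma eventually_formOfPoly {k r : ℕ} {p : Polynomial ℂ} (hp : p.natDegree ≤ 4 * k + r) :
    formOfPoly k r p =ᶠ[atImInfty]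
      fun z => theta z ^ r * u12 z ^ k * p.eval (hauptmodul z) := by
  have h : ∀ᶠ z in atImInfty, ∀ n ∈ Finset.range (4 * k + r + 1),
      normalForm gen k r n z = theta z ^ r * u12 z ^ k * hauptmodul z ^ n := by
    rw [eventually_all_finset]
    exact fun n hn => eventually_normalForm (Nat.lt_succ_iff.mp (Finset.mem_range.mp hn))
  filter_upwards [h] with z hz
  rw [formOfPoly_apply, Finset.sum_apply, Polynomial.eval_eq_sum_range' (Nat.lt_succ_of_le hp),
    Finset.mul_sum]
  refine Finset.sum_congr rfl fun n hn => ?_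
  rw [Pi.smul_apply, smul_eq_mul, hz n hn]
  ring

end Generators

/-! ### The Hauptmodul near i∞ and uniqueness of the polynomial. -/

section Asymptotics

lemma HasTrunc.tendsto_div {j : ℕ} {f : ℍ → ℂ} {Q : Polynomial ℂ}
    (h : HasTrunc (j + 1) f (Polynomial.X ^ j * Q)) :
    Tendsto (fun z => f z / qp z ^ j) atImInfty (𝓝 (Q.eval 0)) := by
  have h1 := (IsBigO.mul h (isBigO_refl (fun z => (qp z ^ j)⁻¹) atImInfty)).trans_tendsto
    (tendsto_qp.congr fun z => by rw [pow_succ']; field_simp [qp_ne_zero z])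
  have h2 := h1.add (tendsto_eval_qp Q)
  rw [zero_add] at h2
  refine h2.congr fun z => ?_
  have := pow_ne_zero j (qp_ne_zero z)
  rw [Polynomial.eval_mul, Polynomial.eval_pow, Polynomial.eval_X]
  field_simp
  ring

lemma tendsto_u12 : Tendsto u12 atImInfty (𝓝 1) := by
  have h : HasTrunc (0 + 1) u12 (Polynomial.X ^ 0 * (1 + 6 * Polynomial.X + 12 * Polynomial.X ^ 2 +
      6 * Polynomial.X ^ 3 - 6 * Polynomial.X ^ 4 + 12 * Polynomial.X ^ 6)) := by
    rw [pow_zero, one_mul]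
    exact hasTrunc_u12.mono (by norm_num)
  simpa using h.tendsto_div

lemma tendsto_theta_sub_div :
    Tendsto (fun z => (theta z - dilate 3 theta z) / qp z) atImInfty (𝓝 2) := by
  have h := (hasTrunc_theta.sub hasTrunc_dilate_three_theta).mono (show 1 + 1 ≤ 7 by norm_num)
  have h2 : HasTrunc (1 + 1) (theta - dilate 3 theta)
      (Polynomial.X ^ 1 * (2 - 2 * Polynomial.X ^ 2 + 2 * Polynomial.X ^ 3)) := by
    convert h using 1
    ring
  simpa using h2.tendsto_div

lemma tendsto_one_sub_hauptmodul_div :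
    Tendsto (fun z => (1 - hauptmodul z) / qp z) atImInfty (𝓝 2) := by
  have h := tendsto_theta_sub_div.div tendsto_theta one_ne_zero
  rw [div_one] at h
  refine h.congr' ?_
  filter_upwards [eventually_theta_ne_zero] with z hz
  have := hz.1
  simp only [Pi.div_apply, hauptmodul]
  field_simp

lemma tendsto_hauptmodul : Tendsto hauptmodul atImInfty (𝓝[≠] 1) := by
  rw [tendsto_nhdsWithin_iff]
  constructor
  · have h := (tendsto_dilate_theta 3).div tendsto_theta one_ne_zero
    rwa [div_one] at h
  · filter_upwards [tendsto_one_sub_hauptmodul_div.eventually_ne two_ne_zero] with z hz h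
    rw [Set.mem_singleton_iff] at h
    exact hz (by rw [h, sub_self, zero_div])

/-- The Hauptmodul tends to 1 without taking the value 1, while a nonzero polynomial has no zero in
a small punctured neighbourhood of 1. -/
lemma eq_zero_of_eventually_eval {p : Polynomial ℂ}
    (h : ∀ᶠ z in atImInfty, p.eval (hauptmodul z) = 0) : p = 0 := by
  by_contra hp
  have hfin : {x | p.eval x = 0}.Finite := by
    refine (p.roots.toFinset.finite_toSet).subset fun x hx => ?_
    simpa [hp] using hx
  have h1 : ∀ᶠ x in 𝓝[≠] (1 : ℂ), p.eval x ≠ 0 := by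
    have h2 := (hfin.subset Set.sdiff_subset : ({x | p.eval x = 0} \ {1}).Finite).isClosed.isOpen_compl
    have h3 : ({x | p.eval x = 0} \ {1})ᶜ ∈ 𝓝 (1 : ℂ) := h2.mem_nhds (by simp)
    filter_upwards [mem_nhdsWithin_of_mem_nhds h3, self_mem_nhdsWithin] with x hx hx1 h0
    exact hx ⟨h0, hx1⟩
  obtain ⟨z, hz⟩ := ((tendsto_hauptmodul.eventually h1).and h).exists
  exact hz.1 hz.2

lemma eq_of_eventually_eval {p q : Polynomial ℂ}
    (h : ∀ᶠ z in atImInfty, p.eval (hauptmodul z) = q.eval (hauptmodul z)) : p = q := by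
  refine sub_eq_zero.mp (eq_zero_of_eventually_eval (h.mono fun z hz => ?_))
  rw [Polynomial.eval_sub, hz, sub_self]

lemma eventually_u12_ne_zero : ∀ᶠ z in atImInfty, u12 z ≠ 0 := tendsto_u12.eventually_ne one_ne_zero

lemma eq_zero_of_formOfPoly_eq_zero {k r : ℕ} {p : Polynomial ℂ} (hp : p.natDegree ≤ 4 * k + r)
    (h : formOfPoly k r p = 0) : p = 0 := by
  refine eq_zero_of_eventually_eval ?_
  filter_upwards [eventually_formOfPoly hp, eventually_theta_ne_zero, eventually_u12_ne_zero]
    with z h1 h2 h3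
  rw [h, Pi.zero_apply, eq_comm] at h1
  simpa [h2.1, h3] using h1

end Asymptotics

/-! ### Integral weight: all forms come from polynomials. -/

section EvenWeight

lemma exists_leading_coeff {k j : ℕ} {f : ℍ → ℂ} (hf : f ∈ M (Gamma1 12) (2 * k))
    (h : f =O[atImInfty] fun z => qp z ^ j) :
    ∃ c : ℂ, (fun z => f z - c * qp z ^ j) =O[atImInfty] fun z => qp z ^ (j + 1) := by
  obtain ⟨g, rfl⟩ := (mem_M_even 12 k f).mp hf
  have hs : ∀ z, HasSum (fun m => (qExpansion 1 g).coeff m * qp z ^ m) (g z) := fun z => by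
    simpa [qp] using ModularForm.hasSum_qExpansion (h := 1) g one_pos (by simp) z
  refine ⟨(qExpansion 1 g).coeff j, (isBigO_sub_sum_of_hasSum hs (j + 1)).congr_left fun z => ?_⟩
  rw [Finset.sum_range_succ, Finset.sum_eq_zero, zero_add]
  intro i hi
  rw [coeff_eq_zero_of_isBigO hs h i (Finset.mem_range.mp hi), zero_mul]

lemma natDegree_one_sub_X_pow_le (j : ℕ) :
    ((1 - Polynomial.X : Polynomial ℂ) ^ j).natDegree ≤ j := by
  refine Polynomial.natDegree_pow_le.trans ?_
  have : (1 - Polynomial.X : Polynomial ℂ).natDegree ≤ 1 :=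
    (Polynomial.natDegree_sub_le _ _).trans (by simp)
  nlinarith

lemma tendsto_formOfPoly_div {k j : ℕ} (hj : j ≤ 4 * k) :
    Tendsto (fun z => formOfPoly k 0 ((1 - Polynomial.X) ^ j) z / qp z ^ j) atImInfty
      (𝓝 (2 ^ j)) := by
  have h := (tendsto_u12.pow k).mul (tendsto_one_sub_hauptmodul_div.pow j)
  rw [one_pow, one_mul] at h
  refine h.congr' ?_
  have hd : ((1 - Polynomial.X : Polynomial ℂ) ^ j).natDegree ≤ 4 * k + 0 :=
    (natDegree_one_sub_X_pow_le j).trans hj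
  filter_upwards [eventually_formOfPoly hd] with z hz
  rw [hz, div_pow]
  simp
  ring

/-- Elimination of q-coefficients: u^k (1 - x)^j has order exactly j, with leading coefficient 2^j,
so it removes the coefficient of q^j. At order 4k + 1 the valence bound takes over. -/
lemma exists_approx {k : ℕ} {f : ℍ → ℂ} (hf : f ∈ M (Gamma1 12) (2 * k)) :
    ∀ j ≤ 4 * k + 1, ∃ p : Polynomial ℂ, p.natDegree ≤ 4 * k ∧
      (f - formOfPoly k 0 p) =O[atImInfty] fun z => qp z ^ j := by
  intro j
  induction j with
  | zero =>
    refine fun _ => ⟨0, by simp, ?_⟩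
    have h := IsBoundedAtImInfty.isBigO_one (hf.2.2 1)
    simpa [sqrtDenom] using h
  | succ j ih =>
    intro hj
    obtain ⟨p, hp, h⟩ := ih (by omega)
    have hH := formOfPoly_mem k 0 ((1 - Polynomial.X) ^ j)
    have ht := tendsto_formOfPoly_div (show j ≤ 4 * k by omega)
    have hd := natDegree_one_sub_X_pow_le j
    generalize hHdef : formOfPoly k 0 ((1 - Polynomial.X) ^ j) = H at hH ht
    have hHO : H =O[atImInfty] fun z => qp z ^ j := by
      have := (ht.isBigO_one ℂ).mul (isBigO_refl (fun z => qp z ^ j) atImInfty)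
      refine (this.congr_left fun z => ?_).congr_right fun z => one_mul _
      exact div_mul_cancel₀ _ (pow_ne_zero j (qp_ne_zero z))
    obtain ⟨c, hc⟩ := exists_leading_coeff (sub_mem hf (formOfPoly_mem k 0 p)) h
    obtain ⟨d, hd'⟩ := exists_leading_coeff hH hHO
    have hd0 : d ≠ 0 := by
      rintro rfl
      simp only [zero_mul, sub_zero] at hd'
      have h1 := (IsBigO.mul hd' (isBigO_refl (fun z => (qp z ^ j)⁻¹) atImInfty)).trans_tendsto
        (tendsto_qp.congr fun z => by rw [pow_succ']; field_simp [qp_ne_zero z])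
      exact pow_ne_zero j two_ne_zero (tendsto_nhds_unique ht h1)
    refine ⟨p + Polynomial.C (c / d) * (1 - Polynomial.X) ^ j, ?_, ?_⟩
    · refine (Polynomial.natDegree_add_le _ _).trans (max_le hp ?_)
      exact (Polynomial.natDegree_C_mul_le _ _).trans (hd.trans (by omega))
    · refine (hc.sub (hd'.const_mul_left (c / d))).congr_left fun z => ?_
      rw [map_add, ← Polynomial.smul_eq_C_mul, map_smul, hHdef]
      simp only [Pi.sub_apply, Pi.add_apply, Pi.smul_apply, smul_eq_mul]
      field_simp
      ring

theorem exists_formOfPoly_even {k : ℕ} {f : ℍ → ℂ} (hf : f ∈ M (Gamma1 12) (2 * k)) :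
    ∃ p : Polynomial ℂ, p.natDegree ≤ 4 * k ∧ f = formOfPoly k 0 p := by
  obtain ⟨p, hp, h⟩ := exists_approx hf (4 * k + 1) le_rfl
  refine ⟨p, hp, sub_eq_zero.mp (eq_zero_of_isBigO (sub_mem hf (formOfPoly_mem k 0 p)) ?_)⟩
  rwa [show 2 * (2 * k) + 1 = 4 * k + 1 by ring]

end EvenWeight

/-! ### Half-integral weight: reduction to integral weight, and the decomposition. -/

section OddWeight

lemma eventually_u12_mul_hauptmodul :
    ∀ᶠ z in atImInfty, u12 z * hauptmodul z = theta z ^ 2 := by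
  filter_upwards [eventually_theta_ne_zero] with z hz
  have h := congrFun u12_mul_dilate_three_theta z
  simp only [Pi.mul_apply, Pi.pow_apply] at h
  have := hz.1
  rw [hauptmodul]
  field_simp
  exact h

theorem exists_formOfPoly_odd {k : ℕ} {f : ℍ → ℂ} (hf : f ∈ M (Gamma1 12) (2 * k + 1)) :
    ∃ p : Polynomial ℂ, p.natDegree ≤ 4 * k + 1 ∧ f = formOfPoly k 1 p := by
  obtain ⟨p, hp, h1⟩ := exists_formOfPoly_even (k := k + 1)
    (mul_mem_M (by ring) hf theta_mem_twelve)
  obtain ⟨r, hr, h2⟩ := exists_formOfPoly_even (k := 2 * k + 1) (mul_mem_M (by ring) hf hf)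
  have e1 := eventually_formOfPoly (k := k + 1) (r := 0) hp
  have e2 := eventually_formOfPoly (k := 2 * k + 1) (r := 0) hr
  rw [← h1] at e1
  rw [← h2] at e2
  -- Compare (fs)² = f² s² and use s² = ux.
  have hpr : p ^ 2 = Polynomial.X * r := by
    refine eq_of_eventually_eval ?_
    filter_upwards [e1, e2, eventually_u12_mul_hauptmodul, eventually_u12_ne_zero] with z h1 h2 h3 h4
    simp only [Pi.mul_apply, pow_zero, one_mul] at h1 h2
    rw [Polynomial.eval_pow, Polynomial.eval_mul, Polynomial.eval_X]
    refine mul_left_cancel₀ (pow_ne_zero (2 * k + 2) h4) ?_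
    have h5 : (u12 z ^ (k + 1) * p.eval (hauptmodul z)) ^ 2 =
        theta z ^ 2 * (u12 z ^ (2 * k + 1) * r.eval (hauptmodul z)) := by
      rw [← h1, ← h2]
      ring
    rw [← h3] at h5
    linear_combination h5
  obtain ⟨p1, rfl⟩ : Polynomial.X ∣ p :=
    Polynomial.prime_X.dvd_of_dvd_pow (hpr ▸ dvd_mul_right _ _)
  have hr' : r = Polynomial.X * p1 ^ 2 := by
    refine mul_left_cancel₀ Polynomial.X_ne_zero ?_
    rw [← hpr]
    ring
  -- The bound comes from r, not p: 1 + 2 deg p1 ≤ 8k + 4.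
  have hdeg : p1.natDegree ≤ 4 * k + 1 := by
    by_cases h0 : p1 = 0
    · simp [h0]
    · rw [hr', Polynomial.natDegree_X_mul (pow_ne_zero 2 h0), Polynomial.natDegree_pow] at hr
      omega
  refine ⟨p1, hdeg, eq_of_eventuallyEq hf (formOfPoly_mem k 1 p1) ?_⟩
  filter_upwards [e1, eventually_formOfPoly hdeg, eventually_u12_mul_hauptmodul, eventually_theta_ne_zero]
    with z h1 h2 h3 h4
  rw [h2]
  refine mul_right_cancel₀ h4.1 ?_
  simp only [Pi.mul_apply, pow_zero, one_mul, Polynomial.eval_mul, Polynomial.eval_X] at h1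
  rw [h1]
  linear_combination u12 z ^ k * p1.eval (hauptmodul z) * h3

lemma thetaSub_mem : thetaSub ∈ M (Gamma1 12) 1 :=
  Submodule.smul_mem _ _ (sub_mem theta_mem_twelve dilate_three_theta_mem)

lemma eventually_thetaSub :
    ∀ᶠ z in atImInfty, thetaSub z = theta z * (1 - hauptmodul z) / 2 := by
  filter_upwards [eventually_theta_ne_zero] with z hz
  have := hz.1
  simp only [thetaSub, hauptmodul, Pi.smul_apply, Pi.sub_apply, smul_eq_mul]
  field_simp

theorem M_odd_eq_sup (k : ℕ) : M (Gamma1 12) (2 * k + 1) =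
    Submodule.span ℂ {theta ^ (2 * k + 1)} ⊔
      (M (Gamma1 12) (2 * k)).map (LinearMap.mulRight ℂ thetaSub) := by
  refine le_antisymm (fun f hf => ?_) (sup_le ?_ ?_)
  · obtain ⟨p, hp, hfp⟩ := exists_formOfPoly_odd hf
    -- X^k represents ϑ^(2k+1) and 1 - X represents 2ϑ_⟨3⟩/ϑ, so the value at 1 is the coefficient
    -- of ϑ^(2k+1).
    have hroot : (1 - Polynomial.X : Polynomial ℂ) ∣
        p - Polynomial.C (p.eval 1) * Polynomial.X ^ k := by
      rw [← neg_sub, neg_dvd, ← Polynomial.C_1, Polynomial.dvd_iff_isRoot]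
      simp
    obtain ⟨p2, hp2⟩ := hroot
    have hdeg : p2.natDegree ≤ 4 * k := by
      by_cases h0 : p2 = 0
      · simp [h0]
      · have h1 : (1 - Polynomial.X : Polynomial ℂ).natDegree = 1 := by
          rw [← neg_sub, Polynomial.natDegree_neg, ← Polynomial.C_1, Polynomial.natDegree_X_sub_C]
        have hne : (1 - Polynomial.X : Polynomial ℂ) ≠ 0 := by
          intro h
          rw [h] at h1
          simp at h1
        have h2 := congrArg Polynomial.natDegree hp2
        rw [Polynomial.natDegree_mul hne h0, h1] at h2
        have h3 : (p - Polynomial.C (p.eval 1) * Polynomial.X ^ k).natDegree ≤ 4 * k + 1 :=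
          (Polynomial.natDegree_sub_le _ _).trans (max_le hp
            ((Polynomial.natDegree_C_mul_X_pow_le _ _).trans (by omega)))
        omega
    have hg : formOfPoly k 0 ((2 : ℂ) • p2) ∈ M (Gamma1 12) (2 * k) := formOfPoly_mem k 0 _
    have key : f = p.eval 1 • theta ^ (2 * k + 1) + formOfPoly k 0 ((2 : ℂ) • p2) * thetaSub := by
      refine eq_of_eventuallyEq hf (add_mem (Submodule.smul_mem _ _ (pow_mem_M _ theta_mem_twelve))
        (mul_mem_M rfl hg thetaSub_mem)) ?_
      have hdeg' : ((2 : ℂ) • p2).natDegree ≤ 4 * k + 0 :=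
        (Polynomial.natDegree_smul_le _ _).trans hdeg
      filter_upwards [eventually_formOfPoly hp, eventually_formOfPoly hdeg', eventually_thetaSub,
        eventually_u12_mul_hauptmodul] with z h1 h2 h3 h5
      have h6 := congrArg (Polynomial.eval (hauptmodul z)) hp2
      have h7 : theta z ^ (2 * k + 1) = theta z * (u12 z ^ k * hauptmodul z ^ k) := by
        rw [← mul_pow, h5, ← pow_mul, pow_succ']
      simp only [Polynomial.eval_sub, Polynomial.eval_mul, Polynomial.eval_C, Polynomial.eval_pow,
        Polynomial.eval_X, Polynomial.eval_one] at h6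
      rw [hfp, h1, Pi.add_apply, Pi.mul_apply, Pi.smul_apply, Pi.pow_apply, h7, h2, h3,
        Polynomial.eval_smul, smul_eq_mul, smul_eq_mul]
      linear_combination theta z * u12 z ^ k * h6
    rw [key]
    exact Submodule.add_mem_sup (Submodule.smul_mem _ _ (Submodule.mem_span_singleton_self _))
      ⟨_, hg, rfl⟩
  · rw [Submodule.span_singleton_le_iff_mem]
    exact pow_mem_M _ theta_mem_twelve
  · rintro _ ⟨g, hg, rfl⟩
    exact mul_mem_M rfl hg thetaSub_mem

/-- At i∞ every multiple of ϑ_⟨3⟩ by a form tends to 0, whereas ϑ^(2k+1) tends to 1. -/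
theorem disjoint_span_map (k : ℕ) : Disjoint (Submodule.span ℂ {theta ^ (2 * k + 1)})
    ((M (Gamma1 12) (2 * k)).map (LinearMap.mulRight ℂ thetaSub)) := by
  rw [Submodule.disjoint_def]
  intro f hf hf'
  obtain ⟨c, rfl⟩ := Submodule.mem_span_singleton.mp hf
  obtain ⟨g, hg, h⟩ := hf'
  have h1 : Tendsto thetaSub atImInfty (𝓝 0) := by
    have := (tendsto_theta.sub (tendsto_dilate_theta 3)).const_mul (1 / 2 : ℂ)
    rw [sub_self, mul_zero] at this
    exact this
  have hb : g =O[atImInfty] fun _ => (1 : ℂ) := by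
    simpa [sqrtDenom] using IsBoundedAtImInfty.isBigO_one (hg.2.2 1)
  have h2 : Tendsto (g * thetaSub) atImInfty (𝓝 0) := by
    have := hb.mul (isBigO_refl thetaSub atImInfty)
    simp only [one_mul] at this
    exact this.trans_tendsto h1
  have h3 : Tendsto (c • theta ^ (2 * k + 1)) atImInfty (𝓝 c) := by
    have := (tendsto_theta.pow (2 * k + 1)).const_mul c
    rwa [one_pow, mul_one] at this
  have h4 : g * thetaSub = c • theta ^ (2 * k + 1) := h
  rw [h4] at h2
  rw [tendsto_nhds_unique h3 h2, zero_smul]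

end OddWeight

/-! ### Independence of distinct weights. -/

section Independence

lemma J_U_injective (z : ℍ) : Function.Injective fun n : ℕ => J (U (12 * n)) z := by
  intro a b h
  have h1 := congrArg (· ^ 2) h
  simp only [J_sq, U_apply_one_zero, U_apply_one_one, add_left_inj] at h1
  have h2 := mul_right_cancel₀ (ne_zero z) h1
  norm_cast at h2
  omega

/-- At fixed z, a relation evaluated at γz says that the polynomial with coefficients f_m(z)
vanishes at J(γ, z), and the matrices U(12n) give infinitely many such roots. -/
theorem iSupIndep_M : iSupIndep (M (Gamma1 12)) := by
  rw [iSupIndep_iff_finsetSum_eq_zero_imp_eq_zero]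
  intro S f hf hsum i hi
  funext z
  let P : Polynomial ℂ := ∑ m ∈ S, Polynomial.monomial m (f m z)
  have hP : P = 0 := by
    refine Polynomial.eq_zero_of_infinite_isRoot P
      ((Set.infinite_range_of_injective (J_U_injective z)).mono ?_)
    rintro _ ⟨n, rfl⟩
    have hU : U (12 * n) ∈ Gamma1 12 := by
      rw [mem_Gamma1_iff]
      simp
    change P.eval (J (U (12 * n)) z) = 0
    have h := congrFun hsum (U (12 * n) • z)
    rw [Finset.sum_apply, Pi.zero_apply] at h
    rw [Polynomial.eval_finsetSum, ← h]
    refine Finset.sum_congr rfl fun m hm => ?_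
    rw [Polynomial.eval_monomial, ← (hf m hm).2.1 _ hU z, mul_comm,
      mul_inv_cancel_left₀ (pow_ne_zero _ (J_ne_zero _ z))]
  have h := congrArg (fun p => Polynomial.coeff p i) hP
  simp only [P, Polynomial.finsetSum_coeff, Polynomial.coeff_monomial, Polynomial.coeff_zero] at h
  rwa [Finset.sum_ite_eq' S i, if_pos hi] at h

end Independence

/-! ### The presentation of the graded ring. -/

section Presentation

lemma weight_wt (d : Fin 4 →₀ ℕ) : Finsupp.weight wt d = d 0 + d 1 + 2 * d 2 + 2 * d 3 := by
  rw [Finsupp.weight_apply, Finsupp.sum_fintype _ _ (by simp), Fin.sum_univ_four]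
  simp [wt]
  ring

lemma algHom_monomial {A : Type*} [CommRing A] [Algebra ℂ A] (φ : MvPolynomial (Fin 4) ℂ →ₐ[ℂ] A)
    (d : Fin 4 →₀ ℕ) (c : ℂ) : φ (monomial d c) =
      c • (φ (X 0) ^ d 0 * φ (X 1) ^ d 1 * φ (X 2) ^ d 2 * φ (X 3) ^ d 3) := by
  rw [monomial_eq, Finsupp.prod_fintype _ _ (by simp), Fin.prod_univ_four, C_mul',
    map_smul]
  simp only [map_mul, map_pow]

lemma aeval_gen_mem {m : ℕ} {P : MvPolynomial (Fin 4) ℂ} (hP : IsWeightedHomogeneous wt P m) :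
    aeval gen P ∈ M (Gamma1 12) m := by
  induction hP using IsWeightedHomogeneous.induction_on with
  | zero => rw [map_zero]; exact zero_mem _
  | add p q _ _ hp hq => rw [map_add]; exact add_mem hp hq
  | monomial d c hd =>
    rw [algHom_monomial]
    simp only [aeval_X]
    refine Submodule.smul_mem _ _ (mul_mem_M ?_ (mul_mem_M rfl (mul_mem_M rfl (pow_gen_mem 0 _)
      (pow_gen_mem 1 _)) (pow_gen_mem 2 _)) (pow_gen_mem 3 _))
    rw [← hd, weight_wt]
    simp [wt]
    ring

lemma isWeightedHomogeneous_normalForm {k r n : ℕ} (hn : n ≤ 4 * k + r) :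
    IsWeightedHomogeneous wt (normalForm (X : Fin 4 → MvPolynomial (Fin 4) ℂ) k r n)
      (2 * k + r) := by
  have h (i : Fin 4) (a : ℕ) :
      IsWeightedHomogeneous wt ((X i : MvPolynomial (Fin 4) ℂ) ^ a) (a * wt i) := by
    simpa using (isWeightedHomogeneous_X ℂ wt i).pow a
  have hmul {i j : Fin 4} {a b : ℕ} (hab : a * wt i + b * wt j = 2 * k + r) :
      IsWeightedHomogeneous wt ((X i : MvPolynomial (Fin 4) ℂ) ^ a * X j ^ b) (2 * k + r) :=
    hab ▸ (h i a).mul (h j b)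
  have w0 : wt 0 = 1 := rfl
  have w1 : wt 1 = 1 := rfl
  have w2 : wt 2 = 2 := rfl
  have w3 : wt 3 = 2 := rfl
  unfold normalForm
  split_ifs <;> refine hmul ?_
  · rw [w0, w2]; omega
  · rw [w0, w1]; omega
  · rw [w1, w3]; omega

/-- The combination of normal form monomials with coefficients those of `p`. -/
def normalCombination {A : Type*} [CommRing A] [Algebra ℂ A] (x : Fin 4 → A) (k r : ℕ)
    (p : Polynomial ℂ) : A :=
  ∑ n ∈ Finset.range (4 * k + r + 1), p.coeff n • normalForm x k r n

lemma map_normalCombination {A B : Type*} [CommRing A] [Algebra ℂ A] [CommRing B] [Algebra ℂ B]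
    (φ : A →ₐ[ℂ] B) (x : Fin 4 → A) (k r : ℕ) (p : Polynomial ℂ) :
    φ (normalCombination x k r p) = normalCombination (fun i => φ (x i)) k r p := by
  rw [normalCombination, normalCombination, map_sum]
  refine Finset.sum_congr rfl fun n _ => ?_
  rw [map_smul]
  congr 1
  exact map_normalForm φ.toRingHom x k r n

lemma isWeightedHomogeneous_normalCombination (k r : ℕ) (p : Polynomial ℂ) :
    IsWeightedHomogeneous wt (normalCombination (X : Fin 4 → MvPolynomial (Fin 4) ℂ) k r p)
      (2 * k + r) := by
  rw [← mem_weightedHomogeneousSubmodule]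
  exact sum_mem fun n hn => Submodule.smul_mem _ _
    (isWeightedHomogeneous_normalForm (Nat.lt_succ_iff.mp (Finset.mem_range.mp hn)))

lemma exists_two_mul_add (m : ℕ) : ∃ k r, r ≤ 1 ∧ m = 2 * k + r :=
  ⟨m / 2, m % 2, by omega, by omega⟩

theorem exists_formOfPoly {k r : ℕ} (hr : r ≤ 1) {f : ℍ → ℂ}
    (hf : f ∈ M (Gamma1 12) (2 * k + r)) :
    ∃ p : Polynomial ℂ, p.natDegree ≤ 4 * k + r ∧ f = formOfPoly k r p := by
  interval_cases r
  · exact exists_formOfPoly_even hf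
  · exact exists_formOfPoly_odd hf

lemma exists_aeval_gen_eq {m : ℕ} {f : ℍ → ℂ} (hf : f ∈ M (Gamma1 12) m) :
    ∃ P : MvPolynomial (Fin 4) ℂ, IsWeightedHomogeneous wt P m ∧ aeval gen P = f := by
  obtain ⟨k, r, hr, rfl⟩ := exists_two_mul_add m
  obtain ⟨p, -, rfl⟩ := exists_formOfPoly hr hf
  refine ⟨_, isWeightedHomogeneous_normalCombination k r p, ?_⟩
  rw [map_normalCombination, formOfPoly_apply]
  simp only [aeval_X]
  rfl

/-- The quotient map onto the ring presented by the three relations. -/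
abbrev quotMap : MvPolynomial (Fin 4) ℂ →ₐ[ℂ] MvPolynomial (Fin 4) ℂ ⧸ relIdeal :=
  Ideal.Quotient.mkₐ ℂ relIdeal

lemma quotMap_eq {P Q : MvPolynomial (Fin 4) ℂ} (h : P - Q ∈ relIdeal) : quotMap P = quotMap Q :=
  (Ideal.Quotient.mk_eq_mk_iff_sub_mem P Q).mpr h

lemma quotMap_monomial {k r : ℕ} (hr : r ≤ 1) (a b c e : ℕ)
    (h : a + b + 2 * c + 2 * e = 2 * k + r) :
    quotMap (X 0) ^ a * quotMap (X 1) ^ b * quotMap (X 2) ^ c * quotMap (X 3) ^ e =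
      normalForm (fun i => quotMap (X i)) k r (k + b + 3 * e - c) := by
  refine monomial_eq_normalForm (x := fun i => quotMap (X i)) ?_ ?_ ?_ hr _ a b c e rfl h
  all_goals
    simp only [← map_mul, ← map_pow]
    refine quotMap_eq (Ideal.subset_span ?_)
    simp

lemma exists_quotMap_eq {k r : ℕ} (hr : r ≤ 1) {P : MvPolynomial (Fin 4) ℂ}
    (hP : IsWeightedHomogeneous wt P (2 * k + r)) :
    ∃ p : Polynomial ℂ, p.natDegree ≤ 4 * k + r ∧
      quotMap P = normalCombination (fun i => quotMap (X i)) k r p := by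
  induction hP using IsWeightedHomogeneous.induction_on with
  | zero => exact ⟨0, by simp, by simp [normalCombination]⟩
  | add P Q _ _ hp hq =>
    obtain ⟨p, hp, hp'⟩ := hp
    obtain ⟨q, hq, hq'⟩ := hq
    refine ⟨p + q, (Polynomial.natDegree_add_le _ _).trans (max_le hp hq), ?_⟩
    rw [map_add, hp', hq', normalCombination, normalCombination, normalCombination,
      ← Finset.sum_add_distrib]
    refine Finset.sum_congr rfl fun n _ => ?_
    rw [Polynomial.coeff_add, add_smul]
  | monomial d c hd =>
    rw [weight_wt] at hd
    have hn : k + d 1 + 3 * d 3 - d 2 ≤ 4 * k + r := by omega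
    refine ⟨Polynomial.monomial (k + d 1 + 3 * d 3 - d 2) c,
      (Polynomial.natDegree_monomial_le c).trans hn, ?_⟩
    rw [algHom_monomial, quotMap_monomial hr _ _ _ _ hd, normalCombination,
      Finset.sum_eq_single (k + d 1 + 3 * d 3 - d 2), Polynomial.coeff_monomial_same]
    · intro n _ hne
      rw [Polynomial.coeff_monomial_of_ne c hne, zero_smul]
    · intro h
      exact absurd (Finset.mem_range.mpr (Nat.lt_succ_of_le hn)) h

lemma aeval_gen_eq_zero_of_mem {P : MvPolynomial (Fin 4) ℂ} (hP : P ∈ relIdeal) :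
    aeval gen P = 0 := by
  have h : relIdeal ≤ RingHom.ker (aeval gen : MvPolynomial (Fin 4) ℂ →ₐ[ℂ] (ℍ → ℂ)) := by
    rw [relIdeal, Ideal.span_le]
    have h0 : gen 0 = theta := rfl
    have h1 : gen 1 = dilate 3 theta := rfl
    have h2 : gen 2 = u12 := rfl
    have h3 : gen 3 = v12 := rfl
    rintro _ (rfl | rfl | rfl) <;>
      simp only [SetLike.mem_coe, RingHom.mem_ker, map_sub, map_mul, map_pow, aeval_X, sub_eq_zero,
        h0, h1, h2, h3]
    · rw [← u12_mul_dilate_three_theta, mul_comm]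
    · rw [← v12_mul_theta, mul_comm]
    · rw [u12_mul_v12]
  exact h hP

/-- Modulo the relations P is a normal combination with coefficients from p, and its value is
`formOfPoly k r p`; uniqueness of p makes the class of P zero. -/
lemma mem_relIdeal_of_isWeightedHomogeneous {m : ℕ} {P : MvPolynomial (Fin 4) ℂ}
    (hP : IsWeightedHomogeneous wt P m) (h : aeval gen P = 0) : P ∈ relIdeal := by
  obtain ⟨k, r, hr, rfl⟩ := exists_two_mul_add m
  obtain ⟨p, hp, hq⟩ := exists_quotMap_eq hr hP
  let L : MvPolynomial (Fin 4) ℂ ⧸ relIdeal →ₐ[ℂ] (ℍ → ℂ) :=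
    Ideal.Quotient.liftₐ relIdeal (aeval gen) fun _ => aeval_gen_eq_zero_of_mem
  have hL : ∀ Q, L (quotMap Q) = aeval gen Q := fun Q => rfl
  have h1 := congrArg L hq
  rw [hL, h, map_normalCombination] at h1
  simp only [hL, aeval_X] at h1
  have h2 : p = 0 := eq_zero_of_formOfPoly_eq_zero hp (by rw [formOfPoly_apply]; exact h1.symm)
  rw [h2] at hq
  have h3 : quotMap P = 0 := by
    rw [hq]
    simp [normalCombination]
  exact Ideal.Quotient.eq_zero_iff_mem.mp h3

lemma mem_relIdeal_iff {P : MvPolynomial (Fin 4) ℂ} : P ∈ relIdeal ↔ aeval gen P = 0 := by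
  refine ⟨aeval_gen_eq_zero_of_mem, fun h => ?_⟩
  have hfin := weightedHomogeneousComponent_finsupp (w := wt) P
  have hsum := sum_weightedHomogeneousComponent wt P
  rw [finsum_eq_sum _ hfin] at hsum
  rw [← hsum]
  refine sum_mem fun m hm => mem_relIdeal_of_isWeightedHomogeneous
    (weightedHomogeneousComponent_isWeightedHomogeneous m P) ?_
  refine (iSupIndep_iff_finsetSum_eq_zero_imp_eq_zero _).mp iSupIndep_M _
    (fun m => aeval gen (weightedHomogeneousComponent wt m P)) (fun m _ => aeval_gen_mem
      (weightedHomogeneousComponent_isWeightedHomogeneous m P)) ?_ m hm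
  rw [← map_sum, hsum, h]

/-- The map from the ring of forms to functions on the upper half plane. -/
abbrev evalForm : FormRing (Gamma1 12) →ₐ[ℂ] (ℍ → ℂ) := DirectSum.coeAlgHom (M (Gamma1 12))

/-- Directness of the sum allows identities in the abstract graded ring to be checked on functions.
-/
lemma evalForm_injective : Function.Injective evalForm := iSupIndep_M.dfinsupp_lsum_injective

/-- The evaluation of polynomials at the generators. -/
def presentation : MvPolynomial (Fin 4) ℂ →ₐ[ℂ] FormRing (Gamma1 12) :=
  aeval fun i => DirectSum.of (fun m => M (Gamma1 12) m) (wt i) ⟨gen i, gen_mem i⟩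

lemma evalForm_presentation (P : MvPolynomial (Fin 4) ℂ) :
    evalForm (presentation P) = aeval gen P := by
  have h : evalForm.comp presentation = aeval gen := by
    ext i : 1
    simp [presentation]
  exact DFunLike.congr_fun h P

lemma presentation_eq_of {m : ℕ} {P : MvPolynomial (Fin 4) ℂ} {f : M (Gamma1 12) m}
    (h : aeval gen P = f) : presentation P = DirectSum.of (fun m => M (Gamma1 12) m) m f := by
  refine evalForm_injective ?_
  rw [evalForm_presentation, h, DirectSum.coeAlgHom_of]

lemma presentation_eq_zero_iff {P : MvPolynomial (Fin 4) ℂ} :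
    presentation P = 0 ↔ P ∈ relIdeal := by
  rw [mem_relIdeal_iff, ← evalForm_presentation]
  exact (map_eq_zero_iff evalForm evalForm_injective).symm

lemma presentation_surjective : Function.Surjective presentation := by
  intro x
  induction x using DirectSum.induction_on with
  | zero => exact ⟨0, map_zero _⟩
  | of m f =>
    obtain ⟨P, -, hP⟩ := exists_aeval_gen_eq f.2
    exact ⟨P, presentation_eq_of hP⟩
  | add x y hx hy =>
    obtain ⟨P, rfl⟩ := hx
    obtain ⟨Q, rfl⟩ := hy
    exact ⟨P + Q, map_add _ _ _⟩

/-- The presentation of the ring of forms of integral and half-integral weight on `Γ₁(12)`. -/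
def presentationEquiv :
    (MvPolynomial (Fin 4) ℂ ⧸ relIdeal) ≃ₐ[ℂ] FormRing (Gamma1 12) :=
  AlgEquiv.ofBijective
    (Ideal.Quotient.liftₐ relIdeal presentation fun _ h => presentation_eq_zero_iff.mpr h)
    ⟨by
      rw [injective_iff_map_eq_zero]
      intro x hx
      obtain ⟨P, rfl⟩ := Ideal.Quotient.mk_surjective x
      exact Ideal.Quotient.eq_zero_iff_mem.mpr (presentation_eq_zero_iff.mp hx),
    fun y => by
      obtain ⟨P, rfl⟩ := presentation_surjective y
      exact ⟨Ideal.Quotient.mk _ P, rfl⟩⟩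

lemma presentationEquiv_mk (P : MvPolynomial (Fin 4) ℂ) :
    presentationEquiv (Ideal.Quotient.mk relIdeal P) = presentation P := rfl

end Presentation

end HalfIntegral

end

/-! ### Assembly of the three statements. -/

theorem mainTheorem4 :
    -- the sum of the spaces of modular forms of distinct weights, inside functions, is direct
    iSupIndep (HalfIntegral.M (Gamma1 12)) ∧
    -- `M_{k+1/2} = ℂ ϑ^{2k+1} ⊕ M_k ϑ_⟨3⟩`
    (∀ k : ℕ,
      HalfIntegral.M (Gamma1 12) (2 * k + 1) =
          Submodule.span ℂ {HalfIntegral.theta ^ (2 * k + 1)} ⊔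
            (HalfIntegral.M (Gamma1 12) (2 * k)).map
              (LinearMap.mulRight ℂ HalfIntegral.thetaSub) ∧
        Disjoint (Submodule.span ℂ {HalfIntegral.theta ^ (2 * k + 1)})
          ((HalfIntegral.M (Gamma1 12) (2 * k)).map
            (LinearMap.mulRight ℂ HalfIntegral.thetaSub))) ∧
    -- the presentation, as graded rings
    ∃ hgen : ∀ i, HalfIntegral.gen i ∈ HalfIntegral.M (Gamma1 12) (HalfIntegral.wt i),
      ∃ Φ : (MvPolynomial (Fin 4) ℂ ⧸ HalfIntegral.relIdeal) ≃ₐ[ℂ]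
          HalfIntegral.FormRing (Gamma1 12),
        (∀ i, Φ (Ideal.Quotient.mk HalfIntegral.relIdeal (X i)) =
          DirectSum.of (fun m => HalfIntegral.M (Gamma1 12) m) (HalfIntegral.wt i)
            ⟨HalfIntegral.gen i, hgen i⟩) ∧
        ∀ m : ℕ,
          (weightedHomogeneousSubmodule ℂ HalfIntegral.wt m).map
              (Φ.toLinearMap ∘ₗ
                (Ideal.Quotient.mkₐ ℂ HalfIntegral.relIdeal).toLinearMap) =
            LinearMap.range
              (DirectSum.lof ℂ ℕ (fun m => HalfIntegral.M (Gamma1 12) m) m) := by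
  refine ⟨HalfIntegral.iSupIndep_M,
    fun k => ⟨HalfIntegral.M_odd_eq_sup k, HalfIntegral.disjoint_span_map k⟩,
    HalfIntegral.gen_mem, HalfIntegral.presentationEquiv, fun i => ?_, fun m => ?_⟩
  · rw [HalfIntegral.presentationEquiv_mk, HalfIntegral.presentation, aeval_X]
  · refine le_antisymm ?_ ?_
    · rintro _ ⟨P, hP, rfl⟩
      exact ⟨⟨aeval HalfIntegral.gen P, HalfIntegral.aeval_gen_mem hP⟩,
        (HalfIntegral.presentation_eq_of rfl).symm⟩
    · rintro _ ⟨f, rfl⟩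
      obtain ⟨P, hP, h⟩ := HalfIntegral.exists_aeval_gen_eq f.2
      exact ⟨P, hP, HalfIntegral.presentation_eq_of h⟩
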